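/- **Theorem 2.1.** Let $H$ be an infinite-dimensional real Hilbert space and let $A:D(A)\to H$ be a positive self-adjoint operator in $H$ with compact inverse. Let $0<\lambda_1\le\lambda_2\le\cdots$ be its eigenvalues, counted with multiplicity, with a corresponding orthonormal basis of eigenvectors $\{e_n\}_{n\ge1}$, and suppose that $$L_0:=\sup_{n\in\mathbb N}(\lambda_{n+1}-\lambda_n)<\infty .$$ Then for every $L>\frac12L_0$ such that, in addition, $L>\lambda_2$, there is a nonlinearity $F\in C^\infty(H,H)$ with $$\|F(u)-F(v)\|\le L\|u-v\|\qquad\text{for all }u,v\in H,$$ such that the equation $\partial_tu+Au=F(u)$, $u|_{t=0}=u_0\in H$, is uniquely solvable on $[0,\infty)$ for every $u_0\in H$ (solutions being continuous with values in $H$ and satisfying $\frac{d}{dt}\langle\varphi,u\rangle=-\langle A\varphi,u\rangle+\langle\varphi,F(u)\rangle$ for all $\varphi\in D(A)$), its solution semigroup $S(t)$ possesses a global attractor $\mathcal A$ (a compact set with $S(t)\mathcal A=\mathcal A$ for all $t\ge0$ that attracts every bounded set uniformly), and: 1. $\mathcal A$ contains two complete trajectories $u,v:\mathbb R\to\mathcal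 A$ of $S(t)$, with $u(t)\ne v(t)$ for all $t$, such that, for some constants $C,\kappa>0$, $$\|u(t)-v(t)\|\le Ce^{-\kappa t^2}\qquad\text{for all }t\ge0;$$ 2. $\mathcal A$ has no bi-Lipschitz Mañé projection: for no finite-dimensional subspace $V\subset H$ is the orthogonal projection onto $V$ injective on $\mathcal A$ with Lipschitz inverse; 3. no finite-dimensional Lipschitz submanifold $M\subset H$ with $S(t)M\subset M$ for all $t\ge0$ contains $\mathcal A$; in particular there is no Lipschitz inertial manifold. Here a Lipschitz submanifold of dimension $n$ is a set which near each of its points is the graph of a Lipschitz map from an $n$-dimensional subspace $V$ to $V^\perp$. -/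

import Mathlib

open Set
open scoped ContDiff NNReal

section SemilinearParabolic

variable {H : Type*} [NormedAddCommGroup H] [InnerProductSpace ℝ H]

/-- The (possibly unbounded) operator `A` is invertible and its inverse is a bounded, compact
operator on the whole space. -/
def HasCompactInverse (A : H →ₗ.[ℝ] H) : Prop :=
  ∃ T : H →L[ℝ] H, IsCompactOperator T ∧
    (∀ f : H, ∃ h : T f ∈ A.domain, A ⟨T f, h⟩ = f) ∧
    (∀ x : A.domain, T (A x) = (x : H))

/-- `u : [0, ∞) → H` (values at negative times are ignored) is a solution of
`∂ₜ u + A u = F u`: it is continuous with values in `H` and the equation holds when tested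
against every element of the domain of the self-adjoint operator `A`,
`d/dt ⟪φ, u⟫ = - ⟪A φ, u⟫ + ⟪φ, F u⟫`. For continuous `F` this is the usual notion of weak, or
equivalently mild, solution. -/
def IsParabolicSolution (A : H →ₗ.[ℝ] H) (F : H → H) (u : ℝ → H) : Prop :=
  ContinuousOn u (Ici 0) ∧
    ∀ φ : A.domain, ∀ t : ℝ, 0 ≤ t →
      HasDerivWithinAt (fun s => inner ℝ (φ : H) (u s))
        (- inner ℝ (A φ) (u t) + inner ℝ (φ : H) (F (u t))) (Ici 0) t

/-- The Cauchy problem `∂ₜ u + A u = F u`, `u(0) = u₀` is uniquely solvable on `[0, ∞)` for every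
`u₀ : H`, and `S t` maps `u₀` to the value of the solution at time `t ≥ 0`. -/
def IsSolutionSemigroup (A : H →ₗ.[ℝ] H) (F : H → H) (S : ℝ → H → H) : Prop :=
  (∀ u₀ : H, S 0 u₀ = u₀ ∧ IsParabolicSolution A F (fun t => S t u₀)) ∧
    ∀ u : ℝ → H, IsParabolicSolution A F u → ∀ t : ℝ, 0 ≤ t → u t = S t (u 0)

/-- Global attractor: a compact set, strictly invariant, attracting every bounded set. -/
structure IsGlobalAttractor (S : ℝ → H → H) (𝒜 : Set H) : Prop where
  isCompact : IsCompact 𝒜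
  invariant : ∀ t : ℝ, 0 ≤ t → S t '' 𝒜 = 𝒜
  attracts : ∀ B : Set H, Bornology.IsBounded B → ∀ ε : ℝ, 0 < ε →
    ∃ T : ℝ, ∀ t : ℝ, T ≤ t → S t '' B ⊆ Metric.thickening ε 𝒜

/-- `u : ℝ → H` is a complete (defined for all times) trajectory of the semigroup `S` that lies
in the set `𝒜`. -/
def IsCompleteTrajectoryIn (S : ℝ → H → H) (𝒜 : Set H) (u : ℝ → H) : Prop :=
  (∀ t : ℝ, u t ∈ 𝒜) ∧ ∀ s t : ℝ, 0 ≤ t → u (s + t) = S t (u s)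

/-- The orthogonal projection onto the finite-dimensional subspace `V` is injective on `𝒜` with
Lipschitz inverse. (It is itself Lipschitz, so this makes it bi-Lipschitz on `𝒜`.) -/
def IsBiLipschitzManeProjection (𝒜 : Set H) (V : Submodule ℝ H) [FiniteDimensional ℝ V] : Prop :=
  ∃ K : ℝ, ∀ p ∈ 𝒜, ∀ q ∈ 𝒜,
    ‖p - q‖ ≤ K * ‖V.orthogonalProjectionOnto p - V.orthogonalProjectionOnto q‖

/-- `M` is an `n`-dimensional Lipschitz submanifold of `H`: near each of its points it is the graph
of a Lipschitz map from an `n`-dimensional subspace to its orthogonal complement. In particular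
the graph of a Lipschitz map over a single `n`-dimensional subspace is such a submanifold. -/
def IsLipschitzSubmanifold (n : ℕ) (M : Set H) : Prop :=
  ∀ p ∈ M, ∃ V : Submodule ℝ H, FiniteDimensional ℝ V ∧ Module.finrank ℝ V = n ∧
    ∃ (K : ℝ≥0) (Φ : V → Vᗮ) (U : Set H), LipschitzWith K Φ ∧ IsOpen U ∧ p ∈ U ∧
      M ∩ U = range (fun x : V => (x : H) + (Φ x : H)) ∩ U

end SemilinearParabolic

namespace SemilinearParabolic

open Filter Topology

variable {H : Type*} [NormedAddCommGroup H] [InnerProductSpace ℝ H]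

/-! ### Coordinates in the eigenbasis -/

section Basis

/-! The obstruction is super-exponential convergence. If a compact set embeds, even locally,
bi-Lipschitzly under finite-dimensional orthogonal projections, then the difference of two nearby
trajectories in it is controlled by finitely many of its eigenmodes. The energy `G` of those modes
satisfies `G' ≥ -c G`, so the difference decays at most exponentially (`exists_exp_le_norm_sub`,
`false_of_locally_biLipschitz`). A Lipschitz manifold containing the set gives such local
embeddings. It is therefore enough to build `F` for which the attractor contains two distinct
trajectories whose distance is at most of order `exp (-κ t ^ 2)`.

The construction is a clock driving a conveyor belt. In the plane of `e 0`, `e 1` the nonlinearity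
cancels `A` and leaves a slow planar field of size `ε`: its trajectory leaves the origin along the
first axis and then circles the origin forever (`exists_clock`). Cancelling `A` on this plane costs
a Lipschitz constant `ev 1`, hence the condition `L > ev 1`. The two trajectories are the clock
alone and the clock plus a small perturbation `w` orthogonal to its velocity or to its plane. Each
time the clock crosses the strip `1/3 ≤ x ≤ 2/3`, `w` is rotated from one mode of a chain `c k` to
the next, so that its decay rate climbs up the spectrum. After `k` half-turns the rate is at least
of order `k`, while each half-turn lasts at least `π / ε`; summing the rates gives decay quadratic
in `t` in the exponent.

Rotating two modes into each other leaves the ratio prescribed by the angle intact only if both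
decay at the same rate. If their eigenvalues differ by `2 d`, adding `-d` on the lower mode and `+d`
on the higher one moves both rates to the mean. This costs a Lipschitz constant `d`, at most half of
the largest gap, hence the condition `L > L₀ / 2`. The rotation itself is slow, of order `ε`, and
hence cheap. Because the clock coordinates, the first-mode correction and the remaining modes occupy
orthogonal blocks, the costs combine as a maximum and not as a sum (`norm_mainPart_sub_le`). All
couplings are truncated at amplitude `ε`, so the variation of their coefficients with the clock
position contributes only `O(ε)`.

For negative times the clock sits on the segment joining the origin to `e 0`. There `e 1` is also an
unstable direction, so a perturbation along `e 1` tends to zero backwards and the perturbed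
trajectory is bounded for all times; a central gate turns it into `e (c 1)` before the circling
begins (`IsAdapted.exists_backward`). Boundedness of `F` and growth of the eigenvalues give a
compact absorbing set, thus a global attractor, which contains every bounded complete trajectory. -/

theorem hasSum_inner_sq (e : HilbertBasis ℕ ℝ H) (x : H) :
    HasSum (fun n => inner ℝ (e n) x ^ 2) (‖x‖ ^ 2) := by
  have h := e.hasSum_inner_mul_inner x x
  rw [real_inner_self_eq_norm_sq] at h
  refine h.congr_fun fun n => ?_
  rw [real_inner_comm x (e n), sq]

theorem ext_inner_basis (e : HilbertBasis ℕ ℝ H) {x y : H}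
    (h : ∀ n, inner ℝ (e n) x = inner ℝ (e n) y) : x = y := by
  have := hasSum_inner_sq e (x - y)
  simp only [inner_sub_right, h, sub_self] at this
  have h0 : ‖x - y‖ ^ 2 = 0 := this.unique (by simp)
  exact sub_eq_zero.1 (norm_eq_zero.1 (pow_eq_zero_iff two_ne_zero |>.1 h0))

theorem norm_le_of_inner_sq_le (e : HilbertBasis ℕ ℝ H) {x : H} {C : ℝ} (hC : 0 ≤ C)
    (h : ∀ N, ∑ n ∈ Finset.range N, inner ℝ (e n) x ^ 2 ≤ C ^ 2) : ‖x‖ ≤ C := by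
  refine le_of_sq_le_sq ?_ hC
  exact le_of_tendsto (hasSum_inner_sq e x).tendsto_sum_nat (Eventually.of_forall h)

theorem sum_inner_sq_le (e : HilbertBasis ℕ ℝ H) (x : H) (s : Finset ℕ) :
    ∑ n ∈ s, inner ℝ (e n) x ^ 2 ≤ ‖x‖ ^ 2 :=
  sum_le_hasSum s (fun _ _ => sq_nonneg _) (hasSum_inner_sq e x)

theorem inner_basis (e : HilbertBasis ℕ ℝ H) (m n : ℕ) :
    inner ℝ (e m) (e n) = if m = n then 1 else 0 :=
  orthonormal_iff_ite.1 e.orthonormal m n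

/-- A permutation of the coordinates is isometric and bounded weights cost at most their supremum.
The trivial permutation gives the semigroup, the tail projections and the balancing operators;
involutions with signs give the rotations of pairs of modes. -/
theorem exists_permuted_multiplier (e : HilbertBasis ℕ ℝ H) (σ : Equiv.Perm ℕ) (b : ℕ → ℝ) {C : ℝ}
    (hC : ∀ n, |b n| ≤ C) : ∃ T : H →L[ℝ] H, ‖T‖ ≤ C ∧
      ∀ n x, inner ℝ (e n) (T x) = b n * inner ℝ (e (σ n)) x := by
  have hC0 : 0 ≤ C := (abs_nonneg _).trans (hC 0)
  have hs : ∀ x : H, Summable fun n => (b n * inner ℝ (e (σ n)) x) ^ 2 := fun x => by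
    have h1 : Summable fun n => C ^ 2 * inner ℝ (e (σ n)) x ^ 2 :=
      ((σ.summable_iff (f := fun n => inner ℝ (e n) x ^ 2)).2 (hasSum_inner_sq e x).summable).mul_left _
    refine h1.of_nonneg_of_le (fun _ => sq_nonneg _) fun n => ?_
    rw [mul_pow]
    gcongr ?_ * _
    exact sq_le_sq' (by linarith [neg_abs_le (b n), hC n]) ((le_abs_self _).trans (hC n))
  have hm : ∀ x : H, Memℓp (fun n => b n * inner ℝ (e (σ n)) x) 2 := fun x =>
    memℓp_gen (by simpa [← abs_mul] using hs x)
  let T₀ : H →ₗ[ℝ] H :=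
    { toFun := fun x => e.repr.symm ⟨_, hm x⟩
      map_add' := fun x y => by
        rw [← map_add]; congr 1; ext n; simp [inner_add_right, mul_add]; rfl
      map_smul' := fun c x => by
        rw [← map_smul]; congr 1; ext n; simp [inner_smul_right]; ring }
  have hT : ∀ n x, inner ℝ (e n) (T₀ x) = b n * inner ℝ (e (σ n)) x := fun n x => by
    rw [← e.repr_apply_apply]; simp [T₀]
  have hb : ∀ x, ‖T₀ x‖ ≤ C * ‖x‖ := fun x => by
    refine norm_le_of_inner_sq_le e (by positivity) fun N => ?_
    calc ∑ n ∈ Finset.range N, inner ℝ (e n) (T₀ x) ^ 2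
        ≤ ∑ n ∈ Finset.range N, C ^ 2 * inner ℝ (e (σ n)) x ^ 2 := by
          refine Finset.sum_le_sum fun n _ => ?_
          rw [hT, mul_pow]
          gcongr ?_ * _
          exact sq_le_sq' (by linarith [neg_abs_le (b n), hC n]) ((le_abs_self _).trans (hC n))
      _ = C ^ 2 * ∑ m ∈ (Finset.range N).map σ.toEmbedding, inner ℝ (e m) x ^ 2 := by
          rw [← Finset.mul_sum, Finset.sum_map]; rfl
      _ ≤ (C * ‖x‖) ^ 2 := by
          rw [mul_pow]; gcongr; exact sum_inner_sq_le e x _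
  exact ⟨T₀.mkContinuous C hb, T₀.mkContinuous_norm_le hC0 hb, hT⟩

end Basis

/-! ### Smooth truncations with Lipschitz constant one -/

section Truncation

/-- A smooth nondecreasing truncation of the identity at scale one. -/
noncomputable def unitTrunc (s : ℝ) : ℝ :=
  ∫ r in (0 : ℝ)..s, (⟨1, 2, one_pos, one_lt_two⟩ : ContDiffBump (0 : ℝ)) r

theorem hasDerivAt_unitTrunc (s : ℝ) :
    HasDerivAt unitTrunc ((⟨1, 2, one_pos, one_lt_two⟩ : ContDiffBump (0 : ℝ)) s) s :=
  intervalIntegral.integral_hasDerivAt_right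
    ((ContDiffBump.continuous _).intervalIntegrable _ _)
    ((ContDiffBump.continuous _).stronglyMeasurableAtFilter _ _)
    (ContDiffBump.continuous _).continuousAt

theorem contDiff_unitTrunc : ContDiff ℝ ∞ unitTrunc := by
  rw [contDiff_infty_iff_deriv]
  refine ⟨fun s => (hasDerivAt_unitTrunc s).differentiableAt, ?_⟩
  rw [funext fun s => (hasDerivAt_unitTrunc s).deriv]
  exact ContDiffBump.contDiff _

/-- A smooth nondecreasing truncation which is the identity on `[-R, R]` and is constant outside
`[-2R, 2R]`. -/
noncomputable def trunc (R s : ℝ) : ℝ := R * unitTrunc (s / R)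

theorem contDiff_trunc (R : ℝ) : ContDiff ℝ ∞ (trunc R) :=
  contDiff_const.mul (contDiff_unitTrunc.comp (contDiff_id.div_const R))

theorem hasDerivAt_trunc {R : ℝ} (hR : 0 < R) (s : ℝ) :
    HasDerivAt (trunc R) ((⟨1, 2, one_pos, one_lt_two⟩ : ContDiffBump (0 : ℝ)) (s / R)) s := by
  have := ((hasDerivAt_unitTrunc (s / R)).comp s ((hasDerivAt_id s).div_const R)).const_mul R
  refine this.congr_deriv ?_
  field_simp

theorem deriv_trunc_mem {R : ℝ} (hR : 0 < R) (s : ℝ) : deriv (trunc R) s ∈ Icc (0 : ℝ) 1 := by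
  rw [(hasDerivAt_trunc hR s).deriv]
  exact ⟨ContDiffBump.nonneg _, ContDiffBump.le_one _⟩

theorem deriv_trunc_of_le {R : ℝ} (hR : 0 < R) {s : ℝ} (h : |s| ≤ R) : deriv (trunc R) s = 1 := by
  rw [(hasDerivAt_trunc hR s).deriv]
  refine ContDiffBump.one_of_mem_closedBall _ ?_
  simp only [mem_closedBall_zero_iff, Real.norm_eq_abs, abs_div, abs_of_pos hR]
  exact div_le_one_of_le₀ h hR.le

theorem deriv_trunc_of_ge {R : ℝ} (hR : 0 < R) {s : ℝ} (h : 2 * R ≤ |s|) :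
    deriv (trunc R) s = 0 := by
  rw [(hasDerivAt_trunc hR s).deriv]
  refine ContDiffBump.zero_of_le_dist _ ?_
  simp only [dist_zero_right, Real.norm_eq_abs, abs_div, abs_of_pos hR]
  exact (le_div_iff₀ hR).2 h

theorem differentiable_trunc {R : ℝ} : Differentiable ℝ (trunc R) :=
  (contDiff_trunc R).differentiable (by simp)

theorem trunc_zero (R : ℝ) : trunc R 0 = 0 := by simp [trunc, unitTrunc]

theorem monotone_trunc {R : ℝ} (hR : 0 < R) : Monotone (trunc R) :=
  monotone_of_deriv_nonneg differentiable_trunc fun s => (deriv_trunc_mem hR s).1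

theorem abs_trunc_sub_le {R : ℝ} (hR : 0 < R) (s t : ℝ) : |trunc R s - trunc R t| ≤ |s - t| := by
  have := Convex.norm_image_sub_le_of_norm_deriv_le (f := trunc R) (C := 1) (s := univ)
    (fun x _ => differentiable_trunc x) (fun x _ => by
      rw [Real.norm_eq_abs, abs_of_nonneg (deriv_trunc_mem hR x).1]
      exact (deriv_trunc_mem hR x).2) convex_univ (mem_univ t) (mem_univ s)
  simpa using this

theorem trunc_of_abs_le {R : ℝ} (hR : 0 < R) {s : ℝ} (h : |s| ≤ R) : trunc R s = s := by
  have hd : ∀ x ∈ Icc (-R) R, HasDerivWithinAt (fun x => trunc R x - x) 0 (Icc (-R) R) x :=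
    fun x hx => by
      have := (differentiable_trunc (R := R) x).hasDerivAt.sub (hasDerivAt_id x)
      rw [deriv_trunc_of_le hR (abs_le.2 hx), sub_self] at this
      exact this.hasDerivWithinAt
  have := (convex_Icc (-R) R).norm_image_sub_le_of_norm_hasDerivWithin_le (C := 0)
    hd (fun x _ => by simp) (⟨by linarith, hR.le⟩ : (0 : ℝ) ∈ Icc (-R) R) (abs_le.1 h)
  simp only [trunc_zero, sub_self, sub_zero, zero_mul, norm_le_zero_iff] at this
  linarith

theorem trunc_neg (R s : ℝ) : trunc R (-s) = - trunc R s := by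
  have : unitTrunc (-(s / R)) = - unitTrunc (s / R) := by
    unfold unitTrunc
    have h := intervalIntegral.integral_comp_neg (a := 0) (b := -(s / R))
      (fun r => (⟨1, 2, one_pos, one_lt_two⟩ : ContDiffBump (0 : ℝ)) r)
    simp only [ContDiffBump.neg, neg_neg, neg_zero] at h
    rw [h, intervalIntegral.integral_symm]
  simp [trunc, neg_div, this]

theorem abs_trunc_le {R : ℝ} (hR : 0 < R) (s : ℝ) : |trunc R s| ≤ 2 * R := by
  have key : ∀ s, 2 * R ≤ s → trunc R s = trunc R (2 * R) := fun s hs => by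
    have := (convex_Ici (2 * R)).norm_image_sub_le_of_norm_hasDerivWithin_le (C := 0)
      (f := trunc R) (f' := fun _ => 0)
      (fun x hx => by
        have := (differentiable_trunc (R := R) x).hasDerivAt
        rw [deriv_trunc_of_ge hR ((mem_Ici.1 hx).trans (le_abs_self x))] at this
        exact this.hasDerivWithinAt) (fun x _ => by simp) (self_mem_Ici) (mem_Ici.2 hs)
    simpa [sub_eq_zero] using this
  have h2 : |trunc R (2 * R)| ≤ 2 * R := by
    have := abs_trunc_sub_le hR (2 * R) 0
    simpa [trunc_zero, abs_of_pos hR] using this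
  rcases le_total (2 * R) |s| with h | h
  · rcases abs_cases s with ⟨hs, _⟩ | ⟨hs, _⟩
    · rw [key s (hs ▸ h)]; exact h2
    · rw [← neg_neg s, trunc_neg, abs_neg, key (-s) (hs ▸ h)]; exact h2
  · have := abs_trunc_sub_le hR s 0
    simp only [trunc_zero, sub_zero] at this
    exact this.trans h

/-- The radial truncation of the identity at scale `R`. -/
noncomputable def radialTrunc (R : ℝ) (w : H) : H := (trunc R ‖w‖ / ‖w‖) • w

theorem radialTrunc_of_norm_le {R : ℝ} (hR : 0 < R) {w : H} (h : ‖w‖ ≤ R) :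
    radialTrunc R w = w := by
  rcases eq_or_ne w 0 with rfl | hw
  · simp [radialTrunc]
  · rw [radialTrunc, trunc_of_abs_le hR (by rwa [abs_norm]), div_self (norm_ne_zero_iff.2 hw),
      one_smul]

/-- The norm fails to be smooth only at the origin, and near it the truncation is the identity. -/
theorem contDiff_radialTrunc {R : ℝ} (hR : 0 < R) : ContDiff ℝ ∞ (radialTrunc R : H → H) := by
  rw [contDiff_iff_contDiffAt]
  intro w
  rcases eq_or_ne w 0 with rfl | hw
  · refine contDiffAt_id.congr_of_eventuallyEq ?_
    filter_upwards [Metric.ball_mem_nhds (0 : H) hR] with x hx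
    exact radialTrunc_of_norm_le hR (by simpa using (mem_ball_zero_iff.1 hx).le)
  · exact (((contDiff_trunc R).contDiffAt.comp w (contDiffAt_norm ℝ hw)).div
      (contDiffAt_norm ℝ hw) (norm_ne_zero_iff.2 hw)).smul contDiffAt_id

theorem trunc_nonneg {R : ℝ} (hR : 0 < R) {s : ℝ} (hs : 0 ≤ s) : 0 ≤ trunc R s := by
  simpa [trunc_zero] using monotone_trunc hR hs

theorem trunc_div_mem {R : ℝ} (hR : 0 < R) {s : ℝ} (hs : 0 ≤ s) :
    trunc R s / s ∈ Icc (0 : ℝ) 1 := by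
  refine ⟨div_nonneg (trunc_nonneg hR hs) hs, div_le_one_of_le₀ ?_ hs⟩
  have := abs_trunc_sub_le hR s 0
  simp only [trunc_zero, sub_zero, abs_of_nonneg hs] at this
  exact (le_abs_self _).trans this

theorem norm_radialTrunc {R : ℝ} (hR : 0 < R) (w : H) : ‖radialTrunc R w‖ = trunc R ‖w‖ := by
  rcases eq_or_ne w 0 with rfl | hw
  · simp [radialTrunc, trunc_zero]
  · rw [radialTrunc, norm_smul, Real.norm_of_nonneg (trunc_div_mem hR (norm_nonneg w)).1,
      div_mul_cancel₀ _ (norm_ne_zero_iff.2 hw)]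

theorem norm_radialTrunc_le {R : ℝ} (hR : 0 < R) (w : H) : ‖radialTrunc R w‖ ≤ 2 * R := by
  rw [norm_radialTrunc hR]
  exact (le_abs_self _).trans (abs_trunc_le hR _)

/-- The squared distance splits into a radial part `(‖v‖ - ‖w‖) ^ 2` and an angular part `2 (‖v‖ ‖w‖
- ⟪v, w⟫)`. The truncation contracts the first and multiplies the second by a factor at most one. A
constant of exactly one matters: it multiplies the critical cost `Δ`. -/
theorem norm_radialTrunc_sub_le {R : ℝ} (hR : 0 < R) (v w : H) :
    ‖radialTrunc R v - radialTrunc R w‖ ≤ ‖v - w‖ := by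
  refine le_of_sq_le_sq ?_ (norm_nonneg _)
  have ha := trunc_div_mem hR (norm_nonneg v)
  have hb := trunc_div_mem hR (norm_nonneg w)
  have h1 : ‖radialTrunc R v - radialTrunc R w‖ ^ 2 = (trunc R ‖v‖ - trunc R ‖w‖) ^ 2 +
      2 * ((trunc R ‖v‖ / ‖v‖) * (trunc R ‖w‖ / ‖w‖)) * (‖v‖ * ‖w‖ - inner ℝ v w) := by
    rw [norm_sub_sq_real, norm_radialTrunc hR, norm_radialTrunc hR]
    have h2 : trunc R ‖v‖ * trunc R ‖w‖
        = (trunc R ‖v‖ / ‖v‖) * (trunc R ‖w‖ / ‖w‖) * (‖v‖ * ‖w‖) := by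
      rcases eq_or_ne v 0 with rfl | hv
      · simp [trunc_zero]
      rcases eq_or_ne w 0 with rfl | hw
      · simp [trunc_zero]
      have := norm_ne_zero_iff.2 hv
      have := norm_ne_zero_iff.2 hw
      field_simp
    simp only [radialTrunc, inner_smul_left, inner_smul_right, RCLike.conj_to_real]
    linear_combination 2 * h2
  have h3 := sq_le_sq.2 (abs_trunc_sub_le hR ‖v‖ ‖w‖)
  have h4 := real_inner_le_norm v w
  have h5 : (trunc R ‖v‖ / ‖v‖) * (trunc R ‖w‖ / ‖w‖) ≤ 1 := mul_le_one₀ ha.2 hb.1 hb.2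
  rw [h1, norm_sub_sq_real]
  nlinarith [mul_le_mul_of_nonneg_right h5 (sub_nonneg.2 h4)]

end Truncation

/-! ### Mild solutions by the contraction principle -/

section FixedPoint

variable {X : Type*} [NormedAddCommGroup X] [NormedSpace ℝ X] [CompleteSpace X]

/-- With the unknown rescaled to `exp (-κ t) u t`, `κ = K + 1`, the Duhamel map is a contraction
with factor `K / (K + 1)` on the whole half-line, so the solution is global at once. Boundedness of
`F` keeps the rescaled functions bounded. Only joint continuity of `(t, x) ↦ E t x` is assumed, so
both `exp (-tA)` and the constant identity (for ordinary differential equations) are admissible. -/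
theorem exists_mild_solution (E : ℝ → X →L[ℝ] X) (hE : Continuous fun p : ℝ × X => E p.1 p.2)
    (hE1 : ∀ t, ‖E t‖ ≤ 1) {F : X → X} {K : ℝ≥0} (hF : LipschitzWith K F) {C : ℝ}
    (hC : ∀ x, ‖F x‖ ≤ C) (u₀ : X) :
    ∃ u : ℝ → X, Continuous u ∧
      ∀ t, 0 ≤ t → u t = E t u₀ + ∫ s in (0 : ℝ)..t, E (t - s) (F (u s)) := by
  have hC0 : 0 ≤ C := (norm_nonneg _).trans (hC 0)
  set κ : ℝ := K + 1 with hκ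
  have hκ1 : 1 ≤ κ := by simp [hκ]
  have hκ0 : 0 < κ := by linarith
  have hE1' : ∀ t x, ‖E t x‖ ≤ ‖x‖ := fun t x =>
    ((E t).le_opNorm x).trans (mul_le_of_le_one_left (norm_nonneg _) (hE1 t))
  let f : (BoundedContinuousFunction ℝ X) → ℝ → ℝ → X :=
    fun v τ s => E (τ - s) (F (Real.exp (κ * s) • v s))
  have hf : ∀ v, Continuous fun p : ℝ × ℝ => f v p.1 p.2 := fun v => by
    have h1 : Continuous fun p : ℝ × ℝ => F (Real.exp (κ * p.2) • v p.2) :=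
      hF.continuous.comp (by fun_prop : Continuous fun p : ℝ × ℝ => Real.exp (κ * p.2) • v p.2)
    exact hE.comp ((continuous_fst.sub continuous_snd).prodMk h1)
  have hfs : ∀ v τ, Continuous (f v τ) := fun v τ =>
    (hf v).comp (by fun_prop : Continuous fun s : ℝ => (τ, s))
  -- Replacing `t` by `max t 0` freezes the map at negative times, so that it acts on bounded
  -- continuous functions on all of `ℝ`.
  let Q : (BoundedContinuousFunction ℝ X) → ℝ → X := fun v t =>
    Real.exp (-(κ * max t 0)) • (E (max t 0) u₀ + ∫ s in (0 : ℝ)..max t 0, f v (max t 0) s)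
  have hQc : ∀ v, Continuous (Q v) := fun v => by
    have h1 : Continuous fun t : ℝ => ∫ s in (0 : ℝ)..max t 0, f v (max t 0) s := by
      refine intervalIntegral.continuous_parametric_intervalIntegral_of_continuous
        (f := fun t s => f v (max t 0) s) ?_ (by fun_prop)
      exact (hf v).comp (by fun_prop : Continuous fun p : ℝ × ℝ => (max p.1 0, p.2))
    have h2 : Continuous fun t : ℝ => E (max t 0) u₀ :=
      hE.comp ((continuous_id.max continuous_const).prodMk continuous_const)
    have h3 : Continuous fun t : ℝ => Real.exp (-(κ * max t 0)) := by fun_prop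
    exact h3.smul (h2.add h1)
  have hQb : ∀ v t, ‖Q v t‖ ≤ ‖u₀‖ + C := fun v t => by
    set τ := max t 0 with hτ
    have hτ0 : 0 ≤ τ := le_max_right _ _
    have h1 : ‖∫ s in (0 : ℝ)..τ, f v τ s‖ ≤ C * |τ - 0| :=
      intervalIntegral.norm_integral_le_of_norm_le_const fun s _ => (hE1' _ _).trans (hC _)
    rw [sub_zero, abs_of_nonneg hτ0] at h1
    have h2 : τ ≤ Real.exp (κ * τ) := by
      nlinarith [Real.add_one_le_exp (κ * τ)]
    have h3 : Real.exp (-(κ * τ)) * τ ≤ 1 := by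
      rw [Real.exp_neg, inv_mul_le_iff₀ (Real.exp_pos _), mul_one]; exact h2
    have h4 : Real.exp (-(κ * τ)) ≤ 1 := Real.exp_le_one_iff.2 (by nlinarith)
    calc ‖Q v t‖ = Real.exp (-(κ * τ)) * ‖E τ u₀ + ∫ s in (0 : ℝ)..τ, f v τ s‖ := by
          simp only [Q, norm_smul, Real.norm_eq_abs, Real.abs_exp, ← hτ]
      _ ≤ Real.exp (-(κ * τ)) * (‖u₀‖ + C * τ) := by
          gcongr; exact (norm_add_le _ _).trans (add_le_add (hE1' _ _) h1)
      _ ≤ ‖u₀‖ + C := by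
          nlinarith [norm_nonneg u₀, Real.exp_pos (-(κ * τ)), mul_le_mul_of_nonneg_left h3 hC0,
            mul_le_mul_of_nonneg_right h4 (norm_nonneg u₀)]
  let P : BoundedContinuousFunction ℝ X → BoundedContinuousFunction ℝ X := fun v =>
    BoundedContinuousFunction.ofNormedAddCommGroup (Q v) (hQc v) _ (hQb v)
  have hP : ContractingWith (K / (K + 1)) P := by
    refine ⟨by rw [div_lt_one (by positivity)]; exact lt_add_one K, ?_⟩
    refine LipschitzWith.of_dist_le_mul fun v w => ?_
    refine (BoundedContinuousFunction.dist_le (by positivity)).2 fun t => ?_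
    set τ := max t 0 with hτ
    have hτ0 : 0 ≤ τ := le_max_right _ _
    have h1 : ‖(∫ s in (0 : ℝ)..τ, f v τ s) - ∫ s in (0 : ℝ)..τ, f w τ s‖
        ≤ ∫ s in (0 : ℝ)..τ, K * dist v w * Real.exp (κ * s) := by
      rw [← intervalIntegral.integral_sub ((hfs v τ).intervalIntegrable _ _)
        ((hfs w τ).intervalIntegrable _ _)]
      refine intervalIntegral.norm_integral_le_of_norm_le hτ0 (Eventually.of_forall fun s _ => ?_)
        (Continuous.intervalIntegrable (by fun_prop) _ _)
      simp only [f, ← map_sub]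
      refine (hE1' _ _).trans ((hF.norm_sub_le _ _).trans ?_)
      rw [← smul_sub, norm_smul, Real.norm_eq_abs, Real.abs_exp, ← dist_eq_norm]
      have := BoundedContinuousFunction.dist_coe_le_dist (f := v) (g := w) s
      calc (K : ℝ) * (Real.exp (κ * s) * dist (v s) (w s))
          ≤ K * (Real.exp (κ * s) * dist v w) := by gcongr
        _ = _ := by ring
    have h2 : ∫ s in (0 : ℝ)..τ, K * dist v w * Real.exp (κ * s)
        = K * dist v w * ((Real.exp (κ * τ) - 1) / κ) := by
      rw [intervalIntegral.integral_const_mul, intervalIntegral.integral_comp_mul_left _ hκ0.ne',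
        integral_exp]
      simp only [mul_zero, Real.exp_zero, smul_eq_mul]
      ring
    calc dist (P v t) (P w t) = ‖Q v t - Q w t‖ := dist_eq_norm _ _
      _ = Real.exp (-(κ * τ)) * ‖(∫ s in (0 : ℝ)..τ, f v τ s) - ∫ s in (0 : ℝ)..τ, f w τ s‖ := by
          simp only [Q, ← smul_sub, norm_smul, Real.norm_eq_abs, Real.abs_exp, ← hτ]
          congr 2; abel
      _ ≤ Real.exp (-(κ * τ)) * (K * dist v w * ((Real.exp (κ * τ) - 1) / κ)) := by
          gcongr; exact h1.trans_eq h2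
      _ = K / κ * dist v w * (1 - Real.exp (-(κ * τ))) := by
          have : Real.exp (-(κ * τ)) * Real.exp (κ * τ) = 1 := by
            rw [← Real.exp_add]; simp
          field_simp
          linear_combination (K * dist v w : ℝ) * this
      _ ≤ K / κ * dist v w := by
          have := Real.exp_pos (-(κ * τ))
          exact mul_le_of_le_one_right (by positivity) (by linarith)
      _ = ((K / (K + 1) : ℝ≥0) : ℝ) * dist v w := by simp [hκ]
  obtain ⟨v, hv⟩ : ∃ v, P v = v := ⟨hP.fixedPoint, hP.fixedPoint_isFixedPt⟩
  refine ⟨fun t => Real.exp (κ * t) • v t, by fun_prop, fun t ht => ?_⟩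
  have h1 : v t = Q v t := (DFunLike.congr_fun hv t).symm
  simp only [h1, Q, max_eq_left ht, f, smul_smul]
  rw [← Real.exp_add]
  simp

/-- A bounded Lipschitz vector field has a global forward trajectory through every point. -/
theorem exists_forward_trajectory {F : X → X} {K : ℝ≥0} (hF : LipschitzWith K F) {C : ℝ}
    (hC : ∀ x, ‖F x‖ ≤ C) (x₀ : X) :
    ∃ u : ℝ → X, Continuous u ∧ u 0 = x₀ ∧
      ∀ t, 0 ≤ t → HasDerivWithinAt u (F (u t)) (Ici 0) t := by
  obtain ⟨u, hu, h⟩ := exists_mild_solution (fun _ => ContinuousLinearMap.id ℝ X)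
    (by simpa using continuous_snd)
    (fun _ => ContinuousLinearMap.norm_id_le) hF hC x₀
  simp only [ContinuousLinearMap.id_apply] at h
  refine ⟨u, hu, by simpa using h 0 le_rfl, fun t ht => ?_⟩
  have hc : Continuous fun s => F (u s) := hF.continuous.comp hu
  have h1 : HasDerivAt (fun t => x₀ + ∫ s in (0 : ℝ)..t, F (u s)) (F (u t)) t :=
    (intervalIntegral.integral_hasDerivAt_right (hc.intervalIntegrable _ _)
      (hc.stronglyMeasurableAtFilter _ _) hc.continuousAt).const_add _
  exact h1.hasDerivWithinAt.congr (fun s hs => h s hs) (h t ht)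

end FixedPoint

/-! ### The semigroup of `A` and the spectral tail projections -/

section Multipliers

/-- The bounded operator which is diagonal in the basis `e`, with the bounded sequence `b` of
eigenvalues. -/
noncomputable def diag (e : HilbertBasis ℕ ℝ H) (b : ℕ → ℝ) (hb : ∃ C, ∀ n, |b n| ≤ C) :
    H →L[ℝ] H :=
  (exists_permuted_multiplier e (Equiv.refl ℕ) b hb.choose_spec).choose

theorem inner_diag (e : HilbertBasis ℕ ℝ H) (b : ℕ → ℝ) (hb : ∃ C, ∀ n, |b n| ≤ C) (n : ℕ) (x : H) :
    inner ℝ (e n) (diag e b hb x) = b n * inner ℝ (e n) x :=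
  (exists_permuted_multiplier e (Equiv.refl ℕ) b hb.choose_spec).choose_spec.2 n x

attribute [irreducible] diag

theorem norm_le_of_abs_inner_le (e : HilbertBasis ℕ ℝ H) {x y : H} {C : ℝ} (hC : 0 ≤ C)
    (h : ∀ n, |inner ℝ (e n) y| ≤ C * |inner ℝ (e n) x|) : ‖y‖ ≤ C * ‖x‖ := by
  refine norm_le_of_inner_sq_le e (by positivity) fun N => ?_
  calc ∑ n ∈ Finset.range N, inner ℝ (e n) y ^ 2
      ≤ ∑ n ∈ Finset.range N, C ^ 2 * inner ℝ (e n) x ^ 2 := by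
        refine Finset.sum_le_sum fun n _ => ?_
        rw [← sq_abs, ← sq_abs (inner ℝ (e n) x), ← mul_pow]
        gcongr
        exact h n
    _ = C ^ 2 * ∑ n ∈ Finset.range N, inner ℝ (e n) x ^ 2 := by rw [Finset.mul_sum]
    _ ≤ (C * ‖x‖) ^ 2 := by
        rw [mul_pow]; gcongr; exact sum_inner_sq_le e x _

theorem bounded_heat {ev : ℕ → ℝ} (hev : ∀ n, 0 < ev n) (t : ℝ) :
    ∃ C, ∀ n, |Real.exp (-(ev n * max t 0))| ≤ C :=
  ⟨1, fun n => by
    rw [Real.abs_exp]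
    exact Real.exp_le_one_iff.2 (by have := mul_nonneg (hev n).le (le_max_right t 0); linarith)⟩

/-- The semigroup `exp (-tA)` for `0 ≤ t` (and the identity for `t ≤ 0`). -/
noncomputable def heat (e : HilbertBasis ℕ ℝ H) {ev : ℕ → ℝ} (hev : ∀ n, 0 < ev n) (t : ℝ) :
    H →L[ℝ] H :=
  diag e (fun n => Real.exp (-(ev n * max t 0))) (bounded_heat hev t)

theorem bounded_tail (N : ℕ) : ∃ C : ℝ, ∀ n, |if N ≤ n then (1 : ℝ) else 0| ≤ C :=
  ⟨1, fun n => by split_ifs <;> simp⟩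

/-- The orthogonal projection onto the closed span of the basis vectors `e n`, `N ≤ n`. -/
noncomputable def tailProj (e : HilbertBasis ℕ ℝ H) (N : ℕ) : H →L[ℝ] H :=
  diag e (fun n => if N ≤ n then 1 else 0) (bounded_tail N)

theorem inner_tailProj (e : HilbertBasis ℕ ℝ H) (N n : ℕ) (x : H) :
    inner ℝ (e n) (tailProj e N x) = if N ≤ n then inner ℝ (e n) x else 0 := by
  rw [tailProj, inner_diag]; split_ifs <;> simp

theorem norm_tailProj_le (e : HilbertBasis ℕ ℝ H) (N : ℕ) (x : H) : ‖tailProj e N x‖ ≤ ‖x‖ := by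
  rw [← one_mul ‖x‖]
  refine norm_le_of_abs_inner_le e zero_le_one fun n => ?_
  rw [inner_tailProj]; split_ifs <;> simp

theorem tailProj_zero (e : HilbertBasis ℕ ℝ H) (x : H) : tailProj e 0 x = x :=
  ext_inner_basis e fun n => by simp [inner_tailProj]

theorem sub_tailProj (e : HilbertBasis ℕ ℝ H) (N : ℕ) (x : H) :
    x - tailProj e N x = ∑ n ∈ Finset.range N, inner ℝ (e n) x • e n := by
  refine ext_inner_basis e fun n => ?_
  simp only [inner_sub_right, inner_tailProj, inner_sum, inner_smul_right, inner_basis, mul_ite,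
    mul_one, mul_zero, Finset.sum_ite_eq, Finset.mem_range]
  by_cases h : N ≤ n
  · simp [h]
  · simp [h, not_le.1 h]

theorem inner_heat (e : HilbertBasis ℕ ℝ H) {ev : ℕ → ℝ} (hev : ∀ n, 0 < ev n) (t : ℝ) (n : ℕ)
    (x : H) : inner ℝ (e n) (heat e hev t x) = Real.exp (-(ev n * max t 0)) * inner ℝ (e n) x :=
  inner_diag ..

theorem norm_tailProj_heat_le (e : HilbertBasis ℕ ℝ H) {ev : ℕ → ℝ} (hev : ∀ n, 0 < ev n)
    (hmono : Monotone ev) {t : ℝ} (ht : 0 ≤ t) (N : ℕ) (x : H) :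
    ‖tailProj e N (heat e hev t x)‖ ≤ Real.exp (-(ev N * t)) * ‖tailProj e N x‖ := by
  refine norm_le_of_abs_inner_le e (Real.exp_pos _).le fun n => ?_
  rw [inner_tailProj, inner_tailProj, inner_heat, max_eq_left ht]
  split_ifs with h
  · rw [abs_mul, Real.abs_exp]
    gcongr
    exact hmono h
  · simp

theorem norm_heat_le (e : HilbertBasis ℕ ℝ H) {ev : ℕ → ℝ} (hev : ∀ n, 0 < ev n) (t : ℝ) (x : H) :
    ‖heat e hev t x‖ ≤ ‖x‖ := by
  rw [← one_mul ‖x‖]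
  refine norm_le_of_abs_inner_le e zero_le_one fun n => ?_
  rw [inner_heat, abs_mul, Real.abs_exp]
  gcongr
  exact Real.exp_le_one_iff.2 (by have := mul_nonneg (hev n).le (le_max_right t 0); linarith)

/-- Each coordinate is continuous in `t` and the squares are dominated by the coordinates of `x`, so
dominated convergence applies to the Parseval sum. Together with contractivity this gives joint
continuity. -/
theorem continuous_heat_apply (e : HilbertBasis ℕ ℝ H) {ev : ℕ → ℝ} (hev : ∀ n, 0 < ev n) (x : H) :
    Continuous fun t => heat e hev t x := by
  rw [continuous_iff_continuousAt]
  intro s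
  rw [ContinuousAt, tendsto_iff_norm_sub_tendsto_zero]
  have h1 : ∀ t, ‖heat e hev t x - heat e hev s x‖ ^ 2 = ∑' n,
      ((Real.exp (-(ev n * max t 0)) - Real.exp (-(ev n * max s 0))) * inner ℝ (e n) x) ^ 2 := by
    intro t
    rw [← (hasSum_inner_sq e _).tsum_eq]
    simp only [inner_sub_right, inner_heat, sub_mul]
  have h2 : Tendsto (fun t => ‖heat e hev t x - heat e hev s x‖ ^ 2) (𝓝 s) (𝓝 0) := by
    simp only [h1]
    suffices h : Tendsto (fun t => ∑' n, ((Real.exp (-(ev n * max t 0)) -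
        Real.exp (-(ev n * max s 0))) * inner ℝ (e n) x) ^ 2) (𝓝 s) (𝓝 (∑' _ : ℕ, (0 : ℝ))) by
      simpa using h
    refine tendsto_tsum_of_dominated_convergence (hasSum_inner_sq e x).summable (fun n => ?_)
      (Eventually.of_forall fun t n => ?_)
    · have : Continuous fun t : ℝ =>
          ((Real.exp (-(ev n * max t 0)) - Real.exp (-(ev n * max s 0))) * inner ℝ (e n) x) ^ 2 := by
        fun_prop
      simpa using this.tendsto s
    · have hb : ∀ t : ℝ, Real.exp (-(ev n * max t 0)) ∈ Icc (0 : ℝ) 1 := fun t =>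
        ⟨(Real.exp_pos _).le, Real.exp_le_one_iff.2
          (by have := mul_nonneg (hev n).le (le_max_right t 0); linarith)⟩
      rw [Real.norm_of_nonneg (sq_nonneg _), mul_pow]
      refine mul_le_of_le_one_left (sq_nonneg _) ?_
      rw [sq_le_one_iff_abs_le_one, abs_le]
      constructor <;> linarith [(hb t).1, (hb t).2, (hb s).1, (hb s).2]
  have h3 := h2.sqrt
  simpa [Real.sqrt_sq (norm_nonneg _)] using h3

theorem continuous_heat (e : HilbertBasis ℕ ℝ H) {ev : ℕ → ℝ} (hev : ∀ n, 0 < ev n) :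
    Continuous fun p : ℝ × H => heat e hev p.1 p.2 := by
  rw [continuous_iff_continuousAt]
  rintro ⟨s, y⟩
  rw [ContinuousAt, tendsto_iff_norm_sub_tendsto_zero]
  have h1 : Tendsto (fun p : ℝ × H => ‖p.2 - y‖ + ‖heat e hev p.1 y - heat e hev s y‖) (𝓝 (s, y))
      (𝓝 0) := by
    have h2 : Continuous fun p : ℝ × H => ‖p.2 - y‖ + ‖heat e hev p.1 y - heat e hev s y‖ :=
      (continuous_snd.sub continuous_const).norm.add
        (((continuous_heat_apply e hev y).comp continuous_fst).sub continuous_const).norm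
    simpa using h2.tendsto (s, y)
  refine squeeze_zero (fun _ => norm_nonneg _) (fun p => ?_) h1
  have : heat e hev p.1 p.2 - heat e hev s y
      = heat e hev p.1 (p.2 - y) + (heat e hev p.1 y - heat e hev s y) := by
    rw [map_sub]; abel
  rw [this]
  exact (norm_add_le _ _).trans (add_le_add (norm_heat_le ..) le_rfl)

end Multipliers

/-! ### Coordinatewise solutions, uniqueness and the weak formulation -/

section Solutions

/-- `u` is continuous on `[a, b]` and its coordinates in the basis `e` satisfy the equation
`∂ₜ uₙ + ev n * uₙ = (F u)ₙ` there. -/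
def IsCoordSolutionOn (e : HilbertBasis ℕ ℝ H) (ev : ℕ → ℝ) (F : H → H) (u : ℝ → H) (a b : ℝ) :
    Prop :=
  ContinuousOn u (Icc a b) ∧ ∀ n, ∀ t ∈ Ico a b, HasDerivWithinAt (fun s => inner ℝ (e n) (u s))
    (-(ev n * inner ℝ (e n) (u t)) + inner ℝ (e n) (F (u t))) (Ici t) t

theorem IsCoordSolutionOn.mono {e : HilbertBasis ℕ ℝ H} {ev : ℕ → ℝ} {F : H → H} {u : ℝ → H}
    {a b a' b' : ℝ} (h : IsCoordSolutionOn e ev F u a b) (ha : a ≤ a') (hb : b' ≤ b) :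
    IsCoordSolutionOn e ev F u a' b' :=
  ⟨h.1.mono (Icc_subset_Icc ha hb), fun n t ht => h.2 n t ⟨ha.trans ht.1, ht.2.trans_le hb⟩⟩

theorem IsCoordSolutionOn.comp_add {e : HilbertBasis ℕ ℝ H} {ev : ℕ → ℝ} {F : H → H} {u : ℝ → H}
    {a b : ℝ} (h : IsCoordSolutionOn e ev F u a b) (s : ℝ) :
    IsCoordSolutionOn e ev F (fun t => u (s + t)) (a - s) (b - s) := by
  refine ⟨h.1.comp (by fun_prop) fun t ht => ⟨by linarith [ht.1], by linarith [ht.2]⟩,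
    fun n t ht => ?_⟩
  have h1 := h.2 n (s + t) ⟨by linarith [ht.1], by linarith [ht.2]⟩
  have h2 : HasDerivWithinAt (fun r => s + r) 1 (Ici t) t :=
    ((hasDerivAt_id t).const_add s).hasDerivWithinAt
  have := h1.scomp t h2 (fun r hr => by simpa using hr)
  simpa [Function.comp_def] using this

/-- Continuous dependence of solutions on the initial data. -/
theorem IsCoordSolutionOn.norm_sub_le {e : HilbertBasis ℕ ℝ H} {ev : ℕ → ℝ} (hev : ∀ n, 0 < ev n)
    {F : H → H} {K : ℝ} (hK : 0 ≤ K) (hF : ∀ x y, ‖F x - F y‖ ≤ K * ‖x - y‖) {u v : ℝ → H}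
    {a b : ℝ} (hu : IsCoordSolutionOn e ev F u a b) (hv : IsCoordSolutionOn e ev F v a b) {t : ℝ}
    (ht : t ∈ Icc a b) : ‖u t - v t‖ ^ 2 ≤ ‖u a - v a‖ ^ 2 * Real.exp (2 * K * (t - a)) := by
  have hab : a ≤ b := ht.1.trans ht.2
  -- Continuity is known on `[a, b]` only; the extension makes the primitive `Φ` differentiable
  -- everywhere.
  set φ : ℝ → ℝ := IccExtend hab ((Icc a b).domRestrict fun t => 2 * K * ‖u t - v t‖ ^ 2) with hφ
  have hφc : Continuous φ := by
    refine Continuous.Icc_extend' (ContinuousOn.domRestrict ?_)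
    exact ((hu.1.sub hv.1).norm.pow 2).const_smul (2 * K)
  have hφe : ∀ s ∈ Icc a b, φ s = 2 * K * ‖u s - v s‖ ^ 2 := fun s hs => by
    rw [hφ, IccExtend_of_mem hab _ hs]; rfl
  set Φ : ℝ → ℝ := fun s => ‖u a - v a‖ ^ 2 + ∫ r in a..s, φ r with hΦ
  have hΦd : ∀ s, HasDerivAt Φ (φ s) s := fun s =>
    (intervalIntegral.integral_hasDerivAt_right (hφc.intervalIntegrable _ _)
      (hφc.stronglyMeasurableAtFilter _ _) hφc.continuousAt).const_add _
  have hΦa : Φ a = ‖u a - v a‖ ^ 2 := by simp [hΦ]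
  have key : ∀ s ∈ Icc a b, ‖u s - v s‖ ^ 2 ≤ Φ s := by
    intro s hs
    -- The full squared norm need not be differentiable, but its partial sums are. The dissipative
    -- terms have a favourable sign and are dropped, which leaves a bound by `φ` uniform in `N`.
    -- Grönwall is then applied to `Φ`.
    refine le_of_tendsto (hasSum_inner_sq e _).tendsto_sum_nat (Eventually.of_forall fun N => ?_)
    refine image_le_of_deriv_right_le_deriv_boundary
      (f := fun r => ∑ n ∈ Finset.range N, inner ℝ (e n) (u r - v r) ^ 2)
      (f' := fun r => ∑ n ∈ Finset.range N, 2 * inner ℝ (e n) (u r - v r) *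
        (-(ev n * inner ℝ (e n) (u r - v r)) + inner ℝ (e n) (F (u r) - F (v r))))
      (B := Φ) (B' := φ) ?_ (fun r hr => ?_) ?_ (fun r _ => (hΦd r).continuousAt.continuousWithinAt)
      (fun r _ => (hΦd r).hasDerivWithinAt) (fun r hr => ?_) hs
    · exact continuousOn_finsetSum _ fun n _ => (continuousOn_const.inner (hu.1.sub hv.1)).pow 2
    · refine HasDerivWithinAt.fun_sum fun n _ => ?_
      have := ((hu.2 n r hr).sub (hv.2 n r hr)).pow 2
      simp only [inner_sub_right]
      refine this.congr_deriv ?_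
      change ((2 : ℕ) : ℝ) * (inner ℝ (e n) (u r) - inner ℝ (e n) (v r)) ^ 1 * _ = _
      push_cast
      ring
    · rw [hΦa]; exact sum_inner_sq_le e _ _
    · rw [hφe r (Ico_subset_Icc_self hr)]
      calc ∑ n ∈ Finset.range N, 2 * inner ℝ (e n) (u r - v r) *
          (-(ev n * inner ℝ (e n) (u r - v r)) + inner ℝ (e n) (F (u r) - F (v r)))
          ≤ ∑ n ∈ Finset.range N,
            2 * (inner ℝ (e n) (u r - v r) * inner ℝ (e n) (F (u r) - F (v r))) := by
            refine Finset.sum_le_sum fun n _ => ?_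
            nlinarith [mul_nonneg (hev n).le (sq_nonneg (inner ℝ (e n) (u r - v r)))]
        _ = 2 * ∑ n ∈ Finset.range N,
            inner ℝ (e n) (u r - v r) * inner ℝ (e n) (F (u r) - F (v r)) := by
            rw [Finset.mul_sum]
        _ ≤ 2 * (‖u r - v r‖ * ‖F (u r) - F (v r)‖) := by
            gcongr
            refine (Real.sum_mul_le_sqrt_mul_sqrt _ _ _).trans ?_
            gcongr <;> exact Real.sqrt_le_iff.2 ⟨norm_nonneg _, sum_inner_sq_le e _ _⟩
        _ ≤ 2 * (‖u r - v r‖ * (K * ‖u r - v r‖)) := by gcongr; exact hF _ _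
        _ = 2 * K * ‖u r - v r‖ ^ 2 := by ring
  have hΦ0 : ∀ s ∈ Icc a b, 0 ≤ Φ s := fun s hs => (sq_nonneg _).trans (key s hs)
  have hg := norm_le_gronwallBound_of_norm_deriv_right_le (f := Φ) (f' := φ) (δ := Φ a) (K := 2 * K)
    (ε := 0) (a := a) (b := b) (fun r _ => (hΦd r).continuousAt.continuousWithinAt)
    (fun r _ => (hΦd r).hasDerivWithinAt)
    (by rw [Real.norm_of_nonneg (hΦ0 a ⟨le_rfl, hab⟩)]) (fun r hr => by
      have hr' := Ico_subset_Icc_self hr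
      rw [hφe r hr', Real.norm_of_nonneg (by positivity), Real.norm_of_nonneg (hΦ0 r hr'), add_zero]
      gcongr
      exact key r hr') t ht
  rw [gronwallBound_ε0, hΦa, Real.norm_of_nonneg (hΦ0 t ht)] at hg
  exact (key t ht).trans hg

theorem IsCoordSolutionOn.eq_of_eq {e : HilbertBasis ℕ ℝ H} {ev : ℕ → ℝ} (hev : ∀ n, 0 < ev n)
    {F : H → H} {K : ℝ} (hK : 0 ≤ K) (hF : ∀ x y, ‖F x - F y‖ ≤ K * ‖x - y‖) {u v : ℝ → H}
    {a b : ℝ} (hu : IsCoordSolutionOn e ev F u a b) (hv : IsCoordSolutionOn e ev F v a b)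
    (h : u a = v a) {t : ℝ} (ht : t ∈ Icc a b) : u t = v t := by
  have := hu.norm_sub_le hev hK hF hv ht
  rw [h, sub_self, norm_zero, zero_pow two_ne_zero, zero_mul] at this
  exact sub_eq_zero.1 (norm_eq_zero.1 (pow_eq_zero_iff two_ne_zero |>.1
    (le_antisymm this (sq_nonneg _))))

theorem _root_.IsParabolicSolution.isCoordSolutionOn {A : H →ₗ.[ℝ] H} {e : HilbertBasis ℕ ℝ H}
    {ev : ℕ → ℝ} (he : ∀ n, ∃ h : e n ∈ A.domain, A ⟨e n, h⟩ = ev n • e n) {F : H → H} {u : ℝ → H}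
    (hu : IsParabolicSolution A F u) {a b : ℝ} (ha : 0 ≤ a) : IsCoordSolutionOn e ev F u a b := by
  refine ⟨hu.1.mono fun t ht => ha.trans ht.1, fun n t ht => ?_⟩
  obtain ⟨h, hAe⟩ := he n
  have h0 : 0 ≤ t := ha.trans ht.1
  have := (hu.2 ⟨e n, h⟩ t h0).mono (Ici_subset_Ici.2 h0)
  simpa [hAe, inner_smul_left] using this

/-- The coordinate equations are first integrated in time, then summed against a general `φ` by
Parseval (which turns `ev n * φₙ` into the coordinates of `A φ`), and only then differentiated
again. This avoids differentiating an infinite series. -/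
theorem isParabolicSolution_of_coord {A : H →ₗ.[ℝ] H} {e : HilbertBasis ℕ ℝ H} {ev : ℕ → ℝ}
    [CompleteSpace H]
    (hA : ∀ (φ : A.domain) n, inner ℝ (e n) (A φ) = ev n * inner ℝ (e n) (φ : H))
    {F : H → H} (hF : Continuous F) {u : ℝ → H} (huc : Continuous u)
    (hu : ∀ b, IsCoordSolutionOn e ev F u 0 b) : IsParabolicSolution A F u := by
  have hFc : Continuous fun s => F (u s) := hF.comp huc
  have hFTC : ∀ {w : ℝ → H}, Continuous w → ∀ t, HasDerivAt (fun t => ∫ s in (0 : ℝ)..t, w s) (w t) t :=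
    fun hw t => intervalIntegral.integral_hasDerivAt_right (hw.intervalIntegrable _ _)
      (hw.stronglyMeasurableAtFilter _ _) hw.continuousAt
  have hcoord : ∀ n t, 0 ≤ t → inner ℝ (e n) (u t - u 0)
      = -(ev n * inner ℝ (e n) (∫ s in (0 : ℝ)..t, u s))
        + inner ℝ (e n) (∫ s in (0 : ℝ)..t, F (u s)) := by
    intro n t ht
    have hd := intervalIntegral.integral_eq_sub_of_hasDeriv_right_of_le
      (f := fun s => inner ℝ (e n) (u s)) ht
      (by fun_prop) (fun s hs => ((hu t).2 n s ⟨hs.1.le, hs.2⟩).mono Ioi_subset_Ici_self)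
      (Continuous.intervalIntegrable (by fun_prop) _ _)
    rw [inner_sub_right, ← hd, intervalIntegral.integral_add
      (Continuous.intervalIntegrable (by fun_prop) _ _)
      (Continuous.intervalIntegrable (by fun_prop) _ _), intervalIntegral.integral_neg,
      intervalIntegral.integral_const_mul]
    have hc : ∀ {w : ℝ → H}, Continuous w → ∫ s in (0 : ℝ)..t, inner ℝ (e n) (w s)
        = inner ℝ (e n) (∫ s in (0 : ℝ)..t, w s) := fun hw =>
      (innerSL ℝ (e n)).intervalIntegral_comp_comm (hw.intervalIntegrable _ _)
    rw [hc huc, hc hFc]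
  have hweak : ∀ (φ : A.domain) t, 0 ≤ t → inner ℝ (φ : H) (u t) = inner ℝ (φ : H) (u 0)
      + (- inner ℝ (A φ) (∫ s in (0 : ℝ)..t, u s)
        + inner ℝ (φ : H) (∫ s in (0 : ℝ)..t, F (u s))) := by
    intro φ t ht
    have h1 := e.hasSum_inner_mul_inner (φ : H) (u t - u 0)
    have h2 := (e.hasSum_inner_mul_inner (A φ) (∫ s in (0 : ℝ)..t, u s)).neg.add
      (e.hasSum_inner_mul_inner (φ : H) (∫ s in (0 : ℝ)..t, F (u s)))
    have h3 := h1.unique (h2.congr_fun fun n => by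
      rw [hcoord n t ht, real_inner_comm (e n) (A φ), hA, real_inner_comm (e n) (φ : H)]; ring)
    rw [inner_sub_right] at h3
    linarith
  refine ⟨huc.continuousOn, fun φ t ht => ?_⟩
  have hd : HasDerivAt (fun t => inner ℝ (φ : H) (u 0) + (- inner ℝ (A φ) (∫ s in (0 : ℝ)..t, u s)
        + inner ℝ (φ : H) (∫ s in (0 : ℝ)..t, F (u s))))
      (- inner ℝ (A φ) (u t) + inner ℝ (φ : H) (F (u t))) t := by
    have h1 := ((innerSL ℝ (A φ)).hasFDerivAt.comp_hasDerivAt t (hFTC huc t)).neg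
    have h2 := (innerSL ℝ (φ : H)).hasFDerivAt.comp_hasDerivAt t (hFTC hFc t)
    exact (h1.add h2).const_add _
  exact hd.hasDerivWithinAt.congr (fun s hs => hweak φ s hs) (hweak φ t ht)

end Solutions

/-! ### The solution semigroup and its smoothing of high modes -/

section Semigroup

variable {A : H →ₗ.[ℝ] H} {e : HilbertBasis ℕ ℝ H} {ev : ℕ → ℝ} {F : H → H} {S : ℝ → H → H}

/-- `u` is a mild solution of `∂ₜ u + A u = F u` with initial value `u₀`. -/
def IsMildSolution (e : HilbertBasis ℕ ℝ H) (hev : ∀ n, 0 < ev n) (F : H → H) (u₀ : H)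
    (u : ℝ → H) : Prop :=
  Continuous u ∧ ∀ t, 0 ≤ t →
    u t = heat e hev t u₀ + ∫ s in (0 : ℝ)..t, heat e hev (t - s) (F (u s))

theorem IsMildSolution.apply_zero {hev : ∀ n, 0 < ev n} {u₀ : H} {u : ℝ → H}
    (hu : IsMildSolution e hev F u₀ u) : u 0 = u₀ := by
  rw [hu.2 0 le_rfl]
  refine ext_inner_basis e fun n => ?_
  simp [inner_heat]

theorem continuous_heat_sub (hev : ∀ n, 0 < ev n) {f : ℝ → H} (hf : Continuous f) (t : ℝ) :
    Continuous fun s => heat e hev (t - s) (f s) :=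
  (continuous_heat e hev).comp ((continuous_const.sub continuous_id).prodMk hf)

theorem IsMildSolution.inner_eq [CompleteSpace H] {hev : ∀ n, 0 < ev n} {u₀ : H} {u : ℝ → H}
    (hu : IsMildSolution e hev F u₀ u) (hF : Continuous F) (n : ℕ) {t : ℝ} (ht : 0 ≤ t) :
    inner ℝ (e n) (u t) = Real.exp (-(ev n * t)) *
      (inner ℝ (e n) u₀ + ∫ s in (0 : ℝ)..t, Real.exp (ev n * s) * inner ℝ (e n) (F (u s))) := by
  have hhc := continuous_heat_sub (e := e) hev (hF.comp hu.1) t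
  have h1 : inner ℝ (e n) (∫ s in (0 : ℝ)..t, heat e hev (t - s) (F (u s)))
      = ∫ s in (0 : ℝ)..t, inner ℝ (e n) (heat e hev (t - s) (F (u s))) :=
    ((innerSL ℝ (e n)).intervalIntegral_comp_comm (hhc.intervalIntegrable _ _)).symm
  rw [hu.2 t ht, inner_add_right, h1, inner_heat, max_eq_left ht, mul_add,
    ← intervalIntegral.integral_const_mul]
  congr 1
  refine intervalIntegral.integral_congr fun s hs => ?_
  rw [uIcc_of_le ht] at hs
  simp only [inner_heat, max_eq_left (sub_nonneg.2 hs.2), ← mul_assoc, ← Real.exp_add]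
  ring_nf

theorem IsMildSolution.isCoordSolutionOn [CompleteSpace H] {hev : ∀ n, 0 < ev n} {u₀ : H}
    {u : ℝ → H} (hu : IsMildSolution e hev F u₀ u) (hF : Continuous F) (b : ℝ) :
    IsCoordSolutionOn e ev F u 0 b := by
  refine ⟨hu.1.continuousOn, fun n t ht => ?_⟩
  have hc : Continuous fun s => Real.exp (ev n * s) * inner ℝ (e n) (F (u s)) := by
    have : Continuous fun s => F (u s) := hF.comp hu.1
    exact (by fun_prop : Continuous fun s => Real.exp (ev n * s)).mul (continuous_const.inner this)
  have h1 : HasDerivAt (fun t => inner ℝ (e n) u₀ + ∫ s in (0 : ℝ)..t,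
      Real.exp (ev n * s) * inner ℝ (e n) (F (u s)))
      (Real.exp (ev n * t) * inner ℝ (e n) (F (u t))) t :=
    (intervalIntegral.integral_hasDerivAt_right (hc.intervalIntegrable _ _)
      (hc.stronglyMeasurableAtFilter _ _) hc.continuousAt).const_add _
  have h2 : HasDerivAt (fun t => Real.exp (-(ev n * t))) (Real.exp (-(ev n * t)) * (-(ev n))) t := by
    simpa using (((hasDerivAt_id t).const_mul (ev n)).neg).exp
  refine ((h2.mul h1).hasDerivWithinAt.congr (fun s hs => hu.inner_eq hF n (ht.1.trans hs))
    (hu.inner_eq hF n ht.1)).congr_deriv ?_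
  rw [hu.inner_eq hF n ht.1, ← mul_assoc (Real.exp (-(ev n * t))) (Real.exp (ev n * t)),
    ← Real.exp_add]
  simp only [neg_add_cancel, Real.exp_zero]
  ring

/-- On the modes from `N` on, the semigroup contracts at rate `ev N` and the forcing is bounded by
`C`. The bound is a convex combination of the initial tail and `C / ev N`; since `ev N` tends to
infinity, this makes the absorbing set compact. -/
theorem IsMildSolution.norm_tailProj_le [CompleteSpace H] {hev : ∀ n, 0 < ev n} {u₀ : H}
    {u : ℝ → H} (hu : IsMildSolution e hev F u₀ u) (hF : Continuous F) (hmono : Monotone ev)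
    {C : ℝ} (hC : ∀ x, ‖F x‖ ≤ C) {t : ℝ} (ht : 0 ≤ t) (N : ℕ) : ‖tailProj e N (u t)‖ ≤
      Real.exp (-(ev N * t)) * ‖tailProj e N u₀‖ + (1 - Real.exp (-(ev N * t))) * (C / ev N) := by
  have hC0 : 0 ≤ C := (norm_nonneg _).trans (hC 0)
  have hhc := continuous_heat_sub (e := e) hev (hF.comp hu.1) t
  have h1 : tailProj e N (∫ s in (0 : ℝ)..t, heat e hev (t - s) (F (u s)))
      = ∫ s in (0 : ℝ)..t, tailProj e N (heat e hev (t - s) (F (u s))) :=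
    ((tailProj e N).intervalIntegral_comp_comm (hhc.intervalIntegrable _ _)).symm
  have h2 : ‖∫ s in (0 : ℝ)..t, tailProj e N (heat e hev (t - s) (F (u s)))‖
      ≤ ∫ s in (0 : ℝ)..t, C * Real.exp (-(ev N * (t - s))) := by
    refine intervalIntegral.norm_integral_le_of_norm_le ht (Eventually.of_forall fun s hs => ?_)
      (Continuous.intervalIntegrable (by fun_prop) _ _)
    refine (norm_tailProj_heat_le e hev hmono (sub_nonneg.2 hs.2) N _).trans ?_
    rw [mul_comm]
    gcongr
    exact (SemilinearParabolic.norm_tailProj_le e N _).trans (hC _)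
  have h3 : ∫ s in (0 : ℝ)..t, C * Real.exp (-(ev N * (t - s)))
      = (1 - Real.exp (-(ev N * t))) * (C / ev N) := by
    have hd : ∀ s ∈ uIcc 0 t, HasDerivAt (fun s => C / ev N * Real.exp (-(ev N * (t - s))))
        (C * Real.exp (-(ev N * (t - s)))) s := fun s _ => by
      have h4 : HasDerivAt (fun s => -(ev N * (t - s))) (ev N) s := by
        simpa using (((hasDerivAt_id s).const_sub t).const_mul (ev N)).fun_neg
      refine (h4.exp.const_mul (C / ev N)).congr_deriv ?_
      have := (hev N).ne'
      field_simp
    rw [intervalIntegral.integral_eq_sub_of_hasDerivAt hd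
      (Continuous.intervalIntegrable (by fun_prop) _ _)]
    simp only [sub_self, mul_zero, neg_zero, Real.exp_zero, sub_zero]
    ring
  rw [hu.2 t ht, map_add, h1]
  exact (norm_add_le _ _).trans
    (add_le_add (norm_tailProj_heat_le e hev hmono ht N _) (h2.trans_eq h3))

theorem exists_solutionSemigroup [CompleteSpace H] (hev : ∀ n, 0 < ev n) (hmono : Monotone ev)
    (he : ∀ n, ∃ h : e n ∈ A.domain, A ⟨e n, h⟩ = ev n • e n)
    (hA : ∀ (φ : A.domain) n, inner ℝ (e n) (A φ) = ev n * inner ℝ (e n) (φ : H))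
    {K : ℝ} (hK : 0 ≤ K) (hF : ∀ x y, ‖F x - F y‖ ≤ K * ‖x - y‖) {C : ℝ} (hC : ∀ x, ‖F x‖ ≤ C) :
    ∃ S, IsSolutionSemigroup A F S ∧ ∀ u₀ t, 0 ≤ t → ∀ N, ‖tailProj e N (S t u₀)‖ ≤
      Real.exp (-(ev N * t)) * ‖tailProj e N u₀‖ + (1 - Real.exp (-(ev N * t))) * (C / ev N) := by
  have hL : LipschitzWith K.toNNReal F := LipschitzWith.of_dist_le_mul fun x y => by
    rw [dist_eq_norm, dist_eq_norm, Real.coe_toNNReal _ hK]; exact hF x y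
  have hex : ∀ u₀ : H, ∃ u, IsMildSolution e hev F u₀ u := fun u₀ =>
    exists_mild_solution (heat e hev) (continuous_heat e hev)
      (fun t => ContinuousLinearMap.opNorm_le_bound _ zero_le_one fun x => by
        rw [one_mul]; exact norm_heat_le e hev t x) hL hC u₀
  choose u hu using hex
  have hsol := fun u₀ => (hu u₀).isCoordSolutionOn hL.continuous
  refine ⟨fun t u₀ => u u₀ t, ⟨fun u₀ => ⟨(hu u₀).apply_zero,
    isParabolicSolution_of_coord hA hL.continuous (hu u₀).1 (hsol u₀)⟩, fun v hv t ht => ?_⟩,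
    fun u₀ t ht N => (hu u₀).norm_tailProj_le hL.continuous hmono hC ht N⟩
  exact (hv.isCoordSolutionOn he le_rfl).eq_of_eq hev hK hF (hsol (v 0) t)
    (hu _).apply_zero.symm ⟨ht, le_rfl⟩

theorem _root_.IsSolutionSemigroup.coord (hS : IsSolutionSemigroup A F S)
    (he : ∀ n, ∃ h : e n ∈ A.domain, A ⟨e n, h⟩ = ev n • e n) (x : H) (b : ℝ) :
    IsCoordSolutionOn e ev F (fun t => S t x) 0 b :=
  (hS.1 x).2.isCoordSolutionOn he le_rfl

theorem _root_.IsSolutionSemigroup.eq_of_coord (hS : IsSolutionSemigroup A F S) (hev : ∀ n, 0 < ev n)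
    (he : ∀ n, ∃ h : e n ∈ A.domain, A ⟨e n, h⟩ = ev n • e n)
    {K : ℝ} (hK : 0 ≤ K) (hF : ∀ x y, ‖F x - F y‖ ≤ K * ‖x - y‖) {u : ℝ → H} {a t : ℝ}
    (hat : a ≤ t) (hu : IsCoordSolutionOn e ev F u a t) : u t = S (t - a) (u a) := by
  have h1 := hu.comp_add a
  rw [sub_self] at h1
  have := h1.eq_of_eq hev hK hF (hS.coord he (u a) (t - a)) (by simp [(hS.1 (u a)).1])
    (t := t - a) ⟨sub_nonneg.2 hat, le_rfl⟩
  simpa using this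

theorem _root_.IsSolutionSemigroup.apply_add (hS : IsSolutionSemigroup A F S) (hev : ∀ n, 0 < ev n)
    (he : ∀ n, ∃ h : e n ∈ A.domain, A ⟨e n, h⟩ = ev n • e n)
    {K : ℝ} (hK : 0 ≤ K) (hF : ∀ x y, ‖F x - F y‖ ≤ K * ‖x - y‖) {s t : ℝ} (hs : 0 ≤ s)
    (ht : 0 ≤ t) (x : H) : S (s + t) x = S t (S s x) := by
  have := hS.eq_of_coord hev he hK hF (le_add_of_nonneg_right ht : s ≤ s + t)
    ((hS.coord he x (s + t)).mono hs le_rfl)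
  simpa using this

theorem _root_.IsSolutionSemigroup.norm_sub_le (hS : IsSolutionSemigroup A F S) (hev : ∀ n, 0 < ev n)
    (he : ∀ n, ∃ h : e n ∈ A.domain, A ⟨e n, h⟩ = ev n • e n)
    {K : ℝ} (hK : 0 ≤ K) (hF : ∀ x y, ‖F x - F y‖ ≤ K * ‖x - y‖) {t : ℝ} (ht : 0 ≤ t) (x y : H) :
    ‖S t x - S t y‖ ≤ Real.exp (K * t) * ‖x - y‖ := by
  have := (hS.coord he x t).norm_sub_le hev hK hF (hS.coord he y t) ⟨ht, le_rfl⟩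
  simp only [(hS.1 _).1, sub_zero] at this
  refine le_of_sq_le_sq ?_ (by positivity)
  have h2 : Real.exp (K * t) ^ 2 = Real.exp (2 * K * t) := by
    rw [← Real.exp_nat_mul]; congr 1; push_cast; ring
  rw [mul_pow, h2, mul_comm]
  exact this

theorem _root_.IsSolutionSemigroup.continuous (hS : IsSolutionSemigroup A F S) (hev : ∀ n, 0 < ev n)
    (he : ∀ n, ∃ h : e n ∈ A.domain, A ⟨e n, h⟩ = ev n • e n)
    {K : ℝ} (hK : 0 ≤ K) (hF : ∀ x y, ‖F x - F y‖ ≤ K * ‖x - y‖) {t : ℝ} (ht : 0 ≤ t) :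
    Continuous (S t) :=
  (LipschitzWith.of_dist_le_mul (K := (Real.exp (K * t)).toNNReal) fun x y => by
    rw [dist_eq_norm, dist_eq_norm, Real.coe_toNNReal _ (Real.exp_pos _).le]
    exact hS.norm_sub_le hev he hK hF ht x y).continuous

end Semigroup

/-! ### Existence of the global attractor -/

section Attractor

/-- Tails are uniformly small, so up to `ε / 2` the set lives in a bounded part of the span of
finitely many basis vectors, which is totally bounded. The condition at `N = 0` bounds the whole
norm. -/
theorem isCompact_tail_le [CompleteSpace H] (e : HilbertBasis ℕ ℝ H) {r : ℕ → ℝ}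
    (hr : Tendsto r atTop (𝓝 0)) : IsCompact {x : H | ∀ N, ‖tailProj e N x‖ ≤ r N} := by
  refine isCompact_iff_totallyBounded_isComplete.2 ⟨?_, IsClosed.isComplete ?_⟩
  · rw [Metric.totallyBounded_iff]
    intro ε hε
    obtain ⟨N, hN⟩ := (hr.eventually (gt_mem_nhds (half_pos hε))).exists
    let R : (Fin N → ℝ) →L[ℝ] H := ∑ n : Fin N,
      (ContinuousLinearMap.proj (R := ℝ) (φ := fun _ : Fin N => ℝ) n).smulRight (e n)
    have hR : ∀ x, R x = ∑ n : Fin N, x n • e n := fun x => by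
      simp [R]
    have hP : TotallyBounded (R '' Metric.closedBall 0 (r 0)) :=
      ((isCompact_closedBall _ _).image R.continuous).totallyBounded
    obtain ⟨t, ht, hcov⟩ := Metric.totallyBounded_iff.1 hP (ε / 2) (half_pos hε)
    refine ⟨t, ht, fun x hx => ?_⟩
    have hx0 : ‖x‖ ≤ r 0 := by simpa [tailProj_zero] using hx 0
    have hmem : x - tailProj e N x ∈ R '' Metric.closedBall 0 (r 0) := by
      refine ⟨fun n => inner ℝ (e n) x, ?_, ?_⟩
      · rw [mem_closedBall_zero_iff, pi_norm_le_iff_of_nonneg ((norm_nonneg _).trans hx0)]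
        intro n
        have h1 := norm_inner_le_norm (𝕜 := ℝ) (e n) x
        rw [e.orthonormal.1 n, one_mul] at h1
        exact h1.trans hx0
      · rw [hR, sub_tailProj, Finset.sum_range]
    obtain ⟨y, hy, hxy⟩ := mem_iUnion₂.1 (hcov hmem)
    refine mem_iUnion₂.2 ⟨y, hy, ?_⟩
    rw [mem_ball_iff_norm] at hxy ⊢
    calc ‖x - y‖ = ‖(x - tailProj e N x - y) + tailProj e N x‖ := by congr 1; abel
      _ ≤ _ := norm_add_le _ _
      _ < ε := by linarith [hx N]
  · simp only [ofPred_forall]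
    exact isClosed_iInter fun N => isClosed_le (tailProj e N).continuous.norm continuous_const

/-- A semigroup with a compact forward invariant absorbing set has a global attractor, which
contains all complete bounded trajectories. -/
theorem exists_globalAttractor {H : Type*} [NormedAddCommGroup H] {S : ℝ → H → H}
    {Z : Set H} (hZ : IsCompact Z)
    (hadd : ∀ s t x, 0 ≤ s → 0 ≤ t → S (s + t) x = S t (S s x))
    (hcont : ∀ t, 0 ≤ t → Continuous (S t)) (hinv : ∀ t, 0 ≤ t → ∀ x ∈ Z, S t x ∈ Z)
    (habs : ∀ r : ℝ, ∃ T, 0 ≤ T ∧ ∀ t, T ≤ t → ∀ x : H, ‖x‖ ≤ r → S t x ∈ Z) :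
    ∃ 𝒜, IsGlobalAttractor S 𝒜 ∧ ∀ (u : ℝ → H) (r : ℝ), (∀ t, ‖u t‖ ≤ r) →
      (∀ s t, 0 ≤ t → u (s + t) = S t (u s)) → ∀ t, u t ∈ 𝒜 := by
  have hcpt : ∀ n : ℕ, IsCompact (S n '' Z) := fun n => hZ.image (hcont n n.cast_nonneg)
  have hshift : ∀ (n : ℕ) t, (n : ℝ) ≤ t → ∀ x, S t x = S n (S (t - n) x) := fun n t ht x => by
    rw [← hadd _ _ _ (sub_nonneg.2 ht) n.cast_nonneg, sub_add_cancel]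
  have hanti : ∀ n : ℕ, S (n + 1 : ℕ) '' Z ⊆ S n '' Z := by
    rintro n _ ⟨x, hx, rfl⟩
    rw [hshift n (n + 1 : ℕ) (by push_cast; linarith)]
    exact mem_image_of_mem _ (hinv _ (by push_cast; linarith) _ hx)
  refine ⟨⋂ n : ℕ, S n '' Z, ⟨?_, ?_, ?_⟩, ?_⟩
  · exact (hcpt 0).of_isClosed_subset (isClosed_iInter fun n => (hcpt n).isClosed)
      (iInter_subset _ 0)
  · intro t ht
    refine Subset.antisymm ?_ fun y hy => ?_
    · rintro _ ⟨x, hx, rfl⟩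
      refine mem_iInter.2 fun n => ?_
      obtain ⟨z, hz, rfl⟩ := mem_iInter.1 hx n
      rw [← hadd _ _ _ n.cast_nonneg ht, add_comm, hadd _ _ _ ht n.cast_nonneg]
      exact mem_image_of_mem _ (hinv t ht z hz)
    -- A preimage of `y` inside the attractor is found as a point of the nested compact sets of
    -- preimages lying in `S n '' Z`.
    · have hcl : IsClosed {x | S t x = y} := isClosed_eq (hcont t ht) continuous_const
      obtain ⟨x, hx⟩ := IsCompact.nonempty_iInter_of_sequence_nonempty_isCompact_isClosed
        (fun n : ℕ => S n '' Z ∩ {x | S t x = y})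
        (fun n => inter_subset_inter_left _ (hanti n)) (fun n => by
          obtain ⟨m, hm⟩ := exists_nat_ge (n + t)
          obtain ⟨z, hz, hzy⟩ := mem_iInter.1 hy m
          refine ⟨S n (S (m - t - n) z), mem_image_of_mem _ (hinv _ (by linarith) z hz), ?_⟩
          rw [mem_ofPred_eq, ← hadd _ _ _ (by linarith) n.cast_nonneg,
            ← hadd _ _ _ (by linarith) ht, ← hzy]
          congr 1; ring) ((hcpt _).inter_right hcl)
        (fun n => ((hcpt n).inter_right hcl).isClosed)
      rw [mem_iInter] at hx
      exact ⟨x, mem_iInter.2 fun n => (hx n).1, (hx 0).2⟩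
  · intro B hB ε hε
    obtain ⟨n, hn⟩ : ∃ n : ℕ, S n '' Z ⊆ Metric.thickening ε (⋂ n : ℕ, S n '' Z) := by
      -- Otherwise the nested compact sets `S n '' Z` would all reach outside the neighbourhood,
      -- hence so would their intersection.
      by_contra! hcon
      have hcl : IsClosed (Metric.thickening ε (⋂ n : ℕ, S n '' Z))ᶜ :=
        Metric.isOpen_thickening.isClosed_compl
      obtain ⟨x, hx⟩ := IsCompact.nonempty_iInter_of_sequence_nonempty_isCompact_isClosed
        (fun n : ℕ => S n '' Z ∩ (Metric.thickening ε (⋂ n : ℕ, S n '' Z))ᶜ)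
        (fun n => inter_subset_inter_left _ (hanti n))
        (fun n => by
          obtain ⟨x, hx, hx'⟩ := not_subset.1 (hcon n)
          exact ⟨x, hx, hx'⟩) ((hcpt _).inter_right hcl)
        (fun n => ((hcpt n).inter_right hcl).isClosed)
      rw [mem_iInter] at hx
      exact (hx 0).2 (Metric.self_subset_thickening hε _ (mem_iInter.2 fun n => (hx n).1))
    obtain ⟨r, hr⟩ := hB.exists_norm_le
    obtain ⟨T, hT, hTr⟩ := habs r
    refine ⟨T + n, fun t ht => ?_⟩
    rintro _ ⟨x, hx, rfl⟩
    refine hn ?_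
    rw [hshift n t (by linarith)]
    exact mem_image_of_mem _ (hTr _ (by linarith) x (hr x hx))
  · intro u r hr hu t
    refine mem_iInter.2 fun n => ?_
    obtain ⟨T, hT, hTr⟩ := habs r
    have h1 := hu (t - n - T) T hT
    have h2 := hu (t - n) n n.cast_nonneg
    rw [sub_add_cancel] at h1 h2
    rw [h2]
    refine mem_image_of_mem _ ?_
    rw [h1]
    exact hTr T le_rfl _ (hr _)

/-- The set of points with tails at most `(C + 1) / ev N` is invariant because the tail bound is a
convex combination. The surplus `1 / ev N` makes it absorbing with an entry time uniform in `N`: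
since `s * exp (-s) ≤ 1`, one has `exp (-ev N * t) * ‖x‖ ≤ 1 / ev N` as soon as `t ≥ ‖x‖` and `t ≥
1`. -/
theorem exists_globalAttractor_of_tail [CompleteSpace H] {e : HilbertBasis ℕ ℝ H} {ev : ℕ → ℝ}
    (hev : ∀ n, 0 < ev n) (htop : Tendsto ev atTop atTop) {S : ℝ → H → H} {C : ℝ} (hC : 0 ≤ C)
    (hadd : ∀ s t x, 0 ≤ s → 0 ≤ t → S (s + t) x = S t (S s x))
    (hcont : ∀ t, 0 ≤ t → Continuous (S t))
    (htail : ∀ u₀ t, 0 ≤ t → ∀ N, ‖tailProj e N (S t u₀)‖ ≤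
      Real.exp (-(ev N * t)) * ‖tailProj e N u₀‖ + (1 - Real.exp (-(ev N * t))) * (C / ev N)) :
    ∃ 𝒜, IsGlobalAttractor S 𝒜 ∧ ∀ (u : ℝ → H) (r : ℝ), (∀ t, ‖u t‖ ≤ r) →
      (∀ s t, 0 ≤ t → u (s + t) = S t (u s)) → ∀ t, u t ∈ 𝒜 := by
  refine exists_globalAttractor (Z := {x : H | ∀ N, ‖tailProj e N x‖ ≤ (C + 1) / ev N})
    (isCompact_tail_le e (htop.const_div_atTop _)) hadd hcont (fun t ht x hx N => ?_) fun r => ?_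
  · have hp := Real.exp_pos (-(ev N * t))
    have hN := hev N
    have h1 : C / ev N ≤ (C + 1) / ev N := by gcongr; linarith
    have h2 : Real.exp (-(ev N * t)) ≤ 1 := Real.exp_le_one_iff.2 (by nlinarith)
    nlinarith [htail x t ht N, mul_le_mul_of_nonneg_left (hx N) hp.le,
      mul_le_mul_of_nonneg_left h1 (sub_nonneg.2 h2)]
  · refine ⟨max r 1, by positivity, fun t ht x hx N => ?_⟩
    have ht1 : 1 ≤ t := (le_max_right _ _).trans ht
    have htr : r ≤ t := (le_max_left _ _).trans ht
    have hN := hev N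
    have hp := Real.exp_pos (-(ev N * t))
    have h3 : Real.exp (-(ev N * t)) * (ev N * t) ≤ 1 := by
      rw [Real.exp_neg, inv_mul_le_iff₀ (Real.exp_pos _), mul_one]
      linarith [Real.add_one_le_exp (ev N * t)]
    have h4 : Real.exp (-(ev N * t)) * ‖tailProj e N x‖ ≤ 1 / ev N := by
      rw [le_div_iff₀ hN]
      refine le_trans ?_ h3
      rw [mul_assoc, mul_comm (ev N)]
      gcongr
      exact ((norm_tailProj_le e N x).trans hx).trans htr
    have h5 : (1 - Real.exp (-(ev N * t))) * (C / ev N) ≤ C / ev N :=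
      mul_le_of_le_one_left (by positivity) (by linarith)
    calc ‖tailProj e N (S t x)‖ ≤ _ := htail x t (by linarith) N
      _ ≤ 1 / ev N + C / ev N := add_le_add h4 h5
      _ = (C + 1) / ev N := by ring

end Attractor

/-! ### Finite-dimensional embeddings forbid super-exponential convergence -/

section Embedding

variable {e : HilbertBasis ℕ ℝ H} {ev : ℕ → ℝ} {F : H → H}

theorem tendsto_tailProj (e : HilbertBasis ℕ ℝ H) (x : H) :
    Tendsto (fun N => tailProj e N x) atTop (𝓝 0) := by
  have h := (e.hasSum_repr x).tendsto_sum_nat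
  have h2 := tendsto_const_nhds (x := x).sub h
  rw [sub_self] at h2
  refine h2.congr fun N => ?_
  rw [← sub_sub_cancel x (tailProj e N x), sub_tailProj]
  simp only [e.repr_apply_apply]

theorem inner_tailProj_comm (e : HilbertBasis ℕ ℝ H) (N : ℕ) (x y : H) :
    inner ℝ (tailProj e N x) y = inner ℝ x (tailProj e N y) := by
  rw [← e.tsum_inner_mul_inner, ← e.tsum_inner_mul_inner]
  refine tsum_congr fun n => ?_
  rw [real_inner_comm, inner_tailProj, inner_tailProj, real_inner_comm x]
  split_ifs <;> simp

/-- Tails tend to zero on each vector of an orthonormal basis of `V`, hence uniformly on its unit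
ball. -/
theorem exists_norm_tailProj_le (e : HilbertBasis ℕ ℝ H) (V : Submodule ℝ H)
    [FiniteDimensional ℝ V] {η : ℝ} (hη : 0 < η) :
    ∃ N₀, ∀ N, N₀ ≤ N → ∀ p : V, ‖tailProj e N (p : H)‖ ≤ η * ‖p‖ := by
  let b := stdOrthonormalBasis ℝ V
  have h1 : Tendsto (fun N => ∑ i, ‖tailProj e N (b i : H)‖) atTop (𝓝 0) := by
    have := tendsto_finsetSum Finset.univ fun i _ => (tendsto_tailProj e (b i : H)).norm
    simpa using this
  obtain ⟨N₀, hN₀⟩ := eventually_atTop.1 (h1.eventually (gt_mem_nhds hη))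
  refine ⟨N₀, fun N hN p => ?_⟩
  have hp : (p : H) = ∑ i, inner ℝ (b i) p • (b i : H) := by
    conv_lhs => rw [← b.sum_repr' p]
    simp
  calc ‖tailProj e N (p : H)‖ = ‖∑ i, inner ℝ (b i) p • tailProj e N (b i : H)‖ := by
        conv_lhs => rw [hp]
        simp only [map_sum, map_smul]
    _ ≤ ∑ i, ‖p‖ * ‖tailProj e N (b i : H)‖ := by
        refine (norm_sum_le _ _).trans (Finset.sum_le_sum fun i _ => ?_)
        rw [norm_smul]
        gcongr
        have := norm_inner_le_norm (𝕜 := ℝ) (b i) p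
        rwa [b.orthonormal.1 i, one_mul] at this
    _ = (∑ i, ‖tailProj e N (b i : H)‖) * ‖p‖ := by rw [← Finset.mul_sum, mul_comm]
    _ ≤ η * ‖p‖ := by gcongr; exact (hN₀ N hN).le

/-- An arbitrary `V` is replaced by a span of eigenvectors, on which the equation can be used. By
duality the projection to `V` of a tail is as small as the tails of vectors of `V`; with smallness
`1 / (2 (|K| + 1))` its contribution is at most `‖x‖ / 2` and is absorbed. -/
theorem exists_norm_le_of_le_projection (e : HilbertBasis ℕ ℝ H) (V : Submodule ℝ H)
    [FiniteDimensional ℝ V] (K : ℝ) : ∃ N₀, ∀ N, N₀ ≤ N → ∀ x : H,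
      ‖x‖ ≤ K * ‖V.orthogonalProjectionOnto x‖ → ‖x‖ ≤ 2 * |K| * ‖x - tailProj e N x‖ := by
  have hη : 0 < 1 / (2 * (|K| + 1)) := by positivity
  obtain ⟨N₀, hN₀⟩ := exists_norm_tailProj_le e V hη
  refine ⟨N₀, fun N hN x hx => ?_⟩
  set p := V.orthogonalProjectionOnto (tailProj e N x) with hp
  have h1 : ‖p‖ ^ 2 ≤ ‖x‖ * (1 / (2 * (|K| + 1)) * ‖p‖) := by
    calc ‖p‖ ^ 2 = inner ℝ p (V.orthogonalProjectionOnto (tailProj e N x)) := by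
          rw [← hp, real_inner_self_eq_norm_sq]
      _ = inner ℝ x (tailProj e N (p : H)) := by
          rw [Submodule.inner_orthogonalProjectionOnto_eq_of_mem_right, ← inner_tailProj_comm]
      _ ≤ ‖x‖ * ‖tailProj e N (p : H)‖ := real_inner_le_norm _ _
      _ ≤ _ := by gcongr; exact hN₀ N hN p
  have h2 : ‖p‖ ≤ 1 / (2 * (|K| + 1)) * ‖x‖ := by
    rcases (norm_nonneg p).eq_or_lt with h0 | h0
    · rw [← h0]; positivity
    · nlinarith
  have h3 : ‖V.orthogonalProjectionOnto x‖ ≤ ‖x - tailProj e N x‖ + ‖p‖ := by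
    have : V.orthogonalProjectionOnto x = V.orthogonalProjectionOnto (x - tailProj e N x) + p := by
      rw [map_sub, hp]; abel
    rw [this]
    exact (norm_add_le _ _).trans
      (add_le_add (Submodule.norm_orthogonalProjectionOnto_apply_le _ _) le_rfl)
  have h4 : |K| * (1 / (2 * (|K| + 1)) * ‖x‖) ≤ ‖x‖ / 2 := by
    have : |K| * (1 / (2 * (|K| + 1))) ≤ 1 / 2 := by
      rw [mul_one_div, div_le_div_iff₀ (by positivity) two_pos]; linarith
    nlinarith [norm_nonneg x]
  have h5 : ‖x‖ ≤ |K| * (‖x - tailProj e N x‖ + 1 / (2 * (|K| + 1)) * ‖x‖) := by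
    refine hx.trans ((mul_le_mul_of_nonneg_right (le_abs_self K) (norm_nonneg _)).trans ?_)
    gcongr
    exact h3.trans (add_le_add le_rfl h2)
  linarith

theorem norm_sub_tailProj_sq (e : HilbertBasis ℕ ℝ H) (N : ℕ) (x : H) :
    ‖x - tailProj e N x‖ ^ 2 = ∑ n ∈ Finset.range N, inner ℝ (e n) x ^ 2 := by
  rw [← (hasSum_inner_sq e _).tsum_eq, tsum_eq_sum (s := Finset.range N)]
  · refine Finset.sum_congr rfl fun n hn => ?_
    rw [inner_sub_right, inner_tailProj, if_neg (by simpa using hn), sub_zero]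
  · intro n hn
    rw [inner_sub_right, inner_tailProj, if_pos (by simpa using hn), sub_self, zero_pow two_ne_zero]

/-- If the difference of two trajectories is controlled by finitely many of its coordinates, then
it decays at most exponentially. -/
theorem exists_exp_le_norm_sub (hev : ∀ n, 0 < ev n) {K : ℝ} (hK : 0 ≤ K)
    (hF : ∀ x y, ‖F x - F y‖ ≤ K * ‖x - y‖) {u v : ℝ → H} {a : ℝ}
    (hu : ∀ b, IsCoordSolutionOn e ev F u a b) (hv : ∀ b, IsCoordSolutionOn e ev F v a b)
    (hne : u a ≠ v a) {M : ℝ} (hM : 0 ≤ M) {N : ℕ} (h : ∀ t, a ≤ t →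
      ‖u t - v t‖ ≤ M * ‖(u t - v t) - tailProj e N (u t - v t)‖) :
    ∃ δ c : ℝ, 0 < δ ∧ ∀ t, a ≤ t → δ * Real.exp (-(c * (t - a))) ≤ ‖u t - v t‖ ^ 2 := by
  -- The sum serves as a crude upper bound for each of the first `N` eigenvalues. With the
  -- hypothesis `h`, the nonlinear term is at most `K * M * G`, so `G' ≥ -c * G` and `G * exp (c (t
  -- - a))` is nondecreasing.
  set Λ := ∑ n ∈ Finset.range N, ev n with hΛ
  set c := 2 * (Λ + K * M) with hc
  set G : ℝ → ℝ := fun t => ∑ n ∈ Finset.range N, inner ℝ (e n) (u t - v t) ^ 2 with hG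
  have hGe : ∀ t, G t = ‖(u t - v t) - tailProj e N (u t - v t)‖ ^ 2 := fun t =>
    (norm_sub_tailProj_sq e N _).symm
  refine ⟨G a, c, ?_, fun t ht => ?_⟩
  · rw [hGe]
    have h0 : 0 < ‖u a - v a‖ := norm_pos_iff.2 (sub_ne_zero.2 hne)
    have := h a le_rfl
    have h1 : 0 < ‖(u a - v a) - tailProj e N (u a - v a)‖ := by
      by_contra hcon
      have h2 := le_antisymm (not_lt.1 hcon) (norm_nonneg _)
      rw [h2] at this
      linarith
    positivity
  · have key := image_le_of_deriv_right_le_deriv_boundary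
      (f := fun t => -(G t * Real.exp (c * (t - a))))
      (f' := fun t => -((∑ n ∈ Finset.range N, 2 * inner ℝ (e n) (u t - v t) *
        (-(ev n * inner ℝ (e n) (u t - v t)) + inner ℝ (e n) (F (u t) - F (v t))))
          * Real.exp (c * (t - a)) + G t * (Real.exp (c * (t - a)) * c)))
      (a := a) (b := t) (B := fun _ => -G a) (B' := fun _ => 0) ?_ (fun r hr => ?_) (by simp)
      continuousOn_const (fun r _ => hasDerivWithinAt_const _ _ _) (fun r hr => ?_)
      (right_mem_Icc.2 ht)
    · have h1 : G a ≤ G t * Real.exp (c * (t - a)) := by simpa using key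
      rw [Real.exp_neg, ← div_eq_mul_inv, div_le_iff₀ (Real.exp_pos _)]
      refine h1.trans ?_
      gcongr
      exact sum_inner_sq_le e _ _
    · have h1 : ContinuousOn G (Icc a t) := continuousOn_finsetSum _ fun n _ =>
        (continuousOn_const.inner ((hu t).1.sub (hv t).1)).pow 2
      exact (h1.mul (by fun_prop)).neg
    · have h1 : HasDerivWithinAt G (∑ n ∈ Finset.range N, 2 * inner ℝ (e n) (u r - v r) *
        (-(ev n * inner ℝ (e n) (u r - v r)) + inner ℝ (e n) (F (u r) - F (v r)))) (Ici r) r := by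
        refine HasDerivWithinAt.fun_sum fun n _ => ?_
        have := (((hu t).2 n r hr).sub ((hv t).2 n r hr)).pow 2
        simp only [inner_sub_right]
        refine this.congr_deriv ?_
        change ((2 : ℕ) : ℝ) * (inner ℝ (e n) (u r) - inner ℝ (e n) (v r)) ^ 1 * _ = _
        push_cast
        ring
      have h2 : HasDerivWithinAt (fun t => Real.exp (c * (t - a))) (Real.exp (c * (r - a)) * c)
          (Ici r) r := by
        have : HasDerivAt (fun t => c * (t - a)) c r := by
          simpa using ((hasDerivAt_id r).sub_const a).const_mul c
        exact this.exp.hasDerivWithinAt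
      exact (h1.mul h2).neg
    · have hr' := h r hr.1
      set d := u r - v r
      have h1 : -(c * G r) ≤ ∑ n ∈ Finset.range N, 2 * inner ℝ (e n) d *
          (-(ev n * inner ℝ (e n) d) + inner ℝ (e n) (F (u r) - F (v r))) := by
        have h2 : ∑ n ∈ Finset.range N, 2 * inner ℝ (e n) d *
            (-(ev n * inner ℝ (e n) d) + inner ℝ (e n) (F (u r) - F (v r)))
            = -(2 * ∑ n ∈ Finset.range N, ev n * inner ℝ (e n) d ^ 2) - 2 *
              ∑ n ∈ Finset.range N, inner ℝ (e n) d * (-inner ℝ (e n) (F (u r) - F (v r))) := by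
          rw [Finset.mul_sum, Finset.mul_sum, ← Finset.sum_neg_distrib, ← Finset.sum_sub_distrib]
          exact Finset.sum_congr rfl fun n _ => by ring
        have h3 : ∑ n ∈ Finset.range N, ev n * inner ℝ (e n) d ^ 2 ≤ Λ * G r := by
          rw [hG, Finset.mul_sum]
          refine Finset.sum_le_sum fun n hn => ?_
          gcongr
          exact Finset.single_le_sum (fun m _ => (hev m).le) hn
        have h4 : ∑ n ∈ Finset.range N, inner ℝ (e n) d * (-inner ℝ (e n) (F (u r) - F (v r)))
            ≤ K * M * G r := by
          refine (Real.sum_mul_le_sqrt_mul_sqrt _ _ _).trans ?_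
          have h5 : √(∑ n ∈ Finset.range N, (-inner ℝ (e n) (F (u r) - F (v r))) ^ 2)
              ≤ K * (M * √(G r)) := by
            refine Real.sqrt_le_iff.2 ⟨by positivity, ?_⟩
            simp only [neg_sq]
            refine (sum_inner_sq_le e _ _).trans ?_
            gcongr
            refine (hF _ _).trans ?_
            gcongr
            rw [hGe, Real.sqrt_sq (norm_nonneg _)]
            exact hr'
          have hG0 : 0 ≤ G r := by rw [hGe]; positivity
          calc √(G r) * _ ≤ √(G r) * (K * (M * √(G r))) := by gcongr
            _ = K * M * (√(G r) * √(G r)) := by ring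
            _ = K * M * G r := by rw [Real.mul_self_sqrt hG0]
        rw [h2, hc]
        linarith
      have h6 := mul_le_mul_of_nonneg_right h1 (Real.exp_pos (c * (r - a))).le
      linarith

/-- Two distinct trajectories in a compact set which approach each other super-exponentially
prevent the set from being locally bi-Lipschitz embedded by finite-dimensional orthogonal
projections. -/
theorem false_of_locally_biLipschitz (hev : ∀ n, 0 < ev n) {K : ℝ} (hK : 0 ≤ K)
    (hF : ∀ x y, ‖F x - F y‖ ≤ K * ‖x - y‖) {u v : ℝ → H}
    (hu : ∀ b, IsCoordSolutionOn e ev F u 0 b) (hv : ∀ b, IsCoordSolutionOn e ev F v 0 b)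
    (hne : ∀ t, u t ≠ v t) {C κ : ℝ} (hκ : 0 < κ)
    (hdecay : ∀ t, 0 ≤ t → ‖u t - v t‖ ≤ C * Real.exp (-κ * t ^ 2))
    {𝒜 : Set H} (h𝒜 : IsCompact 𝒜) (hu𝒜 : ∀ t, u t ∈ 𝒜) (hv𝒜 : ∀ t, v t ∈ 𝒜)
    (hloc : ∀ p ∈ 𝒜, ∃ V : Submodule ℝ H, ∃ _ : FiniteDimensional ℝ V, ∃ (M : ℝ) (U : Set H),
      IsOpen U ∧ p ∈ U ∧ ∀ x ∈ 𝒜 ∩ U, ∀ y ∈ 𝒜 ∩ U,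
        ‖x - y‖ ≤ M * ‖V.orthogonalProjectionOnto (x - y)‖) : False := by
  have hloc' : ∀ p : 𝒜, ∃ (N₀ : ℕ) (M : ℝ) (U : Set H), IsOpen U ∧ (p : H) ∈ U ∧
      ∀ N, N₀ ≤ N → ∀ x ∈ 𝒜 ∩ U, ∀ y ∈ 𝒜 ∩ U,
        ‖x - y‖ ≤ 2 * |M| * ‖(x - y) - tailProj e N (x - y)‖ := by
    rintro ⟨p, hp⟩
    obtain ⟨V, hV, M, U, hU, hpU, h⟩ := hloc p hp
    obtain ⟨N₀, hN₀⟩ := exists_norm_le_of_le_projection e V M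
    exact ⟨N₀, M, U, hU, hpU, fun N hN x hx y hy => hN₀ N hN _ (h x hx y hy)⟩
  choose N₀ M U hU hpU h using hloc'
  obtain ⟨s, hs⟩ := h𝒜.elim_nhds_subcover' (fun x hx => U ⟨x, hx⟩)
    fun x hx => (hU ⟨x, hx⟩).mem_nhds (hpU ⟨x, hx⟩)
  -- Once the trajectories are closer than the Lebesgue number, they lie in a common set of the
  -- finite cover, though the set may vary with time. This is why `N` and the constant are taken
  -- uniform over the cover.
  obtain ⟨δ, hδ, hleb⟩ := lebesgue_number_lemma_of_metric (c := fun i : s => U i.1) h𝒜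
    (fun i => hU i.1) (fun x hx => by
      obtain ⟨i, hi, hxi⟩ := mem_iUnion₂.1 (hs hx)
      exact mem_iUnion.2 ⟨⟨i, hi⟩, hxi⟩)
  obtain ⟨N, hN⟩ := (s.image N₀).exists_le
  obtain ⟨B, hB⟩ := (s.image fun i => |M i|).exists_le
  simp only [Finset.mem_image, forall_exists_index, and_imp, forall_apply_eq_imp_iff₂] at hN hB
  have hexp : Tendsto (fun t : ℝ => C * Real.exp (-κ * t ^ 2)) atTop (𝓝 0) := by
    have h1 : Tendsto (fun t : ℝ => κ * t ^ 2) atTop atTop :=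
      (tendsto_pow_atTop two_ne_zero).const_mul_atTop hκ
    have := (Real.tendsto_exp_neg_atTop_nhds_zero.comp h1).const_mul C
    simpa [Function.comp_def] using this
  obtain ⟨a, ha⟩ := eventually_atTop.1 (hexp.eventually (gt_mem_nhds hδ))
  set a₀ := max a 0 with ha₀
  have hctrl : ∀ t, a₀ ≤ t →
      ‖u t - v t‖ ≤ 2 * max B 0 * ‖(u t - v t) - tailProj e N (u t - v t)‖ := by
    intro t ht
    obtain ⟨i, hi⟩ := hleb (u t) (hu𝒜 t)
    have h1 : v t ∈ Metric.ball (u t) δ := by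
      rw [mem_ball_iff_norm, norm_sub_rev]
      exact (hdecay t ((le_max_right _ _).trans ht)).trans_lt (ha t ((le_max_left _ _).trans ht))
    refine (h i.1 N (hN _ i.2) _ ⟨hu𝒜 t, hi (Metric.mem_ball_self hδ)⟩ _ ⟨hv𝒜 t, hi h1⟩).trans ?_
    gcongr
    exact (hB _ i.2).trans (le_max_left _ _)
  obtain ⟨η, c, hη, hlow⟩ := exists_exp_le_norm_sub hev hK hF
    (fun b => (hu b).mono (le_max_right _ _) le_rfl)
    (fun b => (hv b).mono (le_max_right _ _) le_rfl) (hne a₀) (by positivity) hctrl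
  -- This is the squared Gaussian bound divided by the exponential lower bound without its
  -- prefactor: the quadratic exponent wins.
  have hlim : Tendsto (fun t : ℝ => C ^ 2 * Real.exp (-(t * (2 * κ * t - c)) - c * a₀)) atTop (𝓝 0) := by
    have h1 : Tendsto (fun t : ℝ => t * (2 * κ * t - c)) atTop atTop :=
      tendsto_id.atTop_mul_atTop₀
        (tendsto_atTop_add_const_right _ _ (tendsto_id.const_mul_atTop (by positivity)))
    have h2 := ((Real.tendsto_exp_neg_atTop_nhds_zero.comp h1).mul_const
      (Real.exp (-(c * a₀)))).const_mul (C ^ 2)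
    simpa [Function.comp_def, sub_eq_add_neg, Real.exp_add] using h2
  obtain ⟨t, ht, ht₀⟩ := ((hlim.eventually (gt_mem_nhds hη)).and (eventually_ge_atTop a₀)).exists
  have h1 := hlow t ht₀
  have h2 := hdecay t ((le_max_right _ _).trans ht₀)
  have h3 : ‖u t - v t‖ ^ 2 ≤ (C * Real.exp (-κ * t ^ 2)) ^ 2 := by gcongr
  rw [mul_pow, ← Real.exp_nat_mul] at h3
  have h4 : η ≤ C ^ 2 * Real.exp (-(t * (2 * κ * t - c)) - c * a₀) := by
    have h5 : Real.exp (-(t * (2 * κ * t - c)) - c * a₀)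
        = Real.exp ((2 : ℕ) * (-κ * t ^ 2)) * Real.exp (c * (t - a₀)) := by
      rw [← Real.exp_add]; congr 1; push_cast; ring
    have h6 := h1.trans h3
    rw [Real.exp_neg, ← div_eq_mul_inv, div_le_iff₀ (Real.exp_pos _)] at h6
    rw [h5, ← mul_assoc]
    exact h6
  linarith

theorem not_isBiLipschitzManeProjection (hev : ∀ n, 0 < ev n) {K : ℝ} (hK : 0 ≤ K)
    (hF : ∀ x y, ‖F x - F y‖ ≤ K * ‖x - y‖) {u v : ℝ → H}
    (hu : ∀ b, IsCoordSolutionOn e ev F u 0 b) (hv : ∀ b, IsCoordSolutionOn e ev F v 0 b)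
    (hne : ∀ t, u t ≠ v t) {C κ : ℝ} (hκ : 0 < κ)
    (hdecay : ∀ t, 0 ≤ t → ‖u t - v t‖ ≤ C * Real.exp (-κ * t ^ 2))
    {𝒜 : Set H} (h𝒜 : IsCompact 𝒜) (hu𝒜 : ∀ t, u t ∈ 𝒜) (hv𝒜 : ∀ t, v t ∈ 𝒜)
    (V : Submodule ℝ H) [hV : FiniteDimensional ℝ V] : ¬ IsBiLipschitzManeProjection 𝒜 V := by
  rintro ⟨M, hM⟩
  refine false_of_locally_biLipschitz hev hK hF hu hv hne hκ hdecay h𝒜 hu𝒜 hv𝒜 fun p _ =>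
    ⟨V, hV, M, univ, isOpen_univ, mem_univ _, fun x hx y hy => ?_⟩
  rw [map_sub]
  exact hM x hx.1 y hy.1

/-- On a graph over `V` the projection onto `V` recovers the base point, so distances are at most `1
+ L` times the distances of the projections. -/
theorem not_subset_lipschitzSubmanifold (hev : ∀ n, 0 < ev n) {K : ℝ} (hK : 0 ≤ K)
    (hF : ∀ x y, ‖F x - F y‖ ≤ K * ‖x - y‖) {u v : ℝ → H}
    (hu : ∀ b, IsCoordSolutionOn e ev F u 0 b) (hv : ∀ b, IsCoordSolutionOn e ev F v 0 b)
    (hne : ∀ t, u t ≠ v t) {C κ : ℝ} (hκ : 0 < κ)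
    (hdecay : ∀ t, 0 ≤ t → ‖u t - v t‖ ≤ C * Real.exp (-κ * t ^ 2))
    {𝒜 : Set H} (h𝒜 : IsCompact 𝒜) (hu𝒜 : ∀ t, u t ∈ 𝒜) (hv𝒜 : ∀ t, v t ∈ 𝒜)
    {n : ℕ} {M : Set H} (hM : IsLipschitzSubmanifold n M) : ¬ 𝒜 ⊆ M := by
  intro hsub
  refine false_of_locally_biLipschitz hev hK hF hu hv hne hκ hdecay h𝒜 hu𝒜 hv𝒜 fun p hp => ?_
  obtain ⟨V, hV, -, L, Φ, U, hΦ, hU, hpU, hMU⟩ := hM p (hsub hp)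
  refine ⟨V, hV, 1 + L, U, hU, hpU, fun x hx y hy => ?_⟩
  obtain ⟨⟨a, rfl⟩, -⟩ := hMU.subset ⟨hsub hx.1, hx.2⟩
  obtain ⟨⟨b, rfl⟩, -⟩ := hMU.subset ⟨hsub hy.1, hy.2⟩
  have h1 : V.orthogonalProjectionOnto ((a : H) + Φ a - (b + Φ b)) = a - b := by
    simp [Submodule.orthogonalProjectionOnto_apply_of_mem_orthogonal (Φ a).2,
      Submodule.orthogonalProjectionOnto_apply_of_mem_orthogonal (Φ b).2]
  simp only [h1]
  calc ‖(a : H) + Φ a - (b + Φ b)‖ = ‖((a - b : V) : H) + ((Φ a - Φ b : Vᗮ) : H)‖ := by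
        congr 1; push_cast; abel
    _ ≤ ‖a - b‖ + ‖Φ a - Φ b‖ := norm_add_le _ _
    _ ≤ ‖a - b‖ + L * ‖a - b‖ := by gcongr; exact hΦ.norm_sub_le _ _
    _ = (1 + L) * ‖a - b‖ := by ring

end Embedding

/-! ### The planar field of the clock and the cut-offs of the couplings -/

section Planar

/-- Smooth, bounded and Lipschitz with constant `C`. -/
structure IsPlanarCoeff (C : ℝ) (f : ℝ × ℝ → ℝ) : Prop where
  contDiff : ContDiff ℝ ∞ f
  abs_le : ∀ p, |f p| ≤ C
  abs_sub_le : ∀ p q, |f p - f q| ≤ C * ‖p - q‖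

theorem exists_isPlanarCoeff {f : ℝ × ℝ → ℝ} (hf : ContDiff ℝ ∞ f) (hc : HasCompactSupport f) :
    ∃ C, IsPlanarCoeff C f := by
  obtain ⟨C₁, hC₁⟩ := ContDiff.lipschitzWith_of_hasCompactSupport hc hf (by simp)
  obtain ⟨C₂, hC₂⟩ := hf.continuous.bounded_above_of_compact_support hc
  refine ⟨max C₁ C₂, hf, fun p => (hC₂ p).trans (le_max_right _ _), fun p q => ?_⟩
  refine (hC₁.norm_sub_le p q).trans ?_
  gcongr
  exact le_max_left _ _

theorem IsPlanarCoeff.nonneg {C : ℝ} {f : ℝ × ℝ → ℝ} (h : IsPlanarCoeff C f) : 0 ≤ C :=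
  (abs_nonneg _).trans (h.abs_le 0)

/-- A function of the squared radius: the clock is pushed outwards at unit rate while the squared
radius is at most `3`, and not at all from `4` on. -/
noncomputable def radialRate : ℝ → ℝ := (⟨3, 4, by norm_num, by norm_num⟩ : ContDiffBump (0 : ℝ))

/-- Also a function of the squared radius. There is no rotation up to `2`, so the field is the
identity near the unit segment of the first axis; the speed is one on `[3, 5]`, where the clock ends
up. -/
noncomputable def angularRate : ℝ → ℝ := (⟨1, 2, by norm_num, by norm_num⟩ : ContDiffBump (4 : ℝ))

theorem contDiff_radialRate : ContDiff ℝ ∞ radialRate := ContDiffBump.contDiff _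

theorem contDiff_angularRate : ContDiff ℝ ∞ angularRate := ContDiffBump.contDiff _

theorem radialRate_mem (q : ℝ) : radialRate q ∈ Icc (0 : ℝ) 1 :=
  ⟨ContDiffBump.nonneg _, ContDiffBump.le_one _⟩

theorem angularRate_mem (q : ℝ) : angularRate q ∈ Icc (0 : ℝ) 1 :=
  ⟨ContDiffBump.nonneg _, ContDiffBump.le_one _⟩

theorem radialRate_eq_one {q : ℝ} (h : |q| ≤ 3) : radialRate q = 1 :=
  ContDiffBump.one_of_mem_closedBall _ (by simpa using h)

theorem radialRate_eq_zero {q : ℝ} (h : 4 ≤ |q|) : radialRate q = 0 :=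
  ContDiffBump.zero_of_le_dist _ (by simpa using h)

theorem angularRate_eq_one {q : ℝ} (h : 3 ≤ q) (h' : q ≤ 5) : angularRate q = 1 :=
  ContDiffBump.one_of_mem_closedBall _ (by
    rw [Metric.mem_closedBall, Real.dist_eq]; exact abs_le.2 ⟨by linarith, by linarith⟩)

theorem angularRate_eq_zero {q : ℝ} (h : q ≤ 2) : angularRate q = 0 :=
  ContDiffBump.zero_of_le_dist _ (by
    rw [Real.dist_eq, abs_of_nonpos (by linarith)]; simp only; linarith)

theorem angularRate_eq_zero' {q : ℝ} (h : 6 ≤ q) : angularRate q = 0 :=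
  ContDiffBump.zero_of_le_dist _ (by
    rw [Real.dist_eq, abs_of_nonneg (by linarith)]; simp only; linarith)

/-- First component of the planar field. -/
noncomputable def planarX (p : ℝ × ℝ) : ℝ :=
  radialRate (p.1 ^ 2 + p.2 ^ 2) * p.1 - angularRate (p.1 ^ 2 + p.2 ^ 2) * p.2

/-- Second component of the planar field. -/
noncomputable def planarY (p : ℝ × ℝ) : ℝ :=
  radialRate (p.1 ^ 2 + p.2 ^ 2) * p.2 + angularRate (p.1 ^ 2 + p.2 ^ 2) * p.1

theorem hasCompactSupport_of_sq {f : ℝ × ℝ → ℝ} (h : ∀ p : ℝ × ℝ, 6 ≤ p.1 ^ 2 + p.2 ^ 2 → f p = 0) :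
    HasCompactSupport f := by
  refine HasCompactSupport.intro (isCompact_closedBall (0 : ℝ × ℝ) 6) fun p hp => h p ?_
  rw [mem_closedBall_zero_iff, Prod.norm_def, sup_le_iff, not_and_or] at hp
  simp only [Real.norm_eq_abs, not_le] at hp
  rcases hp with hp | hp
  · nlinarith [sq_nonneg p.2, sq_abs p.1]
  · nlinarith [sq_nonneg p.1, sq_abs p.2]

theorem contDiff_planarX : ContDiff ℝ ∞ planarX := by
  have h1 : ContDiff ℝ ∞ fun p : ℝ × ℝ => p.1 ^ 2 + p.2 ^ 2 := by fun_prop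
  exact ((contDiff_radialRate.comp h1).mul contDiff_fst).sub
    ((contDiff_angularRate.comp h1).mul contDiff_snd)

theorem contDiff_planarY : ContDiff ℝ ∞ planarY := by
  have h1 : ContDiff ℝ ∞ fun p : ℝ × ℝ => p.1 ^ 2 + p.2 ^ 2 := by fun_prop
  exact ((contDiff_radialRate.comp h1).mul contDiff_snd).add
    ((contDiff_angularRate.comp h1).mul contDiff_fst)

theorem exists_isPlanarCoeff_planarX : ∃ C, IsPlanarCoeff C planarX :=
  exists_isPlanarCoeff contDiff_planarX (hasCompactSupport_of_sq fun p hp => by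
    rw [planarX, radialRate_eq_zero (by rw [abs_of_nonneg] <;> linarith),
      angularRate_eq_zero' hp]; ring)

theorem exists_isPlanarCoeff_planarY : ∃ C, IsPlanarCoeff C planarY :=
  exists_isPlanarCoeff contDiff_planarY (hasCompactSupport_of_sq fun p hp => by
    rw [planarY, radialRate_eq_zero (by rw [abs_of_nonneg] <;> linarith),
      angularRate_eq_zero' hp]; ring)

/-- The angle by which a mode is rotated into the next one, as a function of the position. -/
noncomputable def angle (x : ℝ) : ℝ := Real.pi / 2 * Real.smoothTransition (3 * x - 1)

theorem contDiff_angle : ContDiff ℝ ∞ angle :=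
  contDiff_const.mul (Real.smoothTransition.contDiff.comp (by fun_prop))

theorem angle_of_le {x : ℝ} (h : x ≤ 1 / 3) : angle x = 0 := by
  rw [angle, Real.smoothTransition.zero_of_nonpos (by linarith), mul_zero]

theorem angle_of_ge {x : ℝ} (h : 2 / 3 ≤ x) : angle x = Real.pi / 2 := by
  rw [angle, Real.smoothTransition.one_of_one_le (by linarith), mul_one]

theorem deriv_angle_of_lt {x : ℝ} (h : x < 1 / 3) : deriv angle x = 0 := by
  have : angle =ᶠ[𝓝 x] fun _ => 0 := by
    filter_upwards [Iio_mem_nhds h] with y hy using angle_of_le (le_of_lt hy)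
  rw [this.deriv_eq]; simp

theorem deriv_angle_of_gt {x : ℝ} (h : 2 / 3 < x) : deriv angle x = 0 := by
  have : angle =ᶠ[𝓝 x] fun _ => Real.pi / 2 := by
    filter_upwards [Ioi_mem_nhds h] with y hy using angle_of_ge (le_of_lt hy)
  rw [this.deriv_eq]; simp

/-- Cut-off equal to one on `[1/3, 2/3]`, vanishing outside `[1/6, 5/6]`. -/
noncomputable def strip : ℝ → ℝ :=
  (⟨1 / 6, 1 / 3, by norm_num, by norm_num⟩ : ContDiffBump (1 / 2 : ℝ))

theorem contDiff_strip : ContDiff ℝ ∞ strip := ContDiffBump.contDiff _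

theorem strip_mem (x : ℝ) : strip x ∈ Icc (0 : ℝ) 1 :=
  ⟨ContDiffBump.nonneg _, ContDiffBump.le_one _⟩

theorem strip_eq_one {x : ℝ} (h : 1 / 3 ≤ x) (h' : x ≤ 2 / 3) : strip x = 1 :=
  ContDiffBump.one_of_mem_closedBall _ (by
    rw [Metric.mem_closedBall, Real.dist_eq]; exact abs_le.2 ⟨by linarith, by linarith⟩)

theorem strip_eq_zero {x : ℝ} (h : x ≤ 1 / 6 ∨ 5 / 6 ≤ x) : strip x = 0 :=
  ContDiffBump.zero_of_le_dist _ (by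
    rw [Real.dist_eq]
    rcases h with h | h
    · rw [abs_of_nonpos (by linarith)]; simp only; linarith
    · rw [abs_of_nonneg (by linarith)]; simp only; linarith)

/-- The gates distinguish by the second coordinate the three ways the clock meets the strip: along
the first axis on leaving the origin, and above or below it while circling. -/
noncomputable def centralGate : ℝ → ℝ :=
  (⟨1 / 4, 1 / 2, by norm_num, by norm_num⟩ : ContDiffBump (0 : ℝ))

noncomputable def upperGate : ℝ → ℝ := (⟨1, 3 / 2, by norm_num, by norm_num⟩ : ContDiffBump (2 : ℝ))

noncomputable def lowerGate (y : ℝ) : ℝ := upperGate (-y)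

theorem contDiff_centralGate : ContDiff ℝ ∞ centralGate := ContDiffBump.contDiff _

theorem contDiff_upperGate : ContDiff ℝ ∞ upperGate := ContDiffBump.contDiff _

theorem contDiff_lowerGate : ContDiff ℝ ∞ lowerGate := contDiff_upperGate.comp contDiff_neg

theorem centralGate_mem (y : ℝ) : centralGate y ∈ Icc (0 : ℝ) 1 :=
  ⟨ContDiffBump.nonneg _, ContDiffBump.le_one _⟩

theorem upperGate_mem (y : ℝ) : upperGate y ∈ Icc (0 : ℝ) 1 :=
  ⟨ContDiffBump.nonneg _, ContDiffBump.le_one _⟩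

theorem lowerGate_mem (y : ℝ) : lowerGate y ∈ Icc (0 : ℝ) 1 := upperGate_mem _

theorem centralGate_eq_one {y : ℝ} (h : |y| ≤ 1 / 4) : centralGate y = 1 :=
  ContDiffBump.one_of_mem_closedBall _ (by simpa using h)

theorem centralGate_eq_zero {y : ℝ} (h : 1 / 2 ≤ |y|) : centralGate y = 0 :=
  ContDiffBump.zero_of_le_dist _ (by simpa using h)

theorem upperGate_eq_one {y : ℝ} (h : 1 ≤ y) (h' : y ≤ 3) : upperGate y = 1 :=
  ContDiffBump.one_of_mem_closedBall _ (by
    rw [Metric.mem_closedBall, Real.dist_eq]; exact abs_le.2 ⟨by linarith, by linarith⟩)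

theorem upperGate_eq_zero {y : ℝ} (h : y ≤ 1 / 2 ∨ 7 / 2 ≤ y) : upperGate y = 0 :=
  ContDiffBump.zero_of_le_dist _ (by
    rw [Real.dist_eq]
    rcases h with h | h
    · rw [abs_of_nonpos (by linarith)]; simp only; linarith
    · rw [abs_of_nonneg (by linarith)]; simp only; linarith)

/-- At most one gate is open at each height, so the three couplings together cost no more than one
of them. -/
theorem gates_add_le (y : ℝ) : centralGate y + upperGate y + lowerGate y ≤ 1 := by
  have h0 := (centralGate_mem y).2
  have h1 := (upperGate_mem y).2
  have h2 := (lowerGate_mem y).2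
  rcases le_total (1 / 2) y with h | h
  · rw [centralGate_eq_zero (h.trans (le_abs_self y)), lowerGate,
      upperGate_eq_zero (y := -y) (.inl (by linarith))]
    linarith
  rcases le_total y (-(1 / 2)) with h' | h'
  · rw [centralGate_eq_zero (le_trans (by linarith) (neg_le_abs y)), upperGate_eq_zero (.inl h)]
    linarith
  · rw [upperGate_eq_zero (.inl h), lowerGate,
      upperGate_eq_zero (y := -y) (.inl (by linarith))]
    linarith

theorem hasCompactSupport_of_strip {f : ℝ × ℝ → ℝ}
    (h : ∀ p : ℝ × ℝ, (p.1 ≤ 1 / 6 ∨ 5 / 6 ≤ p.1 ∨ 7 / 2 ≤ |p.2|) → f p = 0) :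
    HasCompactSupport f := by
  refine HasCompactSupport.intro (isCompact_closedBall (0 : ℝ × ℝ) 4) fun p hp => h p ?_
  rw [mem_closedBall_zero_iff, Prod.norm_def, sup_le_iff, not_and_or] at hp
  simp only [Real.norm_eq_abs, not_le] at hp
  rcases hp with hp | hp
  · rcases lt_abs.1 hp with hp | hp
    · exact .inr (.inl (by linarith))
    · exact .inl (by linarith)
  · exact .inr (.inr (by linarith))

/-- A smooth cut-off in the second variable. -/
structure IsGate (γ : ℝ → ℝ) : Prop where
  contDiff : ContDiff ℝ ∞ γ
  eq_zero : ∀ y, 7 / 2 ≤ |y| → γ y = 0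

theorem isGate_centralGate : IsGate centralGate :=
  ⟨contDiff_centralGate, fun _ h => centralGate_eq_zero (by linarith)⟩

theorem isGate_upperGate : IsGate upperGate :=
  ⟨contDiff_upperGate, fun y h => upperGate_eq_zero (by
    rcases le_abs.1 h with h | h
    · exact .inr h
    · exact .inl (by linarith))⟩

theorem isGate_lowerGate : IsGate lowerGate :=
  ⟨contDiff_lowerGate, fun y h => isGate_upperGate.eq_zero (-y) (by rwa [abs_neg])⟩

/-- The coefficient of the diagonal part of the coupling near a gate. -/
noncomputable def balance (γ : ℝ → ℝ) (p : ℝ × ℝ) : ℝ := strip p.1 * γ p.2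

/-- The coefficient of the rotation part of the coupling near a gate. -/
noncomputable def swing (γ : ℝ → ℝ) (p : ℝ × ℝ) : ℝ := deriv angle p.1 * planarX p * γ p.2

theorem IsGate.exists_isPlanarCoeff_balance {γ : ℝ → ℝ} (hγ : IsGate γ) :
    ∃ C, IsPlanarCoeff C (balance γ) := by
  refine exists_isPlanarCoeff ((contDiff_strip.comp contDiff_fst).mul
    (hγ.contDiff.comp contDiff_snd)) (hasCompactSupport_of_strip fun p hp => ?_)
  rcases hp with h | h | h
  · rw [balance, strip_eq_zero (.inl h), zero_mul]
  · rw [balance, strip_eq_zero (.inr h), zero_mul]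
  · rw [balance, hγ.eq_zero _ h, mul_zero]

theorem IsGate.exists_isPlanarCoeff_swing {γ : ℝ → ℝ} (hγ : IsGate γ) :
    ∃ C, IsPlanarCoeff C (swing γ) := by
  refine exists_isPlanarCoeff
    ((((contDiff_infty_iff_deriv.1 contDiff_angle).2.comp contDiff_fst).mul contDiff_planarX).mul
      (hγ.contDiff.comp contDiff_snd)) (hasCompactSupport_of_strip fun p hp => ?_)
  rcases hp with h | h | h
  · rw [swing, deriv_angle_of_lt (by linarith), zero_mul, zero_mul]
  · rw [swing, deriv_angle_of_gt (by linarith), zero_mul, zero_mul]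
  · rw [swing, hγ.eq_zero _ h, mul_zero]

end Planar

/-! ### Calculus of bounded Lipschitz maps -/

section BoundedLipschitz

variable {E : Type*} [NormedAddCommGroup E]

/-- Bounded and Lipschitz, both with constant `C`. -/
def IsBoundedLipschitz (C : ℝ) (G : E → E) : Prop :=
  (∀ u, ‖G u‖ ≤ C) ∧ ∀ u v, ‖G u - G v‖ ≤ C * ‖u - v‖

theorem IsBoundedLipschitz.nonneg {C : ℝ} {G : E → E} (h : IsBoundedLipschitz C G) : 0 ≤ C :=
  (norm_nonneg _).trans (h.1 0)

theorem IsBoundedLipschitz.add {C C' : ℝ} {G G' : E → E} (h : IsBoundedLipschitz C G)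
    (h' : IsBoundedLipschitz C' G') : IsBoundedLipschitz (C + C') fun u => G u + G' u := by
  refine ⟨fun u => (norm_add_le _ _).trans (add_le_add (h.1 u) (h'.1 u)), fun u v => ?_⟩
  rw [add_sub_add_comm, add_mul]
  exact (norm_add_le _ _).trans (add_le_add (h.2 u v) (h'.2 u v))

theorem IsBoundedLipschitz.smul {C M : ℝ} [NormedSpace ℝ E] {a : E → ℝ} {G : E → E}
    (ha : ∀ u, |a u| ≤ M)
    (ha' : ∀ u v, |a u - a v| ≤ M * ‖u - v‖) (h : IsBoundedLipschitz C G) :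
    IsBoundedLipschitz (2 * (M * C)) fun u => a u • G u := by
  have hC := h.nonneg
  have hM : 0 ≤ M := (abs_nonneg _).trans (ha 0)
  refine ⟨fun u => ?_, fun u v => ?_⟩
  · rw [norm_smul, Real.norm_eq_abs]
    nlinarith [mul_le_mul (ha u) (h.1 u) (norm_nonneg _) hM, mul_nonneg hM hC]
  · have : a u • G u - a v • G v = a u • (G u - G v) + (a u - a v) • G v := by
      rw [smul_sub, sub_smul]; abel
    rw [this]
    calc _ ≤ |a u| * ‖G u - G v‖ + |a u - a v| * ‖G v‖ := by
          refine (norm_add_le _ _).trans ?_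
          rw [norm_smul, norm_smul, Real.norm_eq_abs, Real.norm_eq_abs]
      _ ≤ M * (C * ‖u - v‖) + M * ‖u - v‖ * C := by
          gcongr
          · exact ha u
          · exact h.2 u v
          · exact ha' u v
          · exact h.1 v
      _ = 2 * (M * C) * ‖u - v‖ := by ring

theorem IsBoundedLipschitz.const {x : E} (hx : ‖x‖ ≤ 1) : IsBoundedLipschitz 1 fun _ : E => x :=
  ⟨fun _ => hx, fun u v => by simp⟩

theorem IsBoundedLipschitz.clm [NormedSpace ℝ E] {C : ℝ} {G : E → E} (h : IsBoundedLipschitz C G)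
    {T : E →L[ℝ] E}
    (hT : ‖T‖ ≤ 1) : IsBoundedLipschitz C fun u => T (G u) := by
  have hT' : ∀ x, ‖T x‖ ≤ ‖x‖ := fun x =>
    (T.le_opNorm x).trans (mul_le_of_le_one_left (norm_nonneg _) hT)
  refine ⟨fun u => (hT' _).trans (h.1 u), fun u v => ?_⟩
  rw [← map_sub]
  exact (hT' _).trans (h.2 u v)

theorem IsBoundedLipschitz.neg {C : ℝ} {G : E → E} (h : IsBoundedLipschitz C G) :
    IsBoundedLipschitz C fun u => -G u :=
  ⟨fun u => by rw [norm_neg]; exact h.1 u, fun u v => by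
    rw [← neg_sub', norm_neg]; exact h.2 u v⟩

end BoundedLipschitz

/-- The linear data from which the nonlinearity is built: two diagonal operators `Dp`, `Dm`, which
balance the decay rates of consecutive modes of a chain, and two operators `Jp`, `Jm`, which rotate
these modes into each other. -/
structure ChainData (H : Type*) [NormedAddCommGroup H] [InnerProductSpace ℝ H] where
  e : HilbertBasis ℕ ℝ H
  lam0 : ℝ
  lam1 : ℝ
  gap0 : ℝ
  Δ : ℝ
  c : ℕ
  bp : ℕ → ℝ
  bm : ℕ → ℝ
  Dp : H →L[ℝ] H
  Dm : H →L[ℝ] H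
  Jp : H →L[ℝ] H
  Jm : H →L[ℝ] H
  lam0_nonneg : 0 ≤ lam0
  lam0_le : lam0 ≤ lam1
  gap0_nonneg : 0 ≤ gap0
  gap0_le : gap0 ≤ Δ
  two_le_c : 2 ≤ c
  norm_Dp : ‖Dp‖ ≤ Δ
  norm_Dm : ‖Dm‖ ≤ Δ
  norm_Jp : ‖Jp‖ ≤ 1
  norm_Jm : ‖Jm‖ ≤ 1
  inner_Dp : ∀ n x, inner ℝ (e n) (Dp x) = bp n * inner ℝ (e n) x
  inner_Dm : ∀ n x, inner ℝ (e n) (Dm x) = bm n * inner ℝ (e n) x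

/-! ### The nonlinearity: smoothness, boundedness and Lipschitz constant -/

namespace ChainData

variable (P : ChainData H)

/-- The coordinates of `u` in the plane of the clock. -/
noncomputable def plane (u : H) : ℝ × ℝ := (inner ℝ (P.e 0) u, inner ℝ (P.e 1) u)

/-- The part of `u` orthogonal to the plane of the clock. -/
noncomputable def rest (u : H) : H :=
  u - inner ℝ (P.e 0) u • P.e 0 - inner ℝ (P.e 1) u • P.e 1

/-- The main part of the nonlinearity, with the coefficients taken at the point `p`. -/
noncomputable def mainPart (ε : ℝ) (p : ℝ × ℝ) (u : H) : H :=
  (P.lam0 * trunc 3 (inner ℝ (P.e 0) u)) • P.e 0 +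
  (P.lam1 * trunc 3 (inner ℝ (P.e 1) u)
    - balance centralGate p * ((P.lam1 + ε + P.gap0) * trunc ε (inner ℝ (P.e 1) u))) • P.e 1 +
  (balance centralGate p • ((P.gap0 * trunc ε (inner ℝ (P.e P.c) u)) • P.e P.c) +
    balance upperGate p • P.Dp (radialTrunc ε (P.rest u)) +
    balance lowerGate p • P.Dm (radialTrunc ε (P.rest u)))

/-- The small part of the nonlinearity. -/
noncomputable def smallPart (ε : ℝ) (u : H) : H :=
  planarX (P.plane u) • P.e 0 + planarY (P.plane u) • P.e 1 +
  swing centralGate (P.plane u) • (-(trunc ε (inner ℝ (P.e P.c) u) • P.e 1)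
    + trunc ε (inner ℝ (P.e 1) u) • P.e P.c) +
  swing upperGate (P.plane u) • (-P.Jp (radialTrunc ε (P.rest u))) +
  swing lowerGate (P.plane u) • P.Jm (radialTrunc ε (P.rest u))

/-- The nonlinearity. -/
noncomputable def field (ε : ℝ) (u : H) : H := P.mainPart ε (P.plane u) u + ε • P.smallPart ε u

theorem abs_inner_le (n : ℕ) (u : H) : |inner ℝ (P.e n) u| ≤ ‖u‖ := by
  have := abs_real_inner_le_norm (P.e n) u
  rwa [P.e.orthonormal.1 n, one_mul] at this

theorem norm_plane_sub_le (u v : H) : ‖P.plane u - P.plane v‖ ≤ ‖u - v‖ := by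
  rw [plane, plane, Prod.mk_sub_mk, ← inner_sub_right, ← inner_sub_right, Prod.norm_def]
  exact sup_le (P.abs_inner_le 0 _) (P.abs_inner_le 1 _)

theorem rest_sub (u v : H) : P.rest u - P.rest v = P.rest (u - v) := by
  simp only [rest, inner_sub_right, sub_smul]; abel

theorem inner_rest (n : ℕ) (u : H) :
    inner ℝ (P.e n) (P.rest u) = if n < 2 then 0 else inner ℝ (P.e n) u := by
  simp only [rest, inner_sub_right, inner_smul_right, inner_basis]
  rcases n with _ | _ | n <;> simp

theorem norm_rest_le (u : H) : ‖P.rest u‖ ≤ ‖u‖ := by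
  rw [← one_mul ‖u‖]
  refine norm_le_of_abs_inner_le P.e zero_le_one fun n => ?_
  rw [inner_rest]; split_ifs <;> simp

theorem norm_rest_sub_le (u v : H) : ‖P.rest u - P.rest v‖ ≤ ‖u - v‖ := by
  rw [rest_sub]; exact P.norm_rest_le _

theorem norm_sq_decomp (a b : ℝ) {w : H} (h0 : inner ℝ (P.e 0) w = 0)
    (h1 : inner ℝ (P.e 1) w = 0) :
    ‖a • P.e 0 + b • P.e 1 + w‖ ^ 2 = a ^ 2 + b ^ 2 + ‖w‖ ^ 2 := by
  have h01 : inner ℝ (P.e 0) (P.e 1) = (0 : ℝ) := by simp [inner_basis]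
  rw [norm_add_sq_real, norm_add_sq_real, norm_smul, norm_smul, P.e.orthonormal.1,
    P.e.orthonormal.1, inner_add_left]
  simp only [inner_smul_left, inner_smul_right, h0, h1, h01, RCLike.conj_to_real,
    Real.norm_eq_abs, mul_one, sq_abs]
  ring

theorem norm_sq_eq (u : H) :
    ‖u‖ ^ 2 = inner ℝ (P.e 0) u ^ 2 + inner ℝ (P.e 1) u ^ 2 + ‖P.rest u‖ ^ 2 := by
  rw [← P.norm_sq_decomp _ _ (by simp [inner_rest]) (by simp [inner_rest])]
  congr 2
  rw [rest]; abel

theorem Δ_nonneg : 0 ≤ P.Δ := P.gap0_nonneg.trans P.gap0_le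

/-- The correction changes the slope from `lam` (cancelling the eigenvalue) towards `-d - ε`
(balancing with the next mode). For `|x| ≤ 2 ε` the outer truncation is still the identity and the
slope lies between these two values; farther out the correction is constant. The costs `lam` and `d`
therefore never add up. -/
theorem _root_.SemilinearParabolic.abs_blend_sub_le {lam d ε a : ℝ} (hlam : 0 ≤ lam) (hd : 0 ≤ d)
    (hε : 0 < ε) (hε1 : ε ≤ 1) (ha : a ∈ Icc (0 : ℝ) 1) (s t : ℝ) :
    |(lam * trunc 3 s - a * ((lam + ε + d) * trunc ε s))
      - (lam * trunc 3 t - a * ((lam + ε + d) * trunc ε t))| ≤ (max lam d + ε) * |s - t| := by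
  have hd' : ∀ x, HasDerivAt (fun x => lam * trunc 3 x - a * ((lam + ε + d) * trunc ε x))
      (lam * deriv (trunc 3) x - a * ((lam + ε + d) * deriv (trunc ε) x)) x := fun x =>
    ((differentiable_trunc x).hasDerivAt.const_mul lam).sub
      (((differentiable_trunc x).hasDerivAt.const_mul _).const_mul a)
  have := convex_univ.norm_image_sub_le_of_norm_hasDerivWithin_le (C := max lam d + ε)
    (fun x _ => (hd' x).hasDerivWithinAt) (fun x _ => ?_) (mem_univ t) (mem_univ s)
  · simpa using this
  have h3 := deriv_trunc_mem (by norm_num : (0 : ℝ) < 3) x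
  have hεx := deriv_trunc_mem hε x
  have hml := le_max_left lam d
  have hmd := le_max_right lam d
  rw [Real.norm_eq_abs, abs_le]
  rcases le_total |x| (2 * ε) with hx | hx
  · rw [deriv_trunc_of_le (by norm_num : (0 : ℝ) < 3) (by linarith)]
    have h1 : a * deriv (trunc ε) x ∈ Icc (0 : ℝ) 1 :=
      ⟨mul_nonneg ha.1 hεx.1, mul_le_one₀ ha.2 hεx.1 hεx.2⟩
    constructor <;> nlinarith [h1.1, h1.2]
  · rw [deriv_trunc_of_ge hε hx]
    constructor <;> nlinarith [h3.1, h3.2]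

/-- With frozen coefficients the map preserves the orthogonal splitting into `e 0`, `e 1` and the
rest, each block of the output depending only on the same block of the input. By Pythagoras the
constant is the maximum of the three, which yields the two separate thresholds for `L`. -/
theorem norm_mainPart_sub_le {ε : ℝ} (hε : 0 < ε) (hε1 : ε ≤ 1) (p : ℝ × ℝ) (u v : H) :
    ‖P.mainPart ε p u - P.mainPart ε p v‖ ≤ (max P.lam1 P.Δ + ε) * ‖u - v‖ := by
  have hΔ := P.Δ_nonneg
  have hl1 : 0 ≤ P.lam1 := P.lam0_nonneg.trans P.lam0_le
  have hm1 := le_max_left P.lam1 P.Δ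
  have hmΔ := le_max_right P.lam1 P.Δ
  have hM : 0 ≤ max P.lam1 P.Δ + ε := by linarith
  have hs := strip_mem p.1
  have hg0 := centralGate_mem p.2
  have hg1 := upperGate_mem p.2
  have hg2 := lowerGate_mem p.2
  have hb : ∀ {g : ℝ}, g ∈ Icc (0 : ℝ) 1 → strip p.1 * g ∈ Icc (0 : ℝ) 1 := fun hg =>
    ⟨mul_nonneg hs.1 hg.1, mul_le_one₀ hs.2 hg.1 hg.2⟩
  set W : H → H := fun u => balance centralGate p • ((P.gap0 * trunc ε (inner ℝ (P.e P.c) u)) • P.e P.c) +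
    balance upperGate p • P.Dp (radialTrunc ε (P.rest u)) +
    balance lowerGate p • P.Dm (radialTrunc ε (P.rest u)) with hW
  have hc2 : ¬ P.c < 2 := not_lt.2 P.two_le_c
  have hW0 : ∀ n, n < 2 → ∀ u, inner ℝ (P.e n) (W u) = 0 := fun n hn u => by
    have hT : inner ℝ (P.e n) (radialTrunc ε (P.rest u)) = 0 := by
      rw [radialTrunc, inner_smul_right, inner_rest, if_pos hn, mul_zero]
    have hne : n ≠ P.c := by rintro rfl; exact hc2 hn
    simp only [hW, inner_add_right, inner_smul_right, P.inner_Dp, P.inner_Dm, hT, inner_basis,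
      if_neg hne, mul_zero, add_zero]
  have hWl : ‖W u - W v‖ ≤ P.Δ * ‖P.rest (u - v)‖ := by
    have hD : ∀ T : H →L[ℝ] H, ‖T‖ ≤ P.Δ → ‖T (radialTrunc ε (P.rest u) - radialTrunc ε (P.rest v))‖
        ≤ P.Δ * ‖P.rest (u - v)‖ := fun T hT => by
      refine (T.le_opNorm _).trans ?_
      rw [← rest_sub]
      gcongr
      exact norm_radialTrunc_sub_le hε _ _
    have hz : ‖(P.gap0 * trunc ε (inner ℝ (P.e P.c) u) - P.gap0 * trunc ε (inner ℝ (P.e P.c) v))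
        • P.e P.c‖ ≤ P.Δ * ‖P.rest (u - v)‖ := by
      rw [norm_smul, P.e.orthonormal.1, mul_one, ← mul_sub, norm_mul, Real.norm_eq_abs,
        Real.norm_eq_abs, abs_of_nonneg P.gap0_nonneg]
      have h1 := P.abs_inner_le P.c (P.rest (u - v))
      rw [inner_rest, if_neg hc2, inner_sub_right] at h1
      exact mul_le_mul P.gap0_le ((abs_trunc_sub_le hε _ _).trans h1) (abs_nonneg _) hΔ
    have hdec : W u - W v = balance centralGate p •
          ((P.gap0 * trunc ε (inner ℝ (P.e P.c) u) - P.gap0 * trunc ε (inner ℝ (P.e P.c) v)) • P.e P.c) +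
        balance upperGate p • P.Dp (radialTrunc ε (P.rest u) - radialTrunc ε (P.rest v)) +
        balance lowerGate p • P.Dm (radialTrunc ε (P.rest u) - radialTrunc ε (P.rest v)) := by
      simp only [hW, map_sub, smul_sub, sub_smul]; abel
    have hsum : balance centralGate p + balance upperGate p + balance lowerGate p ≤ 1 := by
      rw [balance, balance, balance, ← mul_add, ← mul_add]
      exact mul_le_one₀ hs.2 (by linarith [hg0.1, hg1.1, hg2.1]) (gates_add_le p.2)
    rw [hdec]
    set X := P.Δ * ‖P.rest (u - v)‖
    have hX : 0 ≤ X := by positivity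
    have hbal : ∀ {g : ℝ → ℝ} {x : H}, g p.2 ∈ Icc (0 : ℝ) 1 → ‖x‖ ≤ X →
        ‖balance g p • x‖ ≤ balance g p * X := fun {g x} hg hx => by
      have h0 : 0 ≤ balance g p := (hb hg).1
      rw [norm_smul, Real.norm_of_nonneg h0]
      gcongr
    calc _ ≤ balance centralGate p * X + balance upperGate p * X + balance lowerGate p * X :=
          (norm_add₃_le).trans (add_le_add (add_le_add (hbal hg0 hz) (hbal hg1 (hD _ P.norm_Dp)))
            (hbal hg2 (hD _ P.norm_Dm)))
      _ = (balance centralGate p + balance upperGate p + balance lowerGate p) * X := by ring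
      _ ≤ X := mul_le_of_le_one_left hX hsum
  have hx : |P.lam0 * trunc 3 (inner ℝ (P.e 0) u) - P.lam0 * trunc 3 (inner ℝ (P.e 0) v)|
      ≤ (max P.lam1 P.Δ + ε) * |inner ℝ (P.e 0) (u - v)| := by
    rw [← mul_sub, abs_mul, abs_of_nonneg P.lam0_nonneg, inner_sub_right]
    exact mul_le_mul (by linarith [P.lam0_le]) (abs_trunc_sub_le (by norm_num) _ _) (abs_nonneg _) hM
  have hy := abs_blend_sub_le hl1 P.gap0_nonneg hε hε1 (hb hg0)
    (inner ℝ (P.e 1) u) (inner ℝ (P.e 1) v)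
  rw [← inner_sub_right] at hy
  have hy' := hy.trans (mul_le_mul_of_nonneg_right
    (add_le_add (max_le_max le_rfl P.gap0_le) le_rfl) (abs_nonneg _))
  have hdiff : P.mainPart ε p u - P.mainPart ε p v =
      (P.lam0 * trunc 3 (inner ℝ (P.e 0) u) - P.lam0 * trunc 3 (inner ℝ (P.e 0) v)) • P.e 0 +
      ((P.lam1 * trunc 3 (inner ℝ (P.e 1) u)
        - strip p.1 * centralGate p.2 * ((P.lam1 + ε + P.gap0) * trunc ε (inner ℝ (P.e 1) u)))
      - (P.lam1 * trunc 3 (inner ℝ (P.e 1) v)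
        - strip p.1 * centralGate p.2 * ((P.lam1 + ε + P.gap0) * trunc ε (inner ℝ (P.e 1) v)))) • P.e 1
      + (W u - W v) := by
    simp only [mainPart, hW, balance, sub_smul]; abel
  refine le_of_sq_le_sq ?_ (by positivity)
  rw [hdiff, P.norm_sq_decomp _ _ (by rw [inner_sub_right, hW0 0 (by norm_num), hW0 0 (by norm_num), sub_self])
    (by rw [inner_sub_right, hW0 1 (by norm_num), hW0 1 (by norm_num), sub_self]), mul_pow,
    P.norm_sq_eq (u - v), mul_add, mul_add]
  refine add_le_add (add_le_add ?_ ?_) ?_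
  · rw [← sq_abs, ← sq_abs (inner ℝ (P.e 0) (u - v)), ← mul_pow]
    gcongr
  · rw [← sq_abs, ← sq_abs (inner ℝ (P.e 1) (u - v)), ← mul_pow]
    gcongr
  · rw [← mul_pow]
    gcongr
    exact hWl.trans (by gcongr; linarith)

/-- Every term with a position-dependent coefficient is truncated at amplitude of order `ε`; the two
terms truncated at the fixed scale `3` have constant coefficients. -/
theorem exists_norm_mainPart_sub_le : ∃ C, 0 ≤ C ∧ ∀ ε, 0 < ε → ε ≤ 1 → ∀ p q u,
    ‖P.mainPart ε p u - P.mainPart ε q u‖ ≤ C * ε * ‖p - q‖ := by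
  obtain ⟨C0, h0⟩ := isGate_centralGate.exists_isPlanarCoeff_balance
  obtain ⟨C1, h1⟩ := isGate_upperGate.exists_isPlanarCoeff_balance
  obtain ⟨C2, h2⟩ := isGate_lowerGate.exists_isPlanarCoeff_balance
  have hΔ := P.Δ_nonneg
  have hl1 : 0 ≤ P.lam1 := P.lam0_nonneg.trans P.lam0_le
  have hg := P.gap0_nonneg
  have := h0.nonneg
  have := h1.nonneg
  have := h2.nonneg
  refine ⟨C0 * ((P.lam1 + 1 + P.gap0) * 2) + C0 * (P.gap0 * 2) + C1 * (P.Δ * 2) + C2 * (P.Δ * 2),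
    by positivity, fun ε hε hε1 p q u => ?_⟩
  have hdiff : P.mainPart ε p u - P.mainPart ε q u =
      -((balance centralGate p - balance centralGate q) •
        (((P.lam1 + ε + P.gap0) * trunc ε (inner ℝ (P.e 1) u)) • P.e 1)) +
      (balance centralGate p - balance centralGate q) •
        ((P.gap0 * trunc ε (inner ℝ (P.e P.c) u)) • P.e P.c) +
      (balance upperGate p - balance upperGate q) • P.Dp (radialTrunc ε (P.rest u)) +
      (balance lowerGate p - balance lowerGate q) • P.Dm (radialTrunc ε (P.rest u)) := by
    simp only [mainPart]; module
  have hsm : ∀ {C : ℝ} {f : ℝ × ℝ → ℝ} {M : ℝ} {x : H}, IsPlanarCoeff C f → ‖x‖ ≤ M * (2 * ε) →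
      ‖(f p - f q) • x‖ ≤ C * ‖p - q‖ * (M * (2 * ε)) := fun {C f M x} hf hx => by
    have := hf.nonneg
    rw [norm_smul, Real.norm_eq_abs]
    exact mul_le_mul (hf.abs_sub_le p q) hx (norm_nonneg _) (by positivity)
  have hD : ∀ T : H →L[ℝ] H, ‖T‖ ≤ P.Δ → ‖T (radialTrunc ε (P.rest u))‖ ≤ P.Δ * (2 * ε) := fun T hT =>
    (T.le_opNorm _).trans (mul_le_mul hT (norm_radialTrunc_le hε _) (norm_nonneg _) hΔ)
  have hs : ∀ (a : ℝ) n, 0 ≤ a →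
      ‖(a * trunc ε (inner ℝ (P.e n) u)) • P.e n‖ ≤ a * (2 * ε) := fun a n ha => by
    rw [norm_smul, P.e.orthonormal.1, mul_one, Real.norm_eq_abs, abs_mul, abs_of_nonneg ha]
    gcongr
    exact abs_trunc_le hε _
  have hs1 := (hs (P.lam1 + ε + P.gap0) 1 (by positivity)).trans
    (mul_le_mul_of_nonneg_right (by linarith : _ ≤ P.lam1 + 1 + P.gap0) (by positivity))
  rw [hdiff]
  refine (norm_add₄_le).trans ?_
  rw [norm_neg]
  refine (add_le_add (add_le_add (add_le_add (hsm h0 hs1) (hsm h0 (hs _ _ hg)))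
    (hsm h1 (hD _ P.norm_Dp))) (hsm h2 (hD _ P.norm_Dm))).trans (le_of_eq ?_)
  ring

theorem isBoundedLipschitz_radialTrunc {ε : ℝ} (hε : 0 < ε) (hε1 : ε ≤ 1) :
    IsBoundedLipschitz 2 fun u : H => radialTrunc ε (P.rest u) :=
  ⟨fun u => (norm_radialTrunc_le hε _).trans (by linarith), fun u v =>
    (norm_radialTrunc_sub_le hε _ _).trans ((P.norm_rest_sub_le u v).trans
      (by linarith [norm_nonneg (u - v)]))⟩

theorem isBoundedLipschitz_trunc_smul {ε : ℝ} (hε : 0 < ε) (hε1 : ε ≤ 1) (n m : ℕ) :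
    IsBoundedLipschitz (2 * (2 * 1)) fun u : H => trunc ε (inner ℝ (P.e n) u) • P.e m := by
  refine IsBoundedLipschitz.smul (fun u => (abs_trunc_le hε _).trans (by linarith))
    (fun u v => (abs_trunc_sub_le hε _ _).trans ?_)
    (IsBoundedLipschitz.const (P.e.orthonormal.1 m).le)
  rw [← inner_sub_right]
  exact (P.abs_inner_le n _).trans (by linarith [norm_nonneg (u - v)])

theorem isBoundedLipschitz_planar_smul {C M : ℝ} {f : ℝ × ℝ → ℝ} (hf : IsPlanarCoeff C f)
    {G : H → H} (hG : IsBoundedLipschitz M G) :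
    IsBoundedLipschitz (2 * (C * M)) fun u : H => f (P.plane u) • G u :=
  IsBoundedLipschitz.smul (fun _ => hf.abs_le _) (fun u v => (hf.abs_sub_le _ _).trans
    (mul_le_mul_of_nonneg_left (P.norm_plane_sub_le u v) hf.nonneg)) hG

theorem exists_isBoundedLipschitz_smallPart : ∃ C, ∀ ε, 0 < ε → ε ≤ 1 →
    IsBoundedLipschitz C (P.smallPart ε) := by
  obtain ⟨Cx, hx⟩ := exists_isPlanarCoeff_planarX
  obtain ⟨Cy, hy⟩ := exists_isPlanarCoeff_planarY
  obtain ⟨C0, h0⟩ := isGate_centralGate.exists_isPlanarCoeff_swing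
  obtain ⟨C1, h1⟩ := isGate_upperGate.exists_isPlanarCoeff_swing
  obtain ⟨C2, h2⟩ := isGate_lowerGate.exists_isPlanarCoeff_swing
  exact ⟨_, fun ε hε hε1 =>
    ((((P.isBoundedLipschitz_planar_smul hx (.const (P.e.orthonormal.1 0).le)).add
      (P.isBoundedLipschitz_planar_smul hy (.const (P.e.orthonormal.1 1).le))).add
      (P.isBoundedLipschitz_planar_smul h0
        ((P.isBoundedLipschitz_trunc_smul hε hε1 _ _).neg.add
          (P.isBoundedLipschitz_trunc_smul hε hε1 _ _)))).add
      (P.isBoundedLipschitz_planar_smul h1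
        ((P.isBoundedLipschitz_radialTrunc hε hε1).clm P.norm_Jp).neg)).add
      (P.isBoundedLipschitz_planar_smul h2
        ((P.isBoundedLipschitz_radialTrunc hε hε1).clm P.norm_Jm))⟩

/-- The increment is split into moving the point with frozen coefficients, moving the coefficients,
and the small part. Only the first is not `O(ε)`, so `ε` is chosen to fit the rest into the strict
excess of `L`. -/
theorem exists_norm_field_sub_le {L : ℝ} (hL1 : P.lam1 < L) (hLΔ : P.Δ < L) :
    ∃ ε, 0 < ε ∧ ε ≤ 1 ∧ ∀ u v, ‖P.field ε u - P.field ε v‖ ≤ L * ‖u - v‖ := by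
  obtain ⟨C, hC, hm⟩ := P.exists_norm_mainPart_sub_le
  obtain ⟨C', hs⟩ := P.exists_isBoundedLipschitz_smallPart
  have hC' := (hs 1 one_pos le_rfl).nonneg
  have hmax : max P.lam1 P.Δ < L := max_lt hL1 hLΔ
  set ε := min 1 ((L - max P.lam1 P.Δ) / (1 + C + C')) with hεdef
  have hε : 0 < ε := lt_min one_pos (div_pos (sub_pos.2 hmax) (by positivity))
  have hε1 : ε ≤ 1 := min_le_left _ _
  have hεL : ε * (1 + C + C') ≤ L - max P.lam1 P.Δ :=
    (le_div_iff₀ (by positivity)).1 (min_le_right _ _)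
  refine ⟨ε, hε, hε1, fun u v => ?_⟩
  have hdiff : P.field ε u - P.field ε v = (P.mainPart ε (P.plane u) u - P.mainPart ε (P.plane u) v)
      + (P.mainPart ε (P.plane u) v - P.mainPart ε (P.plane v) v)
      + ε • (P.smallPart ε u - P.smallPart ε v) := by
    simp only [field, smul_sub]; abel
  rw [hdiff]
  calc _ ≤ (max P.lam1 P.Δ + ε) * ‖u - v‖ + C * ε * ‖u - v‖ + ε * (C' * ‖u - v‖) := by
        refine norm_add₃_le.trans (add_le_add (add_le_add (P.norm_mainPart_sub_le hε hε1 _ _ _) ?_) ?_)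
        · refine (hm ε hε hε1 _ _ _).trans ?_
          gcongr
          exact P.norm_plane_sub_le u v
        · rw [norm_smul, Real.norm_of_nonneg hε.le]
          gcongr
          exact (hs ε hε hε1).2 u v
    _ = (max P.lam1 P.Δ + ε * (1 + C + C')) * ‖u - v‖ := by ring
    _ ≤ L * ‖u - v‖ := by gcongr; linarith

theorem exists_norm_field_le {ε : ℝ} (hε : 0 < ε) (hε1 : ε ≤ 1) : ∃ C, ∀ u, ‖P.field ε u‖ ≤ C := by
  obtain ⟨C', hs⟩ := P.exists_isBoundedLipschitz_smallPart
  obtain ⟨C0, h0⟩ := isGate_centralGate.exists_isPlanarCoeff_balance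
  obtain ⟨C1, h1⟩ := isGate_upperGate.exists_isPlanarCoeff_balance
  obtain ⟨C2, h2⟩ := isGate_lowerGate.exists_isPlanarCoeff_balance
  have hΔ := P.Δ_nonneg
  have hl0 := P.lam0_nonneg
  have hl1 : 0 ≤ P.lam1 := hl0.trans P.lam0_le
  have hg := P.gap0_nonneg
  have := h0.nonneg
  have := h1.nonneg
  have := h2.nonneg
  have hD : ∀ T : H →L[ℝ] H, ‖T‖ ≤ P.Δ → ∀ u, ‖T (radialTrunc ε (P.rest u))‖ ≤ P.Δ * (2 * ε) :=
    fun T hT u =>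
      (T.le_opNorm _).trans (mul_le_mul hT (norm_radialTrunc_le hε _) (norm_nonneg _) hΔ)
  have ht : ∀ {R : ℝ} (a : ℝ) (s : ℝ), 0 < R → 0 ≤ a → |a * trunc R s| ≤ a * (2 * R) :=
    fun a s hR ha => by
      rw [abs_mul, abs_of_nonneg ha]
      gcongr
      exact abs_trunc_le hR _
  have hn : ∀ (a : ℝ) n, ‖a • P.e n‖ = |a| := fun a n => by
    rw [norm_smul, P.e.orthonormal.1, mul_one, Real.norm_eq_abs]
  refine ⟨P.lam0 * (2 * 3) + (P.lam1 * (2 * 3) + C0 * ((P.lam1 + ε + P.gap0) * (2 * ε))) +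
    (C0 * (P.gap0 * (2 * ε)) + C1 * (P.Δ * (2 * ε)) + C2 * (P.Δ * (2 * ε))) + ε * C', fun u => ?_⟩
  refine (norm_add_le _ _).trans (add_le_add (norm_add₃_le.trans
    (add_le_add (add_le_add ?_ ?_) (norm_add₃_le.trans (add_le_add (add_le_add ?_ ?_) ?_)))) ?_)
  · rw [hn]; exact ht _ _ (by norm_num) hl0
  · rw [hn]
    refine (abs_sub _ _).trans (add_le_add (ht _ _ (by norm_num) hl1) ?_)
    rw [abs_mul]
    exact mul_le_mul (h0.abs_le _) (ht _ _ hε (by positivity)) (abs_nonneg _) (by positivity)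
  · rw [norm_smul, hn]
    exact mul_le_mul (h0.abs_le _) (ht _ _ hε hg) (abs_nonneg _) (by positivity)
  · rw [norm_smul]
    exact mul_le_mul (h1.abs_le _) (hD _ P.norm_Dp u) (norm_nonneg _) (by positivity)
  · rw [norm_smul]
    exact mul_le_mul (h2.abs_le _) (hD _ P.norm_Dm u) (norm_nonneg _) (by positivity)
  · rw [norm_smul, Real.norm_of_nonneg hε.le]
    gcongr
    exact (hs ε hε hε1).1 u

theorem contDiff_field {ε : ℝ} (hε : 0 < ε) : ContDiff ℝ ∞ (P.field ε) := by
  have hi : ∀ n, ContDiff ℝ ∞ fun u : H => inner ℝ (P.e n) u := fun n =>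
    (innerSL ℝ (P.e n)).contDiff
  have hp : ContDiff ℝ ∞ P.plane := (hi 0).prodMk (hi 1)
  have hr : ContDiff ℝ ∞ P.rest :=
    (contDiff_id.sub ((hi 0).smul contDiff_const)).sub ((hi 1).smul contDiff_const)
  have hT : ContDiff ℝ ∞ fun u => radialTrunc ε (P.rest u) := (contDiff_radialTrunc hε).comp hr
  have ht : ∀ R n, ContDiff ℝ ∞ fun u => trunc R (inner ℝ (P.e n) u) := fun R n =>
    (contDiff_trunc R).comp (hi n)
  have hb : ∀ {γ}, IsGate γ → ContDiff ℝ ∞ fun u => balance γ (P.plane u) := fun hγ =>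
    hγ.exists_isPlanarCoeff_balance.choose_spec.contDiff.comp hp
  have hs : ∀ {γ}, IsGate γ → ContDiff ℝ ∞ fun u => swing γ (P.plane u) := fun hγ =>
    hγ.exists_isPlanarCoeff_swing.choose_spec.contDiff.comp hp
  have h0 := isGate_centralGate
  have h1 := isGate_upperGate
  have h2 := isGate_lowerGate
  refine ContDiff.add ?_ (contDiff_const.smul ?_)
  · exact (((contDiff_const.mul (ht 3 0)).smul contDiff_const).add
      (((contDiff_const.mul (ht 3 1)).sub ((hb h0).mul (contDiff_const.mul (ht ε 1)))).smul
        contDiff_const)).add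
      ((((hb h0).smul ((contDiff_const.mul (ht ε P.c)).smul contDiff_const)).add
        ((hb h1).smul (P.Dp.contDiff.comp hT))).add ((hb h2).smul (P.Dm.contDiff.comp hT)))
  · exact (((((contDiff_planarX.comp hp).smul contDiff_const).add
      ((contDiff_planarY.comp hp).smul contDiff_const)).add
      ((hs h0).smul (((ht ε P.c).smul contDiff_const).neg.add ((ht ε 1).smul contDiff_const)))).add
      ((hs h1).smul (P.Jp.contDiff.comp hT).neg)).add ((hs h2).smul (P.Jm.contDiff.comp hT))

end ChainData

/-! ### The spectrum and the choice of the chain of modes -/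

section Spectrum

theorem eigenvalue_pos {A : H →ₗ.[ℝ] H} {e : HilbertBasis ℕ ℝ H} {ev : ℕ → ℝ}
    (hA_pos : ∀ x : A.domain, (x : H) ≠ 0 → 0 < inner ℝ (A x) (x : H))
    (he : ∀ n, ∃ h : e n ∈ A.domain, A ⟨e n, h⟩ = ev n • e n) (n : ℕ) : 0 < ev n := by
  obtain ⟨h, hAe⟩ := he n
  have := hA_pos ⟨e n, h⟩ (e.orthonormal.ne_zero n)
  rw [hAe] at this
  simpa [inner_smul_left, e.orthonormal.1 n] using this

theorem inner_basis_apply {A : H →ₗ.[ℝ] H} [CompleteSpace H] (hA : IsSelfAdjoint A)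
    {e : HilbertBasis ℕ ℝ H} {ev : ℕ → ℝ}
    (he : ∀ n, ∃ h : e n ∈ A.domain, A ⟨e n, h⟩ = ev n • e n) (φ : A.domain) (n : ℕ) :
    inner ℝ (e n) (A φ) = ev n * inner ℝ (e n) (φ : H) := by
  have h1 := LinearPMap.adjoint_isFormalAdjoint hA.dense_domain
  rw [LinearPMap.isSelfAdjoint_def.1 hA] at h1
  obtain ⟨h, hAe⟩ := he n
  have h2 := h1 ⟨e n, h⟩ φ
  rw [hAe, inner_smul_left] at h2
  simpa using h2.symm

theorem tendsto_eigenvalue {A : H →ₗ.[ℝ] H} (hA_inv : HasCompactInverse A)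
    {e : HilbertBasis ℕ ℝ H} {ev : ℕ → ℝ} (hev : ∀ n, 0 < ev n) (hmono : Monotone ev)
    (he : ∀ n, ∃ h : e n ∈ A.domain, A ⟨e n, h⟩ = ev n • e n) : Tendsto ev atTop atTop := by
  obtain ⟨T, hT, -, hTA⟩ := hA_inv
  refine (tendsto_atTop_atTop_iff_of_monotone hmono).2 fun Λ => ?_
  -- If the eigenvalues stayed below `Λ`, the orthogonal images `T (e n) = (ev n)⁻¹ • e n` would be
  -- at mutual distance at least `Λ⁻¹`, contradicting compactness of `T`.
  by_contra! hcon
  have hΛ : 0 < Λ := (hev 0).trans (hcon 0)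
  have hTe : ∀ n, T (e n) = (ev n)⁻¹ • e n := fun n => by
    obtain ⟨h, hAe⟩ := he n
    have h1 : ev n • T (e n) = e n := by simpa [hAe] using hTA ⟨e n, h⟩
    conv_rhs => rw [← h1]
    rw [smul_smul, inv_mul_cancel₀ (hev n).ne', one_smul]
  obtain ⟨Z, hZ, hTZ⟩ := hT.image_closedBall_subset_compact 1
  obtain ⟨a, -, φ, hφ, hlim⟩ := hZ.tendsto_subseq (x := fun n => T (e n)) fun n =>
    hTZ ⟨e n, by simp [e.orthonormal.1 n], rfl⟩
  have hcau := hlim.cauchySeq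
  obtain ⟨N, hN⟩ := Metric.cauchySeq_iff.1 hcau Λ⁻¹ (inv_pos.2 hΛ)
  have h1 := hN N le_rfl (N + 1) N.le_succ
  have hne : φ (N + 1) ≠ φ N := (hφ N.lt_succ_self).ne'
  have h2 : |inner ℝ (e (φ N)) (T (e (φ N)) - T (e (φ (N + 1))))| ≤
      ‖T (e (φ N)) - T (e (φ (N + 1)))‖ := by
    have := abs_real_inner_le_norm (e (φ N)) (T (e (φ N)) - T (e (φ (N + 1))))
    rwa [e.orthonormal.1, one_mul] at this
  rw [hTe, hTe, inner_sub_right, inner_smul_right, inner_smul_right, inner_basis, inner_basis,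
    if_pos rfl, if_neg hne.symm, mul_one, mul_zero, sub_zero, abs_of_pos (inv_pos.2 (hev _))] at h2
  simp only [Function.comp, dist_eq_norm, hTe] at h1
  have h3 : Λ⁻¹ ≤ (ev (φ N))⁻¹ := inv_anti₀ (hev _) (hcon _).le
  linarith

/-- One can select a subsequence of the eigenvalues which grows linearly, without enlarging the
gaps. -/
theorem exists_chain {ev : ℕ → ℝ} (hev : ∀ n, 0 < ev n) (hmono : Monotone ev)
    (htop : Tendsto ev atTop atTop) {Γ : ℝ} (hΓ : 0 ≤ Γ) (hgap : ∀ n, ev (n + 1) - ev n ≤ Γ) :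
    ∃ c : ℕ → ℕ, StrictMono c ∧ c 0 = 1 ∧ (∀ k, ev (c (k + 1)) - ev (c k) ≤ Γ) ∧
      ∀ k : ℕ, k / 2 * Γ ≤ ev (c (k + 1)) := by
  -- Greedy choice: `m` is the last index whose eigenvalue is at most `ev n + Γ`. It exceeds `n`
  -- because single gaps are at most `Γ`. The next chain index is beyond `m`, so two steps together
  -- gain more than `Γ`, whatever the multiplicities.
  have hstep : ∀ n, ∃ m, n < m ∧ ev m - ev n ≤ Γ ∧ ev n + Γ < ev (m + 1) := by
    intro n
    have hex : ∃ k, ev n + Γ < ev k := (htop.eventually_gt_atTop _).exists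
    classical
    have hk := Nat.find_spec hex
    have hnk : n + 1 < Nat.find hex := by
      by_contra hcon
      have := hmono (not_lt.1 hcon)
      linarith [hgap n]
    obtain ⟨m, hm⟩ : ∃ m, Nat.find hex = m + 1 := ⟨Nat.find hex - 1, by omega⟩
    rw [hm] at hk hnk
    have := Nat.find_min hex (m := m) (by omega)
    exact ⟨m, by omega, by linarith, hk⟩
  choose f hf1 hf2 hf3 using hstep
  set c : ℕ → ℕ := fun k => f^[k] 1 with hc
  have hcs : ∀ k, c (k + 1) = f (c k) := fun k => Function.iterate_succ_apply' f k 1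
  have hcm : StrictMono c := strictMono_nat_of_lt_succ fun k => by rw [hcs]; exact hf1 _
  refine ⟨c, hcm, rfl, fun k => by rw [hcs]; exact hf2 _, fun k => ?_⟩
  induction k using Nat.twoStepInduction with
  | zero => simpa using (hev _).le
  | one =>
    have h1 := hf3 (c 0)
    rw [← hcs] at h1
    have h2 : ev (c 1 + 1) ≤ ev (c (1 + 1)) := hmono (hcm (by norm_num : 1 < 1 + 1))
    have := hev (c 0)
    push_cast
    linarith
  | more k ih _ =>
    have h1 := hf3 (c (k + 1))
    rw [← hcs] at h1
    have h2 : ev (c (k + 1 + 1) + 1) ≤ ev (c (k + 2 + 1)) := hmono (hcm (by omega))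
    push_cast
    linarith

end Spectrum

/-! ### Balancing and rotating pairs of modes -/

section PairOperators

/-- The involution of `ℕ` exchanging `k` and `k + 1` whenever `k` has the parity `q`. -/
def pairSwap (q k : ℕ) : ℕ := if k % 2 = q then k + 1 else if k = 0 then 0 else k - 1

theorem involutive_pairSwap {q : ℕ} (hq : q < 2) : Function.Involutive (pairSwap q) := by
  intro k
  by_cases h : k % 2 = q
  · have h1 : ¬ (k + 1) % 2 = q := by omega
    simp [pairSwap, h, h1]
  · rcases k with _ | k
    · simp [pairSwap, h]
    · have h1 : k % 2 = q := by omega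
      simp [pairSwap, h, h1]

/-- For a fixed parity the pairs of consecutive chain modes are disjoint, so all of them are handled
by one operator without adding norms. An inner chain mode belongs to one pair of each parity; this
is why two sets of operators, used on opposite sides of the clock, are needed. -/
theorem exists_pair_operators (e : HilbertBasis ℕ ℝ H) {c : ℕ → ℕ} (hc : StrictMono c) {q : ℕ}
    (hq : q < 2) {d : ℕ → ℝ} {Δ : ℝ} (hd : ∀ k, 0 ≤ d k) (hdΔ : ∀ k, d k ≤ Δ) :
    ∃ (D J : H →L[ℝ] H) (b : ℕ → ℝ), ‖D‖ ≤ Δ ∧ ‖J‖ ≤ 1 ∧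
      (∀ n x, inner ℝ (e n) (D x) = b n * inner ℝ (e n) x) ∧
      ∀ k, k % 2 = q → D (e (c k)) = -d k • e (c k) ∧ D (e (c (k + 1))) = d k • e (c (k + 1)) ∧
        J (e (c k)) = e (c (k + 1)) ∧ J (e (c (k + 1))) = - e (c k) := by
  have hinj := hc.injective
  have hΔ : 0 ≤ Δ := (hd 0).trans (hdΔ 0)
  -- Index `0` is unpaired when `q = 1`. Modes off the chain receive the multiplier `0` through
  -- `Function.extend`.
  set bD : ℕ → ℝ := fun k => if k % 2 = q then -d k else if k = 0 then 0 else d (k - 1) with hbD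
  set bJ : ℕ → ℝ := fun k => if k % 2 = q then -1 else if k = 0 then 0 else 1 with hbJ
  have hext : ∀ {b : ℕ → ℝ} {C : ℝ}, 0 ≤ C → (∀ k, |b k| ≤ C) → ∀ n, |Function.extend c b 0 n| ≤ C := by
    intro b C hC hb n
    by_cases h : ∃ k, c k = n
    · obtain ⟨k, rfl⟩ := h
      rw [hinj.extend_apply]; exact hb k
    · rw [Function.extend_apply' _ _ _ h]; simpa using hC
  obtain ⟨D, hD, hDi⟩ := exists_permuted_multiplier e (Equiv.refl ℕ) (Function.extend c bD 0)
    (hext hΔ fun k => by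
      simp only [hbD]
      split_ifs
      · rw [abs_neg, abs_of_nonneg (hd k)]; exact hdΔ k
      · simpa using hΔ
      · rw [abs_of_nonneg (hd _)]; exact hdΔ _)
  set σ : Equiv.Perm ℕ := (Function.Involutive.toPerm _ (involutive_pairSwap hq)).viaEmbedding
    ⟨c, hinj⟩ with hσ
  have hσc : ∀ k, σ (c k) = c (pairSwap q k) := fun k => Equiv.Perm.viaEmbedding_apply _ ⟨c, hinj⟩ k
  obtain ⟨J, hJ, hJi⟩ := exists_permuted_multiplier e σ (Function.extend c bJ 0)
    (hext zero_le_one fun k => by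
      simp only [hbJ]
      split_ifs <;> simp)
  have hDe : ∀ k, D (e (c k)) = bD k • e (c k) := fun k => by
    refine ext_inner_basis e fun n => ?_
    rw [hDi, inner_smul_right, Equiv.refl_apply, inner_basis]
    split_ifs with h
    · rw [h, hinj.extend_apply]
    · simp
  have hJe : ∀ k, J (e (c (pairSwap q k))) = bJ k • e (c k) := fun k => by
    refine ext_inner_basis e fun n => ?_
    rw [hJi, inner_smul_right, inner_basis, inner_basis, ← hσc]
    simp only [σ.injective.eq_iff]
    split_ifs with h
    · rw [h, hinj.extend_apply]
    · simp
  refine ⟨D, J, _, hD, hJ, hDi, fun k hk => ?_⟩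
  have hk1 : ¬ (k + 1) % 2 = q := by omega
  have hs : pairSwap q k = k + 1 := by simp [pairSwap, hk]
  have hs1 : pairSwap q (k + 1) = k := by simp [pairSwap, hk1]
  refine ⟨by rw [hDe]; simp [hbD, hk], by rw [hDe]; simp [hbD, hk1], ?_, ?_⟩
  · have := hJe (k + 1)
    rw [hs1] at this
    rw [this]; simp [hbJ, hk1]
  · have := hJe k
    rw [hs] at this
    rw [this]; simp [hbJ, hk]

end PairOperators

/-! ### The clock -/

section Clock

/-- The radial equation `ρ' = ε ρ R (ρ ^ 2)`, written in exponential form. -/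
theorem exists_radius (ε : ℝ) : ∃ ρ : ℝ → ℝ, Continuous ρ ∧ ρ 0 = 1 ∧
    (∀ t, 0 ≤ t → HasDerivWithinAt ρ (ε * (radialRate (ρ t ^ 2) * ρ t)) (Ici 0) t) ∧
    ∀ t, 0 ≤ t → ρ t = Real.exp (ε * ∫ s in (0 : ℝ)..t, radialRate (ρ s ^ 2)) := by
  have hsm : ContDiff ℝ ∞ fun r : ℝ => ε * (radialRate (r ^ 2) * r) :=
    contDiff_const.mul ((contDiff_radialRate.comp (contDiff_id.pow 2)).mul contDiff_id)
  have hcs : HasCompactSupport fun r : ℝ => ε * (radialRate (r ^ 2) * r) := by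
    refine HasCompactSupport.intro (isCompact_closedBall (0 : ℝ) 2) fun r hr => ?_
    rw [mem_closedBall_zero_iff, Real.norm_eq_abs, not_le] at hr
    rw [radialRate_eq_zero (by rw [abs_of_nonneg (sq_nonneg r), ← sq_abs]; nlinarith)]
    simp
  obtain ⟨K, hK⟩ := ContDiff.lipschitzWith_of_hasCompactSupport hcs hsm (by simp)
  obtain ⟨C, hC⟩ := hsm.continuous.bounded_above_of_compact_support hcs
  obtain ⟨ρ, hρc, hρ0, hρ⟩ := exists_forward_trajectory hK hC 1
  refine ⟨ρ, hρc, hρ0, hρ, fun t ht => ?_⟩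
  have hc : Continuous fun s => radialRate (ρ s ^ 2) :=
    contDiff_radialRate.continuous.comp (hρc.pow 2)
  have hI : ∀ t, HasDerivAt (fun t => ∫ s in (0 : ℝ)..t, radialRate (ρ s ^ 2))
      (radialRate (ρ t ^ 2)) t := fun t =>
    (hc.integral_hasStrictDerivAt 0 t).hasDerivAt
  have hE : ∀ t, HasDerivAt (fun t => Real.exp (-(ε * ∫ s in (0 : ℝ)..t, radialRate (ρ s ^ 2))))
      (Real.exp (-(ε * ∫ s in (0 : ℝ)..t, radialRate (ρ s ^ 2))) * -(ε * radialRate (ρ t ^ 2))) t :=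
    fun t => (((hI t).const_mul ε).neg).exp
  have key := constant_of_has_deriv_right_zero (a := 0) (b := t)
    (f := fun t => ρ t * Real.exp (-(ε * ∫ s in (0 : ℝ)..t, radialRate (ρ s ^ 2))))
    (hρc.continuousOn.mul fun s _ => (hE s).continuousAt.continuousWithinAt) (fun s hs => by
      refine (((hρ s hs.1).mono (Ici_subset_Ici.2 hs.1)).mul
        (hE s).hasDerivWithinAt).congr_deriv ?_
      ring) t ⟨ht, le_rfl⟩
  simp only [intervalIntegral.integral_same, mul_zero, neg_zero, Real.exp_zero, hρ0, mul_one,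
    Real.exp_neg] at key
  exact (mul_inv_eq_one₀ (Real.exp_ne_zero _)).1 key

/-- Growth stops at radius `2`. A strictly increasing barrier starting at `2` is used because the
comparison principle needs a strict inequality of derivatives at contact. The value `11 / 5`
suffices, its square being below `5`, where the angular speed is still one. -/
theorem radius_le {ε : ℝ} {ρ : ℝ → ℝ} (hc : Continuous ρ) (h0 : ρ 0 = 1)
    (hd : ∀ t, 0 ≤ t → HasDerivWithinAt ρ (ε * (radialRate (ρ t ^ 2) * ρ t)) (Ici 0) t) {t : ℝ}
    (ht : 0 ≤ t) : ρ t ≤ 11 / 5 := by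
  have hB : ∀ t : ℝ, HasDerivAt (fun t : ℝ => 2 + 1 / 5 * (1 - Real.exp (-t)))
      (1 / 5 * Real.exp (-t)) t := fun t => by
    refine (((hasDerivAt_neg t).exp.const_sub 1).const_mul (1 / 5)).const_add 2 |>.congr_deriv ?_
    ring
  have := image_le_of_deriv_right_lt_deriv_boundary (f := ρ) (a := 0) (b := t) hc.continuousOn
    (fun s hs => (hd s hs.1).mono (Ici_subset_Ici.2 hs.1)) (by simp [h0]) (fun s => hB s)
    (fun s hs h => by
      have h1 : Real.exp (-s) ≤ 1 := Real.exp_le_one_iff.2 (by linarith [hs.1])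
      have h2 : 2 ≤ ρ s := by rw [h]; linarith
      rw [radialRate_eq_zero (by rw [abs_of_nonneg (sq_nonneg _)]; nlinarith)]
      have := Real.exp_pos (-s)
      linarith) (x := t) ⟨ht, le_rfl⟩
  have h3 := Real.exp_pos (-t)
  linarith

/-- The clock: a planar trajectory which leaves the unit circle along the first axis and then
rotates around the origin. It crosses the first axis at the times `τ k`. -/
theorem exists_clock {ε : ℝ} (hε : 0 < ε) : ∃ (x y : ℝ → ℝ) (τ : ℕ → ℝ),
    Continuous x ∧ Continuous y ∧ x 0 = 1 ∧ y 0 = 0 ∧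
    (∀ t, 0 ≤ t → HasDerivWithinAt x (ε * planarX (x t, y t)) (Ici t) t) ∧
    (∀ t, 0 ≤ t → HasDerivWithinAt y (ε * planarY (x t, y t)) (Ici t) t) ∧
    (∀ t, 0 ≤ t → |x t| ≤ 3 ∧ |y t| ≤ 3) ∧
    τ 0 = 0 ∧ (∀ k, τ k + Real.pi / ε ≤ τ (k + 1)) ∧ (∀ k : ℕ, τ k ≤ (k * Real.pi + 1) / ε) ∧
    (∀ k, 1 ≤ (-1) ^ k * x (τ k)) ∧
    ∀ k, ∀ t ∈ Icc (τ k) (τ (k + 1)), |x t| ≤ 5 / 6 → 1 ≤ (-1) ^ k * y t := by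
  obtain ⟨ρ, hρc, hρ0, hρd, hρ⟩ := exists_radius ε
  have hcR : Continuous fun s => radialRate (ρ s ^ 2) :=
    contDiff_radialRate.continuous.comp (hρc.pow 2)
  have hcΩ : Continuous fun s => angularRate (ρ s ^ 2) :=
    contDiff_angularRate.continuous.comp (hρc.pow 2)
  have hmonoI : ∀ {g : ℝ → ℝ}, Continuous g → (∀ s, 0 ≤ g s) → ∀ {s t : ℝ}, s ≤ t →
      ∫ r in (0 : ℝ)..s, g r ≤ ∫ r in (0 : ℝ)..t, g r := fun {g} hg h0 {s t} hst => by
    rw [← intervalIntegral.integral_add_adjacent_intervals (hg.intervalIntegrable 0 s)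
      (hg.intervalIntegrable s t)]
    have := intervalIntegral.integral_nonneg (μ := MeasureTheory.volume) hst fun r _ => h0 r
    linarith
  have hρmono : ∀ {s t}, 0 ≤ s → s ≤ t → ρ s ≤ ρ t := fun {s t} hs hst => by
    rw [hρ s hs, hρ t (hs.trans hst), Real.exp_le_exp]
    exact mul_le_mul_of_nonneg_left (hmonoI hcR (fun _ => (radialRate_mem _).1) hst) hε.le
  have hρ1 : ∀ {t}, 0 ≤ t → 1 ≤ ρ t := fun ht => hρ0 ▸ hρmono le_rfl ht
  have hρ2 : ∀ {t}, 0 ≤ t → ρ t ≤ 11 / 5 := fun ht => radius_le hρc hρ0 hρd ht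
  set θ : ℝ → ℝ := fun t => ε * ∫ s in (0 : ℝ)..t, angularRate (ρ s ^ 2) with hθ
  have hθmono : ∀ {s t}, s ≤ t → θ s ≤ θ t := fun hst =>
    mul_le_mul_of_nonneg_left (hmonoI hcΩ (fun _ => (angularRate_mem _).1) hst) hε.le
  have hθd : ∀ t, HasDerivAt θ (ε * angularRate (ρ t ^ 2)) t := fun t =>
    (hcΩ.integral_hasStrictDerivAt 0 t).hasDerivAt.const_mul ε
  have hθ0 : θ 0 = 0 := by simp [hθ]
  have hθc : Continuous θ := continuous_iff_continuousAt.2 fun t => (hθd t).continuousAt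
  have hT : 0 < 1 / ε := by positivity
  have hθT : θ (1 / ε) ≤ 1 := by
    have := intervalIntegral.integral_mono_on (μ := MeasureTheory.volume) hT.le
      (hcΩ.intervalIntegrable 0 _) (continuous_const.intervalIntegrable 0 _)
      (fun s _ => (angularRate_mem (ρ s ^ 2)).2)
    rw [intervalIntegral.integral_const, smul_eq_mul, mul_one, sub_zero] at this
    calc θ (1 / ε) ≤ ε * (1 / ε) := mul_le_mul_of_nonneg_left this hε.le
      _ = 1 := by field_simp
  have hθT0 : 0 ≤ θ (1 / ε) := hθ0 ▸ hθmono hT.le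
  -- If the squared radius were still below `3` at time `1 / ε`, the radius would have grown at full
  -- rate to `exp 1 ≥ 2`.
  have hρT : 3 ≤ ρ (1 / ε) ^ 2 := by
    by_contra! hlt
    have h1 : ∀ s ∈ uIcc 0 (1 / ε), radialRate (ρ s ^ 2) = 1 := fun s hs => by
      rw [uIcc_of_le hT.le] at hs
      refine radialRate_eq_one ?_
      rw [abs_of_nonneg (sq_nonneg _)]
      nlinarith [hρmono hs.1 hs.2, hρ1 hs.1]
    have h2 := hρ _ hT.le
    rw [intervalIntegral.integral_congr h1, intervalIntegral.integral_const, smul_eq_mul, mul_one,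
      sub_zero, mul_one_div_cancel hε.ne'] at h2
    have := Real.add_one_le_exp 1
    nlinarith
  have hθlin : ∀ {t}, 1 / ε ≤ t → θ t = θ (1 / ε) + ε * (t - 1 / ε) := fun {t} ht => by
    have h1 : ∀ s ∈ uIcc (1 / ε) t, angularRate (ρ s ^ 2) = 1 := fun s hs => by
      rw [uIcc_of_le ht] at hs
      have h2 := hρmono hT.le hs.1
      have h3 := hρ1 hT.le
      have h4 := hρ2 (hT.le.trans hs.1)
      exact angularRate_eq_one (by nlinarith) (by nlinarith)
    simp only [hθ]
    rw [← intervalIntegral.integral_add_adjacent_intervals (hcΩ.intervalIntegrable 0 (1 / ε))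
      (hcΩ.intervalIntegrable _ t), intervalIntegral.integral_congr h1,
      intervalIntegral.integral_const, smul_eq_mul, mul_one, mul_add]
  have hπ := Real.pi_gt_three
  -- From `1 / ε` on the angle is affine with slope `ε`, and `τ k` is the time when it equals `k π`.
  -- At `k = 0` the angle vanishes on an initial interval, so the starting time `0` is prescribed
  -- separately.
  set τ : ℕ → ℝ := fun k => if k = 0 then 0 else 1 / ε + (k * Real.pi - θ (1 / ε)) / ε with hτ
  have hτs : ∀ k : ℕ, τ (k + 1) = 1 / ε + ((k + 1) * Real.pi - θ (1 / ε)) / ε := fun k => by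
    simp [hτ]
  have hτ0 : τ 0 = 0 := by simp [hτ]
  have hstep : ∀ k, τ k + Real.pi / ε ≤ τ (k + 1) := fun k => by
    rw [hτs]
    rcases k with _ | k
    · rw [hτ0, zero_add, ← add_div]
      refine div_le_div_of_nonneg_right ?_ hε.le
      push_cast; linarith
    · rw [hτs, ← add_div, ← add_div, ← add_div]
      refine div_le_div_of_nonneg_right ?_ hε.le
      push_cast; linarith
  have hτnn : ∀ k, 0 ≤ τ k := fun k => by
    induction k with
    | zero => rw [hτ0]
    | succ k ih => exact ih.trans ((le_add_of_nonneg_right (by positivity)).trans (hstep k))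
  have hθτ : ∀ k : ℕ, θ (τ k) = k * Real.pi := fun k => by
    rcases k with _ | k
    · simp [hτ0, hθ0]
    · rw [hθlin, hτs]
      · push_cast; field_simp; ring
      · rw [hτs]
        refine le_add_of_nonneg_right (div_nonneg ?_ hε.le)
        have : (0 : ℝ) ≤ k * Real.pi := by positivity
        nlinarith
  have hsq : ∀ t, (ρ t * Real.cos (θ t)) ^ 2 + (ρ t * Real.sin (θ t)) ^ 2 = ρ t ^ 2 := fun t => by
    rw [mul_pow, mul_pow, ← mul_add, Real.cos_sq_add_sin_sq, mul_one]
  refine ⟨fun t => ρ t * Real.cos (θ t), fun t => ρ t * Real.sin (θ t), τ,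
    hρc.mul (Real.continuous_cos.comp hθc), hρc.mul (Real.continuous_sin.comp hθc),
    by simp [hρ0, hθ0], by simp [hθ0], fun t ht => ?_, fun t ht => ?_, fun t ht => ?_, hτ0, hstep,
    fun k => ?_, fun k => ?_, fun k t ht hx => ?_⟩
  · refine (((hρd t ht).mono (Ici_subset_Ici.2 ht)).mul
      (hθd t).cos.hasDerivWithinAt).congr_deriv ?_
    simp only [planarX, hsq]
    ring
  · refine (((hρd t ht).mono (Ici_subset_Ici.2 ht)).mul
      (hθd t).sin.hasDerivWithinAt).congr_deriv ?_
    simp only [planarY, hsq]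
    ring
  · have h1 := hsq t
    have h2 := hρ1 ht
    have h3 := hρ2 ht
    constructor <;> refine abs_le_of_sq_le_sq ?_ (by norm_num) <;>
      nlinarith [sq_nonneg (ρ t * Real.cos (θ t)), sq_nonneg (ρ t * Real.sin (θ t))]
  · rcases k with _ | k
    · rw [hτ0]; positivity
    · rw [hτs, ← add_div]
      refine div_le_div_of_nonneg_right ?_ hε.le
      push_cast; linarith
  · simp only [hθτ]
    rw [Real.cos_nat_mul_pi, mul_left_comm, ← mul_pow]
    simpa using hρ1 (hτnn k)
  · have ht0 : 0 ≤ t := (hτnn k).trans ht.1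
    have h1 : k * Real.pi ≤ θ t := hθτ k ▸ hθmono ht.1
    have h2 : θ t ≤ (k + 1 : ℕ) * Real.pi := hθτ (k + 1) ▸ hθmono ht.2
    push_cast at h2
    have hsin : 0 ≤ (-1) ^ k * Real.sin (θ t) := by
      rw [← Real.sin_sub_nat_mul_pi]
      exact Real.sin_nonneg_of_nonneg_of_le_pi (by linarith) (by linarith)
    have hθ' : 0 ≤ θ t := hθ0 ▸ hθmono ht0
    have hρt := hρ1 ht0
    -- Below squared radius `2` no rotation has taken place, so the clock would still be on the
    -- positive axis with `x ≥ 1`. Hence inside the strip `y ^ 2 ≥ 2 - (5 / 6) ^ 2 > 1`.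
    have h3 : 2 ≤ ρ t ^ 2 := by
      by_contra! hlt
      have h4 : ∀ s ∈ uIcc 0 t, angularRate (ρ s ^ 2) = 0 := fun s hs => by
        rw [uIcc_of_le ht0] at hs
        refine angularRate_eq_zero ?_
        nlinarith [hρmono hs.1 hs.2, hρ1 hs.1]
      have h5 : θ t = 0 := by
        simp only [hθ]
        rw [intervalIntegral.integral_congr h4]
        simp
      simp only [h5, Real.cos_zero, mul_one] at hx
      linarith [le_abs_self (ρ t)]
    have h6 := hsq t
    have h7 : (ρ t * Real.cos (θ t)) ^ 2 ≤ (5 / 6) ^ 2 := by rw [← sq_abs]; gcongr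
    have h8 : 0 ≤ (-1) ^ k * (ρ t * Real.sin (θ t)) := by
      rw [mul_left_comm]; positivity
    have h9 : ((-1 : ℝ) ^ k) ^ 2 = 1 := by rw [← pow_mul, mul_comm, pow_mul]; norm_num
    by_contra! h10
    have h11 : ((-1) ^ k * (ρ t * Real.sin (θ t))) ^ 2 = (ρ t * Real.sin (θ t)) ^ 2 := by
      rw [mul_pow, h9, one_mul]
    nlinarith

end Clock

/-! ### Explicit solutions carried by finitely many modes -/

section Modes

theorem isCoordSolutionOn_of_modes {e : HilbertBasis ℕ ℝ H} {ev : ℕ → ℝ} {F : H → H} {ι : Type*}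
    [Fintype ι] {n : ι → ℕ} {f f' : ι → ℝ → ℝ} {u : ℝ → H} {a b : ℝ}
    (hu : ∀ t, u t = ∑ i, f i t • e (n i)) (hf : ∀ i, Continuous (f i))
    (hf' : ∀ i, ∀ t ∈ Ico a b, HasDerivWithinAt (f i) (f' i t) (Ici t) t)
    (hF : ∀ t ∈ Ico a b, F (u t) = ∑ i, (f' i t + ev (n i) * f i t) • e (n i)) :
    IsCoordSolutionOn e ev F u a b := by
  have hu' : u = fun t => ∑ i, f i t • e (n i) := funext hu
  refine ⟨?_, fun m t ht => ?_⟩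
  · rw [hu']
    exact (continuous_finsetSum _ fun i _ => (hf i).smul continuous_const).continuousOn
  · rw [hF t ht]
    simp only [hu', inner_sum, inner_smul_right, inner_basis]
    refine (HasDerivWithinAt.fun_sum fun i _ => (hf' i t ht).mul_const _).congr_deriv ?_
    rw [Finset.mul_sum, ← Finset.sum_neg_distrib, ← Finset.sum_add_distrib]
    refine Finset.sum_congr rfl fun i _ => ?_
    split_ifs with h
    · rw [h]; ring
    · ring

/-- Two modes with decay rates `β₁`, `β₂` which are rotated into each other by the angle `α`. -/
theorem hasDerivWithinAt_pair {A α : ℝ → ℝ} {β₁ β₂ α' t : ℝ}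
    (hA : HasDerivAt A (-(β₁ * Real.cos (α t) ^ 2 + β₂ * Real.sin (α t) ^ 2) * A t) t)
    (hα : HasDerivWithinAt α α' (Ici t) t)
    (h : Real.sin (α t) * Real.cos (α t) * (β₁ - β₂) = 0) :
    HasDerivWithinAt (fun t => A t * Real.cos (α t))
      (-β₁ * (A t * Real.cos (α t)) - α' * (A t * Real.sin (α t))) (Ici t) t ∧
    HasDerivWithinAt (fun t => A t * Real.sin (α t))
      (-β₂ * (A t * Real.sin (α t)) + α' * (A t * Real.cos (α t))) (Ici t) t := by
  have hsc := Real.sin_sq_add_cos_sq (α t)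
  constructor
  · refine (hA.hasDerivWithinAt.mul hα.cos).congr_deriv ?_
    linear_combination A t * Real.sin (α t) * h - A t * Real.cos (α t) * β₁ * hsc
  · refine (hA.hasDerivWithinAt.mul hα.sin).congr_deriv ?_
    linear_combination -A t * Real.cos (α t) * h - A t * Real.sin (α t) * β₂ * hsc

theorem norm_smul_add_smul (e : HilbertBasis ℕ ℝ H) {a b : ℕ} (hab : a ≠ b) (f h : ℝ) :
    ‖f • e a + h • e b‖ ^ 2 = f ^ 2 + h ^ 2 := by
  rw [← real_inner_self_eq_norm_sq]
  simp only [inner_add_left, inner_add_right, real_inner_smul_left, inner_smul_right, inner_basis,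
    hab, hab.symm, if_true, if_false]
  ring

theorem norm_cos_smul_add_sin_smul (e : HilbertBasis ℕ ℝ H) {a b : ℕ} (hab : a ≠ b) (α : ℝ) :
    ‖Real.cos α • e a + Real.sin α • e b‖ = 1 := by
  have h := norm_smul_add_smul e hab (Real.cos α) (Real.sin α)
  rw [Real.cos_sq_add_sin_sq] at h
  exact (pow_eq_one_iff_of_nonneg (norm_nonneg _) two_ne_zero).1 h

/-- The factor by which an amplitude decaying at the rate `β` shrinks between `s` and `t`. -/
noncomputable def decay (β : ℝ → ℝ) (s t : ℝ) : ℝ := Real.exp (-∫ r in s..t, β r)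

theorem decay_pos (β : ℝ → ℝ) (s t : ℝ) : 0 < decay β s t := Real.exp_pos _

theorem decay_self (β : ℝ → ℝ) (s : ℝ) : decay β s s = 1 := by simp [decay]

theorem hasDerivAt_decay {β : ℝ → ℝ} (hβ : Continuous β) (s t : ℝ) :
    HasDerivAt (decay β s) (-β t * decay β s t) t :=
  ((hβ.integral_hasStrictDerivAt s t).hasDerivAt.neg.exp).congr_deriv (by
    rw [decay, Pi.neg_apply]; ring)

theorem continuous_decay {β : ℝ → ℝ} (hβ : Continuous β) (s : ℝ) : Continuous (decay β s) :=
  continuous_iff_continuousAt.2 fun t => (hasDerivAt_decay hβ s t).continuousAt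

theorem decay_le {β : ℝ → ℝ} (hβ : Continuous β) {m s t : ℝ} (hst : s ≤ t)
    (h : ∀ r ∈ Icc s t, m ≤ β r) : decay β s t ≤ Real.exp (-(m * (t - s))) := by
  have := intervalIntegral.integral_mono_on (μ := MeasureTheory.volume) hst
    (continuous_const.intervalIntegrable s t) (hβ.intervalIntegrable s t) h
  rw [intervalIntegral.integral_const, smul_eq_mul] at this
  rw [decay, Real.exp_le_exp]
  linarith

theorem decay_le_one {β : ℝ → ℝ} {s t : ℝ} (hts : t ≤ s)
    (h : ∀ r ∈ Icc t s, β r ≤ 0) : decay β s t ≤ 1 := by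
  rw [decay, intervalIntegral.integral_symm, neg_neg, Real.exp_le_one_iff]
  have := intervalIntegral.integral_nonneg (μ := MeasureTheory.volume) hts
    fun r hr => neg_nonneg.2 (h r hr)
  rw [intervalIntegral.integral_neg] at this
  linarith

/-- The perturbation keeps the prescribed direction `cos α • e a + sin α • e b`, because the
balanced rates coincide (`κ = 1`) whenever `α` is not a multiple of `π / 2`. Only its amplitude
evolves, at a rate never below `ev a`. The amplitude law is independent of the initial size `g`, as
long as the truncation is not felt. -/
theorem isCoordSolutionOn_chain {e : HilbertBasis ℕ ℝ H} {ev : ℕ → ℝ} {F : H → H} {a b : ℕ}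
    (ha : 2 ≤ a) (hb : 2 ≤ b) (hab : a ≠ b) {D J : H →L[ℝ] H} {d : ℝ} (hd : ev b - ev a = 2 * d)
    (hd0 : 0 ≤ d) (hDa : D (e a) = -d • e a) (hDb : D (e b) = d • e b) (hJa : J (e a) = e b)
    (hJb : J (e b) = -e a) {ε s T : ℝ} {x y α x' y' α' κ : ℝ → ℝ} (hεa : 0 ≤ ev a)
    (hx : Continuous x) (hy : Continuous y) (hα : Continuous α) (hκ : Continuous κ)
    (hx' : ∀ t ∈ Ico s T, HasDerivWithinAt x (x' t) (Ici t) t)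
    (hy' : ∀ t ∈ Ico s T, HasDerivWithinAt y (y' t) (Ici t) t)
    (hα' : ∀ t ∈ Ico s T, HasDerivWithinAt α (α' t) (Ici t) t)
    (hκ01 : ∀ t, κ t ∈ Icc (0 : ℝ) 1)
    (hκα : ∀ t, Real.sin (α t) * Real.cos (α t) * (1 - κ t) = 0)
    (hF : ∀ t ∈ Ico s T, ∀ w, inner ℝ (e 0) w = 0 → inner ℝ (e 1) w = 0 → ‖w‖ ≤ ε →
      F (x t • e 0 + y t • e 1 + w) = (x' t + ev 0 * x t) • e 0 + (y' t + ev 1 * y t) • e 1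
        + (κ t • D w + α' t • J w)) :
    ∃ B : ℝ → ℝ, B s = 1 ∧ (∀ t, 0 < B t) ∧
      (∀ t, s ≤ t → B t ≤ Real.exp (-(ev a * (t - s)))) ∧
      ∀ g ∈ Icc 0 ε, IsCoordSolutionOn e ev F (fun t => x t • e 0 + y t • e 1
        + (g * B t) • (Real.cos (α t) • e a + Real.sin (α t) • e b)) s T := by
  -- The effective rate is the average of the two corrected rates, weighted by the squares of the
  -- components.
  set β : ℝ → ℝ := fun t => (ev a + κ t * d) * Real.cos (α t) ^ 2
    + (ev b - κ t * d) * Real.sin (α t) ^ 2 with hβ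
  have hβc : Continuous β := by fun_prop
  have hβm : ∀ t, ev a ≤ β t := fun t => by
    have h1 := Real.sin_sq_add_cos_sq (α t)
    have h2 := mul_nonneg (mul_nonneg (hκ01 t).1 hd0) (sq_nonneg (Real.cos (α t)))
    have h3 := mul_nonneg (mul_nonneg (by linarith [(hκ01 t).2] : 0 ≤ 2 - κ t) hd0)
      (sq_nonneg (Real.sin (α t)))
    have h4 : β t - ev a = κ t * d * Real.cos (α t) ^ 2 + (2 - κ t) * d * Real.sin (α t) ^ 2 := by
      simp only [hβ]
      linear_combination ev a * h1 + Real.sin (α t) ^ 2 * hd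
    linarith
  refine ⟨decay β s, decay_self β s, decay_pos β s, fun t hst => decay_le hβc hst fun r _ => hβm r,
    fun g hg => ?_⟩
  have hA : ∀ t, HasDerivAt (fun t => g * decay β s t) (-β t * (g * decay β s t)) t := fun t =>
    ((hasDerivAt_decay hβc s t).const_mul g).congr_deriv (by ring)
  have hpair := fun t (ht : t ∈ Ico s T) => hasDerivWithinAt_pair (hA t) (hα' t ht)
    (β₁ := ev a + κ t * d) (β₂ := ev b - κ t * d)
    (by linear_combination (-2 * d) * hκα t - Real.sin (α t) * Real.cos (α t) * hd)
  have hBc := continuous_decay hβc s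
  refine isCoordSolutionOn_of_modes (n := ![0, 1, a, b])
    (f := ![x, y, fun t => g * decay β s t * Real.cos (α t),
      fun t => g * decay β s t * Real.sin (α t)])
    (f' := ![x', y', fun t => -(ev a + κ t * d) * (g * decay β s t * Real.cos (α t))
        - α' t * (g * decay β s t * Real.sin (α t)),
      fun t => -(ev b - κ t * d) * (g * decay β s t * Real.sin (α t))
        + α' t * (g * decay β s t * Real.cos (α t))])
    (fun t => ?_) (fun i => ?_) (fun i t ht => ?_) fun t ht => ?_
  · simp [Fin.sum_univ_four]; module
  · fin_cases i
    · exact hx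
    · exact hy
    · exact (continuous_const.mul hBc).mul (Real.continuous_cos.comp hα)
    · exact (continuous_const.mul hBc).mul (Real.continuous_sin.comp hα)
  · fin_cases i
    · exact hx' t ht
    · exact hy' t ht
    · exact (hpair t ht).1
    · exact (hpair t ht).2
  · rw [hF t ht]
    · simp [Fin.sum_univ_four, map_add, map_smul, hDa, hDb, hJa, hJb]; module
    · simp only [inner_smul_right, inner_add_right, inner_basis]
      simp [show 0 ≠ a by omega, show 0 ≠ b by omega]
    · simp only [inner_smul_right, inner_add_right, inner_basis]
      simp [show 1 ≠ a by omega, show 1 ≠ b by omega]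
    · rw [norm_smul, norm_cos_smul_add_sin_smul e hab, mul_one, Real.norm_eq_abs,
        abs_of_nonneg (mul_nonneg hg.1 (decay_pos _ _ _).le)]
      refine (mul_le_of_le_one_right hg.1 ?_).trans hg.2
      refine (decay_le hβc ht.1 fun r _ => hβm r).trans (Real.exp_le_one_iff.2 ?_)
      have := mul_nonneg hεa (sub_nonneg.2 ht.1)
      linarith

end Modes

/-! ### The nonlinearity near the clock trajectory -/

namespace ChainData

variable (P : ChainData H)

theorem field_plane_add {ε x y : ℝ} {w : H} (hε : 0 < ε) (hx : |x| ≤ 3) (hy : |y| ≤ 3)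
    (h0 : inner ℝ (P.e 0) w = 0) (h1 : inner ℝ (P.e 1) w = 0) (hw : ‖w‖ ≤ ε) :
    P.field ε (x • P.e 0 + y • P.e 1 + w) =
      (P.lam0 * x + ε * planarX (x, y)) • P.e 0 + (P.lam1 * y + ε * planarY (x, y)) • P.e 1
      + (balance centralGate (x, y) • ((P.gap0 * inner ℝ (P.e P.c) w) • P.e P.c
          - ((P.lam1 + ε + P.gap0) * trunc ε y) • P.e 1)
        + (ε * swing centralGate (x, y)) • (trunc ε y • P.e P.c - inner ℝ (P.e P.c) w • P.e 1))
      + (balance upperGate (x, y) • P.Dp w + (-(ε * swing upperGate (x, y))) • P.Jp w)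
      + (balance lowerGate (x, y) • P.Dm w + (ε * swing lowerGate (x, y)) • P.Jm w) := by
  set u := x • P.e 0 + y • P.e 1 + w with hu
  have hc := P.two_le_c
  have e0 : inner ℝ (P.e 0) u = x := by
    simp [hu, inner_add_right, inner_smul_right, inner_basis, h0, P.e.orthonormal.1]
  have e1 : inner ℝ (P.e 1) u = y := by
    simp [hu, inner_add_right, inner_smul_right, inner_basis, h1, P.e.orthonormal.1]
  have ec : inner ℝ (P.e P.c) u = inner ℝ (P.e P.c) w := by
    simp [hu, inner_add_right, inner_smul_right, inner_basis, show P.c ≠ 0 by omega,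
      show P.c ≠ 1 by omega]
  have hp : P.plane u = (x, y) := by rw [plane, e0, e1]
  have hr : P.rest u = w := by rw [rest, e0, e1, hu]; abel
  rw [field, mainPart, smallPart, hp, hr, e0, e1, ec, trunc_of_abs_le (by norm_num) hx,
    trunc_of_abs_le (by norm_num) hy, radialTrunc_of_norm_le hε hw,
    trunc_of_abs_le hε ((P.abs_inner_le _ _).trans hw)]
  module

theorem strip_eq_zero_and_deriv_angle {x : ℝ} (hx : ¬ |x| ≤ 5 / 6) :
    strip x = 0 ∧ deriv angle x = 0 := by
  rw [not_le] at hx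
  rcases lt_abs.1 hx with h | h
  · exact ⟨strip_eq_zero (.inr h.le), deriv_angle_of_gt (by linarith)⟩
  · exact ⟨strip_eq_zero (.inl (by linarith)), deriv_angle_of_lt (by linarith)⟩

/-- For `|x| ≤ 5 / 6` only the upper gate is open; elsewhere both `strip` and the derivative of
`angle` vanish, so it does not matter which gate is open. The same formula thus holds during the
whole half-turn. -/
theorem field_upper {ε x y : ℝ} {w : H} (hε : 0 < ε) (hx : |x| ≤ 3) (hy : |y| ≤ 3)
    (h0 : inner ℝ (P.e 0) w = 0) (h1 : inner ℝ (P.e 1) w = 0) (hw : ‖w‖ ≤ ε)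
    (hxy : |x| ≤ 5 / 6 → 1 ≤ y) :
    P.field ε (x • P.e 0 + y • P.e 1 + w) =
      (P.lam0 * x + ε * planarX (x, y)) • P.e 0 + (P.lam1 * y + ε * planarY (x, y)) • P.e 1
      + (strip x • P.Dp w + (-(deriv angle x * (ε * planarX (x, y)))) • P.Jp w) := by
  rw [P.field_plane_add hε hx hy h0 h1 hw]
  by_cases h : |x| ≤ 5 / 6
  · have hy1 := hxy h
    have hy3 := (abs_le.1 hy).2
    simp only [balance, swing,
      centralGate_eq_zero (show 1 / 2 ≤ |y| by rw [abs_of_nonneg] <;> linarith),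
      upperGate_eq_one hy1 hy3, lowerGate,
      upperGate_eq_zero (show -y ≤ 1 / 2 ∨ 7 / 2 ≤ -y from .inl (by linarith))]
    module
  · obtain ⟨h2, h3⟩ := strip_eq_zero_and_deriv_angle h
    simp only [balance, swing, h2, h3]
    module

theorem field_lower {ε x y : ℝ} {w : H} (hε : 0 < ε) (hx : |x| ≤ 3) (hy : |y| ≤ 3)
    (h0 : inner ℝ (P.e 0) w = 0) (h1 : inner ℝ (P.e 1) w = 0) (hw : ‖w‖ ≤ ε)
    (hxy : |x| ≤ 5 / 6 → 1 ≤ -y) :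
    P.field ε (x • P.e 0 + y • P.e 1 + w) =
      (P.lam0 * x + ε * planarX (x, y)) • P.e 0 + (P.lam1 * y + ε * planarY (x, y)) • P.e 1
      + (strip x • P.Dm w + (deriv angle x * (ε * planarX (x, y))) • P.Jm w) := by
  rw [P.field_plane_add hε hx hy h0 h1 hw]
  by_cases h : |x| ≤ 5 / 6
  · have hy1 := hxy h
    have hy3 := (abs_le.1 hy).1
    simp only [balance, swing,
      centralGate_eq_zero (show 1 / 2 ≤ |y| by rw [abs_of_nonpos] <;> linarith),
      lowerGate, upperGate_eq_one hy1 (by linarith),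
      upperGate_eq_zero (show y ≤ 1 / 2 ∨ 7 / 2 ≤ y from .inl (by linarith))]
    module
  · obtain ⟨h2, h3⟩ := strip_eq_zero_and_deriv_angle h
    simp only [balance, swing, h2, h3]
    module

/-- In this region the planar field is the identity, so `e 1` is an unstable direction with rate `ε`
outside the strip. Inside, the correction turns its rate into `lam1 + gap0`, balanced with that of
mode `P.c`. -/
theorem field_central {ε x y z : ℝ} (hε : 0 < ε) (hx0 : 0 ≤ x) (hx : x ≤ 1) (hy : |y| ≤ 1 / 4)
    (hyε : |y| ≤ ε) (hz : |z| ≤ ε) :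
    P.field ε (x • P.e 0 + y • P.e 1 + z • P.e P.c) =
      (P.lam0 * x + ε * x) • P.e 0
      + (P.lam1 * y + ε * y - strip x * (P.lam1 + ε + P.gap0) * y
          - deriv angle x * (ε * x) * z) • P.e 1
      + (strip x * P.gap0 * z + deriv angle x * (ε * x) * y) • P.e P.c := by
  have hc := P.two_le_c
  have hy2 : y ^ 2 ≤ (1 / 4) ^ 2 := by rw [← sq_abs]; gcongr
  have hX : planarX (x, y) = x := by
    rw [planarX, radialRate_eq_one, angularRate_eq_zero] <;> simp only
    · ring
    · nlinarith
    · rw [abs_of_nonneg (by positivity)]; nlinarith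
  have hY : planarY (x, y) = y := by
    rw [planarY, radialRate_eq_one, angularRate_eq_zero] <;> simp only
    · ring
    · nlinarith
    · rw [abs_of_nonneg (by positivity)]; nlinarith
  obtain ⟨hy3, hy4⟩ := abs_le.1 hy
  rw [P.field_plane_add hε (by rw [abs_of_nonneg] <;> linarith) (by linarith)
    (by simp [inner_smul_right, inner_basis, show 0 ≠ P.c by omega])
    (by simp [inner_smul_right, inner_basis, show 1 ≠ P.c by omega])
    (by rwa [norm_smul, P.e.orthonormal.1, mul_one])]
  simp only [balance, swing, centralGate_eq_one hy,
    upperGate_eq_zero (show y ≤ 1 / 2 ∨ 7 / 2 ≤ y from .inl (by linarith)),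
    lowerGate, upperGate_eq_zero (show -y ≤ 1 / 2 ∨ 7 / 2 ≤ -y from .inl (by linarith)), hX, hY,
    trunc_of_abs_le hε hyε, inner_smul_right, inner_basis, if_true]
  module

end ChainData

/-- Wherever the angle is not at an end value the balancing is fully on; this is why `strip` is one
on the whole interval where `angle` varies. -/
theorem sin_angle_mul_cos_angle_mul (x : ℝ) :
    Real.sin (angle x) * Real.cos (angle x) * (1 - strip x) = 0 := by
  rcases le_total x (1 / 3) with h | h
  · simp [angle_of_le h]
  rcases le_total (2 / 3) x with h' | h'
  · simp [angle_of_ge h']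
  · simp [strip_eq_one h h']

theorem hasDerivWithinAt_angle_comp {x : ℝ → ℝ} {x' t : ℝ} {s : Set ℝ}
    (hx : HasDerivWithinAt x x' s t) :
    HasDerivWithinAt (fun t => angle (x t)) (deriv angle (x t) * x') s t :=
  ((contDiff_angle.differentiable (by simp)) (x t)).hasDerivAt.comp_hasDerivWithinAt t hx

/-! ### Transport of the perturbation along the chain -/

namespace ChainData

variable (P : ChainData H)

/-- The data of `P` are adapted to the eigenvalues `ev` and to the chain `c` of modes, whose
consecutive gaps are `2 * d k`. -/
structure IsAdapted (ev : ℕ → ℝ) (c : ℕ → ℕ) (d : ℕ → ℝ) : Prop where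
  pos : ∀ n, 0 < ev n
  lam0_eq : P.lam0 = ev 0
  lam1_eq : P.lam1 = ev 1
  gap0_eq : P.gap0 = d 0
  c_eq : P.c = c 1
  strictMono : StrictMono c
  zero : c 0 = 1
  gap : ∀ k, ev (c (k + 1)) - ev (c k) = 2 * d k
  nonneg : ∀ k, 0 ≤ d k
  upper : ∀ k, k % 2 = 1 → P.Dp (P.e (c k)) = -d k • P.e (c k) ∧
    P.Dp (P.e (c (k + 1))) = d k • P.e (c (k + 1)) ∧
    P.Jp (P.e (c k)) = P.e (c (k + 1)) ∧ P.Jp (P.e (c (k + 1))) = -P.e (c k)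
  lower : ∀ k, k % 2 = 0 → P.Dm (P.e (c k)) = -d k • P.e (c k) ∧
    P.Dm (P.e (c (k + 1))) = d k • P.e (c (k + 1)) ∧
    P.Jm (P.e (c k)) = P.e (c (k + 1)) ∧ P.Jm (P.e (c (k + 1))) = -P.e (c k)

variable {P} {ev : ℕ → ℝ} {c : ℕ → ℕ} {d : ℕ → ℝ}

/-- During one passage of the clock through the strip, the perturbation is transported from one
mode of the chain to the next one. -/
theorem IsAdapted.exists_transport (h : P.IsAdapted ev c d) {ε : ℝ} (hε : 0 < ε) {x y : ℝ → ℝ}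
    (hx : Continuous x) (hy : Continuous y) {s T : ℝ} {k : ℕ}
    (hx' : ∀ t ∈ Ico s T, HasDerivWithinAt x (ε * planarX (x t, y t)) (Ici t) t)
    (hy' : ∀ t ∈ Ico s T, HasDerivWithinAt y (ε * planarY (x t, y t)) (Ici t) t)
    (hb : ∀ t ∈ Ico s T, |x t| ≤ 3 ∧ |y t| ≤ 3) (hs : 1 ≤ (-1) ^ k * x s)
    (hT : 1 ≤ (-1) ^ (k + 1) * x T)
    (hxy : ∀ t ∈ Ico s T, |x t| ≤ 5 / 6 → 1 ≤ (-1) ^ k * y t) :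
    ∃ (n : ℝ → H) (B : ℝ → ℝ), n s = P.e (c (k + 1)) ∧ n T = P.e (c (k + 2)) ∧ (∀ t, ‖n t‖ = 1) ∧
      B s = 1 ∧ (∀ t, 0 < B t) ∧
      (∀ t, s ≤ t → B t ≤ Real.exp (-(ev (c (k + 1)) * (t - s)))) ∧
      ∀ g ∈ Icc 0 ε, IsCoordSolutionOn P.e ev (P.field ε)
        (fun t => x t • P.e 0 + y t • P.e 1 + (g * B t) • n t) s T := by
  have hc : ∀ j, 2 ≤ c (j + 1) := fun j => by
    have := h.strictMono (Nat.succ_pos j); rw [h.zero] at this; exact this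
  have hne : c (k + 1) ≠ c (k + 2) := (h.strictMono (Nat.lt_succ_self _)).ne
  have hxa : Continuous fun t => angle (x t) := contDiff_angle.continuous.comp hx
  have hxs : Continuous fun t => strip (x t) := contDiff_strip.continuous.comp hx
  have hda := fun t ht => hasDerivWithinAt_angle_comp (hx' t ht)
  rcases Nat.even_or_odd k with hk | hk
  -- Upper half-turn: `x` passes from at least `1` to at most `-1`, so `angle` runs from `π / 2` to
  -- `0`. The complementary angle is used, which accounts for the minus sign in front of `Jp`.
  · rw [hk.neg_one_pow] at hs
    simp only [hk.neg_one_pow, one_mul] at hxy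
    rw [hk.add_one.neg_one_pow] at hT
    obtain ⟨h1, h2, h3, h4⟩ := h.upper (k + 1) (by rw [← Nat.odd_iff]; exact hk.add_one)
    obtain ⟨B, hB1, hB0, hB, hsol⟩ := isCoordSolutionOn_chain (e := P.e) (ev := ev)
      (F := P.field ε) (ε := ε) (hc k) (hc (k + 1)) hne (h.gap (k + 1)) (h.nonneg _) h1 h2 h3 h4
      (h.pos _).le hx hy (continuous_const.sub hxa : Continuous fun t => Real.pi / 2 - angle (x t))
      hxs hx' hy' (fun t ht => (hda t ht).const_sub _) (fun t => strip_mem _) (fun t => by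
        simp only [Pi.sub_apply]
        rw [Real.sin_pi_div_two_sub, Real.cos_pi_div_two_sub, mul_comm (Real.cos _)]
        exact sin_angle_mul_cos_angle_mul _)
      (fun t ht w hw0 hw1 hw => by
        rw [P.field_upper hε (hb t ht).1 (hb t ht).2 hw0 hw1 hw (hxy t ht), h.lam0_eq, h.lam1_eq,
          add_comm (ev 0 * x t), add_comm (ev 1 * y t)])
    refine ⟨_, B, ?_, ?_, fun t => norm_cos_smul_add_sin_smul P.e hne (Real.pi / 2 - angle (x t)),
      hB1, hB0, hB, hsol⟩
    · simp [angle_of_ge (show 2 / 3 ≤ x s by linarith)]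
    · simp [angle_of_le (show x T ≤ 1 / 3 by linarith)]
  -- Lower half-turn: `x` comes back from left to right and `angle` itself runs from `0` to `π / 2`.
  · rw [hk.neg_one_pow] at hs
    simp only [hk.neg_one_pow, neg_one_mul] at hxy
    rw [hk.add_one.neg_one_pow] at hT
    obtain ⟨h1, h2, h3, h4⟩ := h.lower (k + 1) (by rw [← Nat.even_iff]; exact hk.add_one)
    obtain ⟨B, hB1, hB0, hB, hsol⟩ := isCoordSolutionOn_chain (e := P.e) (ev := ev)
      (F := P.field ε) (ε := ε) (hc k) (hc (k + 1)) hne (h.gap (k + 1)) (h.nonneg _) h1 h2 h3 h4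
      (h.pos _).le hx hy hxa hxs hx' hy' hda (fun t => strip_mem _)
      (fun t => sin_angle_mul_cos_angle_mul _)
      (fun t ht w hw0 hw1 hw => by
        rw [P.field_lower hε (hb t ht).1 (hb t ht).2 hw0 hw1 hw (hxy t ht), h.lam0_eq, h.lam1_eq,
          add_comm (ev 0 * x t), add_comm (ev 1 * y t)])
    refine ⟨_, B, ?_, ?_, fun t => norm_cos_smul_add_sin_smul P.e hne (angle (x t)),
      hB1, hB0, hB, hsol⟩
    · simp [angle_of_le (show x s ≤ 1 / 3 by linarith)]
    · simp [angle_of_ge (show 2 / 3 ≤ x T by linarith)]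

/-- The difference of the solutions starting at `e 0 + g • e (c 1)` and `e 0` decays
super-exponentially. -/
theorem IsAdapted.exists_decay (h : P.IsAdapted ev c d) {ε : ℝ} (hε : 0 < ε) {K : ℝ} (hK : 0 ≤ K)
    (hF : ∀ u v, ‖P.field ε u - P.field ε v‖ ≤ K * ‖u - v‖) {Γ : ℝ} (hΓ : 0 < Γ)
    (hgrow : ∀ k : ℕ, k / 2 * Γ ≤ ev (c (k + 1))) :
    ∃ C κ : ℝ, 0 < C ∧ 0 < κ ∧ ∀ t, 0 ≤ t → ∃ (p n : H) (E : ℝ), ‖n‖ = 1 ∧ 0 < E ∧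
      E ≤ C * Real.exp (-κ * t ^ 2) ∧ ∀ g ∈ Icc 0 ε, ∀ U : ℝ → H,
        (∀ b, IsCoordSolutionOn P.e ev (P.field ε) U 0 b) →
        U 0 = P.e 0 + g • P.e (c 1) → U t = p + (g * E) • n := by
  obtain ⟨x, y, τ, hx, hy, hx0, hy0, hx', hy', hb, hτ0, hτ, hτle, hxτ, hxy⟩ := exists_clock hε
  have hπ := Real.pi_gt_three
  have hπε : 0 < Real.pi / ε := by positivity
  have hτmono : Monotone τ := monotone_nat_of_le_succ fun k => by linarith [hτ k]
  have hτnn : ∀ k, 0 ≤ τ k := fun k => hτ0 ▸ hτmono (Nat.zero_le k)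
  have htr := fun k => h.exists_transport hε hx hy (s := τ k) (T := τ (k + 1)) (k := k)
    (fun t ht => hx' t ((hτnn k).trans ht.1)) (fun t ht => hy' t ((hτnn k).trans ht.1))
    (fun t ht => hb t ((hτnn k).trans ht.1)) (hxτ k) (hxτ (k + 1))
    (fun t ht => hxy k t (Ico_subset_Icc_self ht))
  choose n B hns hnT hn hBs hB0 hB hsol using htr
  set μ : ℝ := Γ * Real.pi / (4 * ε) with hμ
  have hμ0 : 0 < μ := by positivity
  -- Half-turn `k` lasts at least `π / ε` and the rate is at least `k Γ / 2`; `μ` is normalized so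
  -- that the exponents add up to `μ * k * (k - 1)`.
  have hBstep : ∀ k, B k (τ (k + 1)) ≤ Real.exp (-(2 * μ * k)) := fun k => by
    refine (hB k _ (hτmono (Nat.le_succ k))).trans (Real.exp_le_exp.2 (neg_le_neg ?_))
    calc 2 * μ * k = k / 2 * Γ * (Real.pi / ε) := by rw [hμ]; field_simp; ring
      _ ≤ ev (c (k + 1)) * (τ (k + 1) - τ k) :=
        mul_le_mul (hgrow k) (by linarith [hτ k]) hπε.le (h.pos _).le
  have hB1 : ∀ k t, τ k ≤ t → B k t ≤ 1 := fun k t ht =>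
    (hB k t ht).trans (Real.exp_le_one_iff.2 (by
      have := mul_nonneg (h.pos (c (k + 1))).le (sub_nonneg.2 ht); linarith))
  -- The factor `E` is chosen before `g` and `U`. The clock and the direction of the perturbation
  -- are therefore common to all these solutions, and the distance of two of them is exactly
  -- proportional to the difference of the values of `g`.
  have hstate : ∀ k : ℕ, ∃ E, 0 < E ∧ E ≤ 1 ∧ E ≤ Real.exp (-(μ * (k * (k - 1)))) ∧
      ∀ g ∈ Icc 0 ε, ∀ U : ℝ → H, (∀ b, IsCoordSolutionOn P.e ev (P.field ε) U 0 b) →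
        U 0 = P.e 0 + g • P.e (c 1) → ∀ t ∈ Icc (τ k) (τ (k + 1)),
        U t = x t • P.e 0 + y t • P.e 1 + (g * E * B k t) • n k t := by
    intro k
    induction k with
    | zero =>
      refine ⟨1, one_pos, le_rfl, by simp, fun g hg U hU hU0 t ht => ?_⟩
      have := ((hU _).mono (hτnn 0) le_rfl).eq_of_eq h.pos hK hF (hsol 0 g hg)
        (by
          have h1 := hBs 0
          have h2 := hns 0
          rw [hτ0] at h1 h2 ⊢
          simp [hU0, hx0, hy0, h1, h2]) ht
      rw [this, mul_one]
    | succ k ih =>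
      obtain ⟨E, hE0, hE1, hE, hEU⟩ := ih
      have hpos := mul_pos hE0 (hB0 k (τ (k + 1)))
      have hle1 : E * B k (τ (k + 1)) ≤ 1 :=
        mul_le_one₀ hE1 (hB0 _ _).le (hB1 k _ (hτmono (Nat.le_succ k)))
      refine ⟨E * B k (τ (k + 1)), hpos, hle1, ?_, fun g hg U hU hU0 t ht => ?_⟩
      · calc E * B k (τ (k + 1)) ≤ Real.exp (-(μ * (k * (k - 1)))) * Real.exp (-(2 * μ * k)) :=
            mul_le_mul hE (hBstep k) (hB0 _ _).le (Real.exp_pos _).le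
          _ = _ := by rw [← Real.exp_add]; congr 1; push_cast; ring
      · have hg' : g * (E * B k (τ (k + 1))) ∈ Icc 0 ε :=
          ⟨mul_nonneg hg.1 hpos.le, (mul_le_of_le_one_right hg.1 hle1).trans hg.2⟩
        have h0 := hEU g hg U hU hU0 _ ⟨hτmono (Nat.le_succ k), le_rfl⟩
        exact ((hU _).mono (hτnn _) le_rfl).eq_of_eq h.pos hK hF (hsol (k + 1) _ hg')
          (by rw [h0, hns, hnT, hBs, mul_one, mul_assoc]) ht
  choose E hE0 hE1 hE hEU using hstate
  -- Within half-turn `k`, `ε * t ≤ (k + 1) π + 1 ≤ 5 (k + 1)`, whence `(ε * t) ^ 2 / 50 ≤ (k + 1) ^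
  -- 2 / 2 ≤ k (k - 1) + 5`.
  refine ⟨Real.exp (5 * μ), μ * ε ^ 2 / 50, Real.exp_pos _, by positivity, fun t ht => ?_⟩
  have hex : ∃ k, t < τ (k + 1) := by
    have hlin : ∀ k : ℕ, k * (Real.pi / ε) ≤ τ k := fun k => by
      induction k with
      | zero => simp [hτ0]
      | succ k ih => push_cast; linarith [hτ k]
    obtain ⟨k, hk⟩ := exists_nat_gt (t / (Real.pi / ε))
    refine ⟨k, ((div_lt_iff₀ hπε).1 hk).trans_le ((hlin k).trans (hτmono (Nat.le_succ k)))⟩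
  classical
  obtain ⟨k, hk, hmin⟩ : ∃ k, t < τ (k + 1) ∧ τ k ≤ t := by
    refine ⟨Nat.find hex, Nat.find_spec hex, ?_⟩
    rcases hj : Nat.find hex with _ | j
    · rwa [hτ0]
    · exact not_lt.1 (Nat.find_min hex (by omega))
  refine ⟨x t • P.e 0 + y t • P.e 1, n k t, E k * B k t, hn k t, mul_pos (hE0 k) (hB0 k t), ?_,
    fun g hg U hU hU0 => ?_⟩
  · calc E k * B k t ≤ Real.exp (-(μ * (k * (k - 1)))) * 1 :=
        mul_le_mul (hE k) (hB1 k t hmin) (hB0 _ _).le (Real.exp_pos _).le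
      _ ≤ Real.exp (5 * μ) * Real.exp (-(μ * ε ^ 2 / 50) * t ^ 2) := by
        rw [mul_one, ← Real.exp_add, Real.exp_le_exp]
        have h1 : ε * t ≤ 5 * (k + 1) := by
          have h2 := hk.le.trans (hτle (k + 1))
          rw [le_div_iff₀ hε] at h2
          push_cast at h2
          have h3 := Real.pi_lt_four
          have : (0 : ℝ) ≤ k := Nat.cast_nonneg k
          nlinarith
        have h2 : (ε * t) ^ 2 ≤ (5 * (k + 1)) ^ 2 := by gcongr
        have h3 : (ε * t) ^ 2 / 50 ≤ k * (k - 1) + 5 := by nlinarith [sq_nonneg ((k : ℝ) - 2)]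
        nlinarith [mul_le_mul_of_nonneg_left h3 hμ0.le]
  · rw [hEU k g hg U hU hU0 t ⟨hmin, hk.le⟩, mul_assoc]

/-- The backward part of the two trajectories. -/
theorem IsAdapted.exists_backward (h : P.IsAdapted ev c d) {ε : ℝ} (hε : 0 < ε) (hε1 : ε ≤ 1) :
    ∃ (n : ℝ → H) (B : ℝ → ℝ), n 0 = P.e (c 1) ∧ (∀ t, ‖n t‖ = 1) ∧ (∀ t, 0 < B t) ∧
      (∀ t ≤ 0, B t ≤ 6) ∧ ∀ g ∈ Icc 0 (ε / 24), ∀ a, IsCoordSolutionOn P.e ev (P.field ε)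
        (fun t => Real.exp (ε * t) • P.e 0 + (g * B t) • n t) a 0 := by
  have hc2 : 2 ≤ c 1 := h.c_eq ▸ P.two_le_c
  have hne : 1 ≠ c 1 := by omega
  have hgap := h.gap 0
  rw [h.zero, zero_add] at hgap
  have hd := h.nonneg 0
  have hev := h.pos
  set x : ℝ → ℝ := fun t => Real.exp (ε * t) with hxdef
  have hx : Continuous x := by fun_prop
  have hx' : ∀ t, HasDerivAt x (ε * x t) t := fun t =>
    (((hasDerivAt_id t).const_mul ε).exp).congr_deriv (by simp [hxdef]; ring)
  have hxa : Continuous fun t => angle (x t) := contDiff_angle.continuous.comp hx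
  have hxs : Continuous fun t => strip (x t) := contDiff_strip.continuous.comp hx
  set β₁ : ℝ → ℝ := fun t => -ε + strip (x t) * (ev 1 + ε + d 0) with hβ₁
  set β₂ : ℝ → ℝ := fun t => ev (c 1) - strip (x t) * d 0 with hβ₂
  set β : ℝ → ℝ := fun t => β₁ t * Real.cos (angle (x t)) ^ 2
    + β₂ t * Real.sin (angle (x t)) ^ 2 with hβ
  have hβc : Continuous β := by fun_prop
  have hβm : ∀ t, -ε ≤ β t := fun t => by
    obtain ⟨h0, h1⟩ := strip_mem (x t)
    have h2 := Real.sin_sq_add_cos_sq (angle (x t))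
    have h3 : -ε ≤ β₁ t := le_add_of_nonneg_right (mul_nonneg h0 (by linarith [hev 1]))
    have h4 : -ε ≤ β₂ t := by
      have := mul_le_of_le_one_left hd h1
      simp only [hβ₂]
      linarith [hev 1]
    have h5 := mul_le_mul_of_nonneg_right h3 (sq_nonneg (Real.cos (angle (x t))))
    have h6 := mul_le_mul_of_nonneg_right h4 (sq_nonneg (Real.sin (angle (x t))))
    have h7 : -ε = -ε * Real.cos (angle (x t)) ^ 2 + -ε * Real.sin (angle (x t)) ^ 2 := by
      linear_combination ε * h2
    simp only [hβ]
    linarith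
  -- At this time `x = 1 / 6`. Earlier, the strip has not been reached and the amplitude grows at
  -- rate `ε` from zero at `-∞`; later, `-ε ≤ β` bounds its growth up to time `0` by `exp (-ε * s) =
  -- 6`.
  set s : ℝ := -(Real.log 6 / ε) with hs
  have hlog : 0 < Real.log 6 := Real.log_pos (by norm_num)
  have hs0 : s ≤ 0 := by rw [hs, neg_nonpos]; positivity
  have hxs6 : ∀ t ≤ s, x t ≤ 1 / 6 := fun t ht => by
    have : ε * t ≤ -Real.log 6 := by
      calc ε * t ≤ ε * s := by gcongr
        _ = -Real.log 6 := by rw [hs]; field_simp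
    calc x t ≤ Real.exp (-Real.log 6) := Real.exp_le_exp.2 this
      _ = 1 / 6 := by rw [Real.exp_neg, Real.exp_log (by norm_num), one_div]
  have hB6 : ∀ t ≤ 0, decay β s t ≤ 6 := fun t ht => by
    rcases le_total t s with hts | hst
    · refine (decay_le_one hts fun r hr => ?_).trans (by norm_num)
      have hr' := hxs6 r hr.2
      simp only [hβ, hβ₁, strip_eq_zero (.inl hr'), angle_of_le (show x r ≤ 1 / 3 by linarith)]
      simp [hε.le]
    · refine (decay_le hβc hst fun r _ => hβm r).trans ?_
      calc Real.exp (-(-ε * (t - s))) ≤ Real.exp (Real.log 6) := by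
            refine Real.exp_le_exp.2 ?_
            have : ε * s = -Real.log 6 := by rw [hs]; field_simp
            nlinarith
        _ = 6 := Real.exp_log (by norm_num)
  refine ⟨fun t => Real.cos (angle (x t)) • P.e 1 + Real.sin (angle (x t)) • P.e (c 1),
    decay β s, ?_, fun t => norm_cos_smul_add_sin_smul P.e hne _, decay_pos β s, hB6,
    fun g hg a => ?_⟩
  · simp [hxdef, angle_of_ge (show (2 : ℝ) / 3 ≤ 1 by norm_num)]
  have hA : ∀ t, HasDerivAt (fun t => g * decay β s t) (-β t * (g * decay β s t)) t := fun t =>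
    ((hasDerivAt_decay hβc s t).const_mul g).congr_deriv (by ring)
  have hpair := fun t => hasDerivWithinAt_pair (hA t)
    (hasDerivWithinAt_angle_comp (hx' t).hasDerivWithinAt) (β₁ := β₁ t) (β₂ := β₂ t) (by
      have h1 := sin_angle_mul_cos_angle_mul (x t)
      simp only [hβ₁, hβ₂]
      linear_combination (-(ev 1 + ε + d 0) - d 0) * h1
        + (-Real.sin (angle (x t)) * Real.cos (angle (x t))) * hgap)
  have hBc := continuous_decay hβc s
  refine isCoordSolutionOn_of_modes (n := ![0, 1, c 1])
    (f := ![x, fun t => g * decay β s t * Real.cos (angle (x t)),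
      fun t => g * decay β s t * Real.sin (angle (x t))])
    (f' := ![fun t => ε * x t, fun t => -β₁ t * (g * decay β s t * Real.cos (angle (x t)))
        - deriv angle (x t) * (ε * x t) * (g * decay β s t * Real.sin (angle (x t))),
      fun t => -β₂ t * (g * decay β s t * Real.sin (angle (x t)))
        + deriv angle (x t) * (ε * x t) * (g * decay β s t * Real.cos (angle (x t)))])
    (fun t => ?_) (fun i => ?_) (fun i t ht => ?_) fun t ht => ?_
  · simp [Fin.sum_univ_three]; module
  · fin_cases i
    · exact hx
    · exact (continuous_const.mul hBc).mul (Real.continuous_cos.comp hxa)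
    · exact (continuous_const.mul hBc).mul (Real.continuous_sin.comp hxa)
  · fin_cases i
    · exact (hx' t).hasDerivWithinAt
    · exact (hpair t).1
    · exact (hpair t).2
  · have hA4 : |g * decay β s t| ≤ ε / 4 := by
      rw [abs_of_nonneg (mul_nonneg hg.1 (decay_pos _ _ _).le)]
      calc g * decay β s t ≤ ε / 24 * 6 :=
            mul_le_mul hg.2 (hB6 t ht.2.le) (decay_pos _ _ _).le (by positivity)
        _ = ε / 4 := by ring
    have hcos : |g * decay β s t * Real.cos (angle (x t))| ≤ ε / 4 := by
      rw [abs_mul]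
      exact (mul_le_of_le_one_right (abs_nonneg _) (Real.abs_cos_le_one _)).trans hA4
    have hsin : |g * decay β s t * Real.sin (angle (x t))| ≤ ε / 4 := by
      rw [abs_mul]
      exact (mul_le_of_le_one_right (abs_nonneg _) (Real.abs_sin_le_one _)).trans hA4
    have hx1 : x t ≤ 1 := Real.exp_le_one_iff.2 (mul_nonpos_of_nonneg_of_nonpos hε.le ht.2.le)
    have hfield := P.field_central hε (Real.exp_pos (ε * t)).le hx1
      (hcos.trans (by linarith)) (hcos.trans (by linarith)) (hsin.trans (by linarith))
    rw [h.c_eq, h.lam0_eq, h.lam1_eq, h.gap0_eq] at hfield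
    rw [smul_add, smul_smul, smul_smul, ← add_assoc, hfield]
    simp [Fin.sum_univ_three, hβ₁, hβ₂, hxdef]
    module

end ChainData

theorem IsCoordSolutionOn.congr {e : HilbertBasis ℕ ℝ H} {ev : ℕ → ℝ} {F : H → H} {u v : ℝ → H}
    {a b : ℝ} (h : IsCoordSolutionOn e ev F u a b) (huv : ∀ t, a ≤ t → v t = u t) :
    IsCoordSolutionOn e ev F v a b := by
  refine ⟨h.1.congr fun t ht => huv t ht.1, fun n t ht => ?_⟩
  rw [huv t ht.1]
  exact (h.2 n t ht).congr (fun s hs => by rw [huv s (ht.1.trans hs)]) (by rw [huv t ht.1])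

/-- A solution on `(-∞, 0]` extends to a complete trajectory. -/
theorem _root_.IsSolutionSemigroup.exists_complete {A : H →ₗ.[ℝ] H} {e : HilbertBasis ℕ ℝ H}
    {ev : ℕ → ℝ} {F : H → H} {S : ℝ → H → H} (hS : IsSolutionSemigroup A F S)
    (hev : ∀ n, 0 < ev n) (he : ∀ n, ∃ h : e n ∈ A.domain, A ⟨e n, h⟩ = ev n • e n)
    {K : ℝ} (hK : 0 ≤ K) (hF : ∀ x y, ‖F x - F y‖ ≤ K * ‖x - y‖) {b : ℝ → H}
    (hb : ∀ a, IsCoordSolutionOn e ev F b a 0) :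
    ∃ u : ℝ → H, (∀ t ≤ 0, u t = b t) ∧ (∀ t, 0 ≤ t → u t = S t (b 0)) ∧
      ∀ s t, 0 ≤ t → u (s + t) = S t (u s) := by
  set u : ℝ → H := fun t => S (max t 0) (b (min t 0)) with hu
  have hneg : ∀ t ≤ 0, u t = b t := fun t ht => by
    simp only [hu, max_eq_right ht, min_eq_left ht, (hS.1 _).1]
  have hpos : ∀ t, 0 ≤ t → u t = S t (b 0) := fun t ht => by
    simp only [hu, max_eq_left ht, min_eq_right ht]
  refine ⟨u, hneg, hpos, fun s t ht => ?_⟩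
  rcases le_total 0 s with hs | hs
  · rw [hpos _ (add_nonneg hs ht), hpos s hs, hS.apply_add hev he hK hF hs ht]
  rcases le_total (s + t) 0 with hst | hst
  · rw [hneg _ hst, hneg s hs, hS.eq_of_coord hev he hK hF (le_add_of_nonneg_right ht)
      ((hb s).mono le_rfl hst), add_sub_cancel_left]
  -- When the time interval crosses zero, uniqueness identifies `b 0` with the state reached from `b
  -- s`, and the semigroup law joins the two pieces.
  · rw [hpos _ hst, hneg s hs, hS.eq_of_coord hev he hK hF hs (hb s), zero_sub,
      ← hS.apply_add hev he hK hF (neg_nonneg.2 hs) hst, neg_add_cancel_left]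

/-! ### The two converging trajectories -/

namespace ChainData

variable {P : ChainData H} {ev : ℕ → ℝ} {c : ℕ → ℕ} {d : ℕ → ℝ}

/-- Two bounded complete trajectories which approach each other super-exponentially. -/
theorem IsAdapted.exists_trajectories (h : P.IsAdapted ev c d) {ε : ℝ} (hε : 0 < ε) (hε1 : ε ≤ 1)
    {K : ℝ} (hK : 0 ≤ K) (hF : ∀ u v, ‖P.field ε u - P.field ε v‖ ≤ K * ‖u - v‖) {Γ : ℝ}
    (hΓ : 0 < Γ) (hgrow : ∀ k : ℕ, k / 2 * Γ ≤ ev (c (k + 1))) {A : H →ₗ.[ℝ] H}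
    {S : ℝ → H → H} (hS : IsSolutionSemigroup A (P.field ε) S)
    (he : ∀ n, ∃ h : P.e n ∈ A.domain, A ⟨P.e n, h⟩ = ev n • P.e n) {r : ℝ}
    (hr : ∀ x t, 0 ≤ t → ‖S t x‖ ≤ ‖x‖ + r) :
    ∃ u v : ℝ → H, (∀ s t, 0 ≤ t → u (s + t) = S t (u s)) ∧
      (∀ s t, 0 ≤ t → v (s + t) = S t (v s)) ∧ (∀ t, ‖u t‖ ≤ 2 + r) ∧ (∀ t, ‖v t‖ ≤ 2 + r) ∧
      (∀ b, IsCoordSolutionOn P.e ev (P.field ε) u 0 b) ∧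
      (∀ b, IsCoordSolutionOn P.e ev (P.field ε) v 0 b) ∧ (∀ t, u t ≠ v t) ∧
      ∃ C κ : ℝ, 0 < C ∧ 0 < κ ∧ ∀ t, 0 ≤ t → ‖u t - v t‖ ≤ C * Real.exp (-κ * t ^ 2) := by
  obtain ⟨n, B, hn0, hn, hB0, hB, hsol⟩ := h.exists_backward hε hε1
  obtain ⟨C, κ, hC, hκ, hdec⟩ := h.exists_decay hε hK hF hΓ hgrow
  have hr0 : 0 ≤ r := by simpa [(hS.1 0).1] using hr 0 0 le_rfl
  have hamp : ∀ g ∈ Icc 0 (ε / 24), ∀ t ≤ 0, g * B t ∈ Icc 0 (ε / 4) := fun g hg t ht =>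
    ⟨mul_nonneg hg.1 (hB0 t).le, by
      calc g * B t ≤ ε / 24 * 6 := mul_le_mul hg.2 (hB t ht) (hB0 t).le (by positivity)
        _ = ε / 4 := by ring⟩
  have hnorm : ∀ g ∈ Icc 0 (ε / 24), ∀ t ≤ 0,
      ‖Real.exp (ε * t) • P.e 0 + (g * B t) • n t‖ ≤ 2 := fun g hg t ht => by
    have h1 := hamp g hg t ht
    have h2 : Real.exp (ε * t) ≤ 1 :=
      Real.exp_le_one_iff.2 (mul_nonpos_of_nonneg_of_nonpos hε.le ht)
    refine (norm_add_le _ _).trans ?_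
    rw [norm_smul, norm_smul, hn, P.e.orthonormal.1, Real.norm_eq_abs, Real.norm_eq_abs,
      Real.abs_exp, abs_of_nonneg h1.1]
    linarith [h1.2]
  have key : ∀ g ∈ Icc 0 (ε / 24), ∃ u : ℝ → H,
      (∀ t ≤ 0, u t = Real.exp (ε * t) • P.e 0 + (g * B t) • n t) ∧
      (∀ s t, 0 ≤ t → u (s + t) = S t (u s)) ∧ (∀ t, ‖u t‖ ≤ 2 + r) ∧
      (∀ b, IsCoordSolutionOn P.e ev (P.field ε) u 0 b) ∧
      u 0 = P.e 0 + (g * B 0) • P.e (c 1) := fun g hg => by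
    obtain ⟨u, hneg, hpos, hu⟩ := hS.exists_complete h.pos he hK hF (hsol g hg)
    refine ⟨u, hneg, hu, fun t => ?_, fun b => (hS.coord he _ b).congr hpos, ?_⟩
    · rcases le_total t 0 with ht | ht
      · rw [hneg t ht]; linarith [hnorm g hg t ht]
      · rw [hpos t ht]
        exact (hr _ t ht).trans (by linarith [hnorm g hg 0 le_rfl])
    · rw [hneg 0 le_rfl, hn0]; simp
  -- The value `0` gives the unperturbed clock and `ε / 24` the largest admissible perturbation.
  -- Their difference is an explicit positive amplitude times a unit vector at every time, so the
  -- trajectories never meet.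
  have hg0 : (0 : ℝ) ∈ Icc 0 (ε / 24) := ⟨le_rfl, by positivity⟩
  have hg1 : ε / 24 ∈ Icc 0 (ε / 24) := ⟨by positivity, le_rfl⟩
  obtain ⟨u, hu1, hu2, hu3, hu4, hu5⟩ := key 0 hg0
  obtain ⟨v, hv1, hv2, hv3, hv4, hv5⟩ := key _ hg1
  have hBpos : ∀ t, 0 < ε / 24 * B t := fun t => mul_pos (by positivity) (hB0 t)
  have hBε := hamp _ hg1 0 le_rfl
  have hdiff : ∀ t, 0 ≤ t → ∃ E, 0 < E ∧ E ≤ C * Real.exp (-κ * t ^ 2) ∧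
      ‖u t - v t‖ = ε / 24 * B 0 * E := fun t ht => by
    obtain ⟨p, m, E, hm, hE0, hE, hU⟩ := hdec t ht
    refine ⟨E, hE0, hE, ?_⟩
    rw [hU 0 ⟨le_rfl, hε.le⟩ u hu4 (by rw [hu5, zero_mul]),
      hU _ ⟨hBε.1, hBε.2.trans (by linarith)⟩ v hv4 hv5, zero_mul, zero_smul, add_zero,
      sub_add_cancel_left, norm_neg, norm_smul, hm, mul_one, Real.norm_eq_abs,
      abs_of_pos (mul_pos (hBpos 0) hE0)]
  refine ⟨u, v, hu2, hv2, hu3, hv3, hu4, hv4, fun t => ?_, C, κ, hC, hκ, fun t ht => ?_⟩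
  · rw [← sub_ne_zero, ← norm_ne_zero_iff]
    rcases le_total t 0 with ht | ht
    · rw [hu1 t ht, hv1 t ht, zero_mul, zero_smul, add_zero, sub_add_cancel_left, norm_neg,
        norm_smul, hn, mul_one, norm_ne_zero_iff]
      exact (hBpos t).ne'
    · obtain ⟨E, hE0, -, hE⟩ := hdiff t ht
      rw [hE]
      exact (mul_pos (hBpos 0) hE0).ne'
  · obtain ⟨E, hE0, hE1, hE⟩ := hdiff t ht
    rw [hE]
    exact (mul_le_of_le_one_left hE0.le (by linarith [hBε.2])).trans hE1

end ChainData

theorem exists_adapted_chainData (e : HilbertBasis ℕ ℝ H) {ev : ℕ → ℝ} (hev : ∀ n, 0 < ev n)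
    (hmono : Monotone ev) (htop : Tendsto ev atTop atTop) {Γ : ℝ} (hΓ : 0 ≤ Γ)
    (hgap : ∀ n, ev (n + 1) - ev n ≤ Γ) :
    ∃ (P : ChainData H) (c : ℕ → ℕ) (d : ℕ → ℝ), P.e = e ∧ P.Δ = Γ / 2 ∧ P.IsAdapted ev c d ∧
      ∀ k : ℕ, k / 2 * Γ ≤ ev (c (k + 1)) := by
  obtain ⟨c, hc, hc0, hcgap, hgrow⟩ := exists_chain hev hmono htop hΓ hgap
  set d : ℕ → ℝ := fun k => (ev (c (k + 1)) - ev (c k)) / 2 with hd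
  have hd0 : ∀ k, 0 ≤ d k := fun k =>
    div_nonneg (sub_nonneg.2 (hmono (hc (Nat.lt_succ_self k)).le)) (by norm_num)
  have hdΔ : ∀ k, d k ≤ Γ / 2 := fun k => by
    have := hcgap k
    simp only [hd]
    linarith
  obtain ⟨Dp, Jp, bp, hDp, hJp, hbp, hup⟩ :=
    exists_pair_operators e hc (q := 1) (by norm_num) hd0 hdΔ
  obtain ⟨Dm, Jm, bm, hDm, hJm, hbm, hlow⟩ :=
    exists_pair_operators e hc (q := 0) (by norm_num) hd0 hdΔ
  have hc2 : 2 ≤ c 1 := by have := hc Nat.zero_lt_one; rw [hc0] at this; exact this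
  exact ⟨⟨e, ev 0, ev 1, d 0, Γ / 2, c 1, bp, bm, Dp, Dm, Jp, Jm, (hev 0).le,
    hmono (Nat.zero_le 1), hd0 0, hdΔ 0, hc2, hDp, hDm, hJp, hJm, hbp, hbm⟩, c, d, rfl, rfl,
    ⟨hev, rfl, rfl, rfl, rfl, hc, hc0, fun k => by simp only [hd]; ring, hd0, hup, hlow⟩, hgrow⟩

end SemilinearParabolic

/-! ### The main theorem -/

theorem theorem2p1 {H : Type*} [NormedAddCommGroup H] [InnerProductSpace ℝ H] [CompleteSpace H]
    -- a positive self-adjoint operator with compact inverse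
    (A : H →ₗ.[ℝ] H) (hA_selfAdjoint : IsSelfAdjoint A)
    (hA_pos : ∀ x : A.domain, (x : H) ≠ 0 → 0 < inner ℝ (A x) (x : H))
    (hA_inv : HasCompactInverse A)
    -- its eigenvalues in increasing order, counted with multiplicity, and the corresponding
    -- orthonormal basis of eigenvectors; the numbering starts at 0
    (ev : ℕ → ℝ) (e : HilbertBasis ℕ ℝ H) (hev_mono : Monotone ev)
    (hev : ∀ n, ∃ h : e n ∈ A.domain, A ⟨e n, h⟩ = ev n • e n)
    -- finite spectral gap exponent
    (hgap : BddAbove (range fun n => ev (n + 1) - ev n))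
    (L : ℝ) (hL : (⨆ n, (ev (n + 1) - ev n)) / 2 < L) (hL2 : ev 1 < L) :
    ∃ F : H → H, ContDiff ℝ ∞ F ∧ (∀ x y, ‖F x - F y‖ ≤ L * ‖x - y‖) ∧
      ∃ S : ℝ → H → H, IsSolutionSemigroup A F S ∧
        ∃ 𝒜 : Set H, IsGlobalAttractor S 𝒜 ∧
          -- two trajectories in the attractor that approach each other super-exponentially
          (∃ u v : ℝ → H, IsCompleteTrajectoryIn S 𝒜 u ∧ IsCompleteTrajectoryIn S 𝒜 v ∧
            (∀ t, u t ≠ v t) ∧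
            ∃ C κ : ℝ, 0 < C ∧ 0 < κ ∧
              ∀ t, 0 ≤ t → ‖u t - v t‖ ≤ C * Real.exp (-κ * t ^ 2)) ∧
          -- no bi-Lipschitz Mañé projection
          (∀ (V : Submodule ℝ H) [FiniteDimensional ℝ V], ¬ IsBiLipschitzManeProjection 𝒜 V) ∧
          -- no invariant finite-dimensional Lipschitz submanifold contains the attractor
          ¬ ∃ (n : ℕ) (M : Set H), IsLipschitzSubmanifold n M ∧
            (∀ t, 0 ≤ t → S t '' M ⊆ M) ∧ 𝒜 ⊆ M := by
  have hpos := SemilinearParabolic.eigenvalue_pos hA_pos hev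
  have hA := SemilinearParabolic.inner_basis_apply hA_selfAdjoint hev
  have htop := SemilinearParabolic.tendsto_eigenvalue hA_inv hpos hev_mono hev
  set Γ : ℝ := ⨆ n, (ev (n + 1) - ev n) with hΓdef
  have hle : ∀ n, ev (n + 1) - ev n ≤ Γ := le_ciSup hgap
  -- Without a positive gap the eigenvalues would be nonincreasing, although they tend to infinity.
  -- Positivity makes the rates along the chain grow linearly.
  have hΓ : 0 < Γ := by
    obtain ⟨n, hn⟩ : ∃ n, 0 < ev (n + 1) - ev n := by
      by_contra! hcon
      obtain ⟨n, hn⟩ := (htop.eventually_gt_atTop (ev 0)).exists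
      exact hn.not_ge (antitone_nat_of_succ_le (fun k => sub_nonpos.1 (hcon k)) (Nat.zero_le n))
    exact hn.trans_le (hle n)
  have hK : 0 ≤ L := ((hpos 1).trans hL2).le
  obtain ⟨P, c, d, rfl, hPΔ, hP, hgrow⟩ :=
    SemilinearParabolic.exists_adapted_chainData e hpos hev_mono htop hΓ.le hle
  obtain ⟨ε, hε, hε1, hF⟩ :=
    P.exists_norm_field_sub_le (L := L) (by rwa [hP.lam1_eq]) (by rwa [hPΔ])
  obtain ⟨C, hC⟩ := P.exists_norm_field_le hε hε1
  have hC0 : 0 ≤ C := (norm_nonneg _).trans (hC 0)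
  obtain ⟨S, hS, htail⟩ :=
    SemilinearParabolic.exists_solutionSemigroup hpos hev_mono hev hA hK hF hC
  obtain ⟨𝒜, h𝒜, hmem⟩ := SemilinearParabolic.exists_globalAttractor_of_tail hpos htop hC0
    (fun s t x hs ht => hS.apply_add hpos hev hK hF hs ht x)
    (fun t ht => hS.continuous hpos hev hK hF ht) htail
  -- The tail estimate at `N = 0` controls the whole norm. It keeps the two complete trajectories
  -- bounded, which places them in the attractor.
  have hr : ∀ x t, 0 ≤ t → ‖S t x‖ ≤ ‖x‖ + C / ev 0 := fun x t ht => by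
    have h1 := htail x t ht 0
    rw [SemilinearParabolic.tailProj_zero, SemilinearParabolic.tailProj_zero] at h1
    have h2 : Real.exp (-(ev 0 * t)) ≤ 1 :=
      Real.exp_le_one_iff.2 (neg_nonpos.2 (mul_nonneg (hpos 0).le ht))
    have h3 := mul_le_of_le_one_left (norm_nonneg x) h2
    have h4 := mul_le_of_le_one_left (div_nonneg hC0 (hpos 0).le)
      (show 1 - Real.exp (-(ev 0 * t)) ≤ 1 by linarith [Real.exp_pos (-(ev 0 * t))])
    linarith
  obtain ⟨u, v, hu, hv, hur, hvr, hu0, hv0, hne, C', κ, hC', hκ, hdec⟩ :=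
    hP.exists_trajectories hε hε1 hK hF hΓ hgrow hS hev hr
  have hu𝒜 := hmem u _ hur hu
  have hv𝒜 := hmem v _ hvr hv
  refine ⟨P.field ε, P.contDiff_field hε, hF, S, hS, 𝒜, h𝒜,
    ⟨u, v, ⟨hu𝒜, hu⟩, ⟨hv𝒜, hv⟩, hne, C', κ, hC', hκ, hdec⟩, fun V _ => ?_, ?_⟩
  · exact SemilinearParabolic.not_isBiLipschitzManeProjection hpos hK hF hu0 hv0 hne hκ hdec
      h𝒜.isCompact hu𝒜 hv𝒜 V
  · rintro ⟨n, M, hM, -, hsub⟩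
    exact SemilinearParabolic.not_subset_lipschitzSubmanifold hpos hK hF hu0 hv0 hne hκ hdec
      h𝒜.isCompact hu𝒜 hv𝒜 hM hsub
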